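/- Let $\Gamma$ be a (discrete) group. $C^*$-algebras are complex and not assumed to be unital, and $\hat\otimes$ denotes the maximal tensor product. The full group $C^*$-algebra $C^*(\Gamma)$ carries the comultiplication $\Delta\colon C^*(\Gamma)\to C^*(\Gamma)\hat\otimes C^*(\Gamma)$, $\gamma\mapsto\gamma\otimes\gamma$. A $(\mathbb{C},\Gamma)$-$C^*$-algebra is a $C^*$-algebra $A$ with injective $*$-homomorphisms $\delta_A\colon A\to C^*(\Gamma)\hat\otimes A$ and $\bar\delta_A\colon A\to A\hat\otimes C^*(\Gamma)$ such that $$(\mathrm{id}\hat\otimes\delta_A)\delta_A=(\Delta\hat\otimes\mathrm{id})\delta_A,\qquad (\bar\delta_A\hat\otimes\mathrm{id})\bar\delta_A=(\mathrm{id}\hat\otimes\Delta)\bar\delta_A,\qquad (\delta_A\hat\otimes\mathrm{id})\bar\delta_A=(\mathrm{id}\hat\otimes\bar\delta_A)\delta_A .$$ A morphism $\pi\colon A\to C$ is a $*$-homomorphism with $\delta_C\pi=(\mathrm{id}\hat\otimes\pi)\delta_A$ and $\bar\delta_C\pi=(\pi\hat\otimes\mathrm{id})\bar\delta_A$. A short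 exact sequence of $(\mathbb{C},\Gamma)$-$C^*$-algebras is a sequence of morphisms $J\xrightarrow{\iota}A\xrightarrow{\pi}C$ with $\ker\iota=0$, $\iota(J)=\ker\pi$ and $\pi(A)=C$. The maximal cotensor product of $A$ and $C$ is the $C^*$-subalgebra $$A\hat\otimes^{\Gamma}C:=\{x\in A\hat\otimes C:(\bar\delta_A\hat\otimes\mathrm{id})(x)=(\mathrm{id}\hat\otimes\delta_C)(x)\}\subseteq A\hat\otimes C ,$$ and, for morphisms $\phi\colon A\to A'$ and $\psi\colon C\to C'$, the map $\phi\hat\otimes^{\Gamma}\psi\colon A\hat\otimes^\Gamma C\to A'\hat\otimes^\Gamma C'$ is the restriction of $\phi\hat\otimes\psi$. Proposition. Let $D$ be a $(\mathbb{C},\Gamma)$-$C^*$-algebra. (1) For every $(\mathbb{C},\Gamma)$-$C^*$-algebra $X$, there is exactly one structure of a $(\mathbb{C},\Gamma)$-$C^*$-algebra on $X\hat\otimes^{\Gamma}D$ whose coactions are the restrictions of $\delta_X\hat\otimes\mathrm{id}$ and $\mathrm{id}\hat\otimes\bar\delta_D$, and exactly one on $D\hat\otimes^{\Gamma}X$ whose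 coactions are the restrictions of $\delta_D\hat\otimes\mathrm{id}$ and $\mathrm{id}\hat\otimes\bar\delta_X$. (2) With respect to these structures, the functors $-\hat\otimes^{\Gamma}D$ and $D\hat\otimes^{\Gamma}-$ are exact: if $J\xrightarrow{\iota}A\xrightarrow{\pi}C$ is a short exact sequence of $(\mathbb{C},\Gamma)$-$C^*$-algebras, then so are $$J\hat\otimes^{\Gamma}D\xrightarrow{\iota\hat\otimes^{\Gamma}\mathrm{id}}A\hat\otimes^{\Gamma}D\xrightarrow{\pi\hat\otimes^{\Gamma}\mathrm{id}}C\hat\otimes^{\Gamma}D \quad\text{and}\quad D\hat\otimes^{\Gamma}J\xrightarrow{\mathrm{id}\hat\otimes^{\Gamma}\iota}D\hat\otimes^{\Gamma}A\xrightarrow{\mathrm{id}\hat\otimes^{\Gamma}\pi}D\hat\otimes^{\Gamma}C .$$ -/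

import Mathlib

open scoped TensorProduct

universe u v w

noncomputable section

namespace CGamma

/-! ### Enveloping C⋆-algebras -/

section Seminorms

variable (X : Type*) [NonUnitalRing X] [StarRing X] [Module ℂ X]

/-- A C⋆-seminorm on a complex ⋆-algebra. These are exactly the functions `x ↦ ‖π x‖`, where `π` is
a ⋆-homomorphism from `X` into some C⋆-algebra. -/
structure CStarSeminorm extends Seminorm ℂ X where
  mul_le' : ∀ x y, toFun (x * y) ≤ toFun x * toFun y
  star_mul_self' : ∀ x, toFun (star x * x) = toFun x ^ 2

variable {X}

instance : CoeFun (CStarSeminorm X) fun _ => X → ℝ := ⟨fun p => p.toSeminorm⟩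

theorem CStarSeminorm.mul_le (p : CStarSeminorm X) (x y : X) : p (x * y) ≤ p x * p y :=
  p.mul_le' x y

theorem CStarSeminorm.star_mul_self (p : CStarSeminorm X) (x : X) :
    p (star x * x) = p x ^ 2 := p.star_mul_self' x

theorem CStarSeminorm.nonneg (p : CStarSeminorm X) (x : X) : 0 ≤ p x := apply_nonneg _ x

theorem CStarSeminorm.star_le (p : CStarSeminorm X) (x : X) : p x ≤ p (star x) := by
  by_contra! h
  have h1 := p.star_mul_self x
  have h2 := p.mul_le (star x) x
  nlinarith [p.nonneg (star x), p.nonneg x]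

theorem CStarSeminorm.star_eq (p : CStarSeminorm X) (x : X) : p (star x) = p x :=
  le_antisymm (by simpa using p.star_le (star x)) (p.star_le x)

/-- The C⋆-seminorm `x ↦ ‖π x‖` of a representation `π`. -/
def CStarSeminorm.ofHom {E : Type*} [NonUnitalCStarAlgebra E] (π : X →⋆ₙₐ[ℂ] E) :
    CStarSeminorm X where
  toFun x := ‖π x‖
  map_zero' := by simp
  add_le' x y := by simpa using norm_add_le (π x) (π y)
  neg' x := by simp
  smul' c x := by simp [norm_smul]
  mul_le' x y := by simpa using norm_mul_le (π x) (π y)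
  star_mul_self' x := by
    rw [map_mul, map_star, CStarRing.norm_star_mul_self, sq]

theorem CStarSeminorm.ofHom_apply {E : Type*} [NonUnitalCStarAlgebra E] (π : X →⋆ₙₐ[ℂ] E) (x : X) :
    CStarSeminorm.ofHom π x = ‖π x‖ := rfl

/-- `X`, regarded as a seminormed ⋆-algebra with respect to a C⋆-seminorm. -/
def CStarSeminorm.Pre (_p : CStarSeminorm X) : Type _ := X

end Seminorms

section Completion

variable {X : Type*} [NonUnitalRing X] [StarRing X] [Module ℂ X] [IsScalarTower ℂ X X]
  [SMulCommClass ℂ X X] [StarModule ℂ X] (p : CStarSeminorm X)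

instance : NonUnitalSeminormedRing p.Pre :=
  { (inferInstance : NonUnitalRing X), p.toSeminorm.toAddGroupSeminorm.toSeminormedAddCommGroup with
    norm_mul_le := p.mul_le }

instance : StarRing p.Pre := (inferInstance : StarRing X)
instance : Module ℂ p.Pre := (inferInstance : Module ℂ X)
instance : IsScalarTower ℂ p.Pre p.Pre := (inferInstance : IsScalarTower ℂ X X)
instance : SMulCommClass ℂ p.Pre p.Pre := (inferInstance : SMulCommClass ℂ X X)
instance : StarModule ℂ p.Pre := (inferInstance : StarModule ℂ X)

instance : NormedSpace ℂ p.Pre where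
  norm_smul_le c x := (map_smul_eq_mul p.toSeminorm c x).le

/-- The identity map from `X` to `p.Pre`. -/
def CStarSeminorm.toPre : X →⋆ₙₐ[ℂ] p.Pre where
  toFun x := x
  map_smul' _ _ := rfl
  map_zero' := rfl
  map_add' _ _ := rfl
  map_mul' _ _ := rfl
  map_star' _ := rfl

theorem norm_toPre (x : X) : ‖p.toPre x‖ = p x := rfl

theorem norm_star_pre (x : p.Pre) : ‖star x‖ = ‖x‖ := p.star_eq (show X from x)

theorem norm_star_mul_self_pre (x : p.Pre) : ‖star x * x‖ = ‖x‖ ^ 2 :=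
  p.star_mul_self (show X from x)

theorem continuous_star_pre : UniformContinuous (star : p.Pre → p.Pre) :=
  (AddMonoidHomClass.isometry_of_norm (starAddEquiv : p.Pre ≃+ p.Pre)
    (norm_star_pre p)).uniformContinuous

open UniformSpace UniformSpace.Completion

instance : Mul (Completion p.Pre) :=
  ⟨Function.curry <| (isDenseInducing_coe.prodMap isDenseInducing_coe).extend
    ((↑) ∘ Function.uncurry (· * · : p.Pre → p.Pre → p.Pre))⟩

theorem coe_mul (a b : p.Pre) : ((a * b : p.Pre) : Completion p.Pre) = a * b :=
  ((isDenseInducing_coe.prodMap isDenseInducing_coe).extend_eq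
    ((continuous_coe p.Pre).comp (continuous_mul (M := p.Pre))) (a, b)).symm

instance : ContinuousMul (Completion p.Pre) where
  continuous_mul := by
    let m := (AddMonoidHom.mul : p.Pre →+ p.Pre →+ p.Pre).compr₂ toCompl
    have : Continuous fun q : p.Pre × p.Pre => m q.1 q.2 :=
      (continuous_coe p.Pre).comp continuous_mul
    have di : IsDenseInducing (toCompl : p.Pre → Completion p.Pre) := isDenseInducing_coe
    exact (di.extend_Z_bilin di this :)

instance : NonUnitalNormedRing (Completion p.Pre) :=
  { (inferInstance : NormedAddCommGroup (Completion p.Pre)) with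
    mul := (· * ·)
    zero_mul := fun a =>
      Completion.induction_on a (isClosed_eq (by fun_prop) continuous_const)
        fun a => by rw [← coe_zero, ← coe_mul, zero_mul]
    mul_zero := fun a =>
      Completion.induction_on a (isClosed_eq (by fun_prop) continuous_const)
        fun a => by rw [← coe_zero, ← coe_mul, mul_zero]
    mul_assoc := fun a b c =>
      Completion.induction_on₃ a b c (isClosed_eq (by fun_prop) (by fun_prop))
        fun a b c => by rw [← coe_mul, ← coe_mul, ← coe_mul, ← coe_mul, mul_assoc]
    left_distrib := fun a b c =>
      Completion.induction_on₃ a b c (isClosed_eq (by fun_prop) (by fun_prop))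
        fun a b c => by rw [← coe_add, ← coe_mul, ← coe_mul, ← coe_mul, ← coe_add, mul_add]
    right_distrib := fun a b c =>
      Completion.induction_on₃ a b c (isClosed_eq (by fun_prop) (by fun_prop))
        fun a b c => by rw [← coe_add, ← coe_mul, ← coe_mul, ← coe_mul, ← coe_add, add_mul]
    norm_mul_le := fun a b =>
      Completion.induction_on₂ a b (isClosed_le (by fun_prop) (by fun_prop))
        fun a b => by simpa only [← coe_mul, norm_coe] using norm_mul_le a b }

instance : Star (Completion p.Pre) := ⟨Completion.map star⟩

theorem coe_star (a : p.Pre) : ((star a : p.Pre) : Completion p.Pre) = star (a : Completion p.Pre) :=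
  (Completion.map_coe (continuous_star_pre p) a).symm

theorem continuous_star_completion : Continuous (star : Completion p.Pre → Completion p.Pre) :=
  Completion.continuous_map

instance : StarRing (Completion p.Pre) where
  star_involutive a :=
    have := continuous_star_completion p
    Completion.induction_on a (isClosed_eq (this.comp this) continuous_id)
      fun a => by rw [← coe_star, ← coe_star, star_star]
  star_mul a b :=
    have := continuous_star_completion p
    Completion.induction_on₂ a b (isClosed_eq (by fun_prop) (by fun_prop))
      fun a b => by rw [← coe_mul, ← coe_star, ← coe_star, ← coe_star, ← coe_mul, star_mul]
  star_add a b :=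
    have := continuous_star_completion p
    Completion.induction_on₂ a b (isClosed_eq (by fun_prop) (by fun_prop))
      fun a b => by rw [← coe_add, ← coe_star, ← coe_star, ← coe_star, ← coe_add, star_add]

instance : CStarRing (Completion p.Pre) where
  norm_mul_self_le a :=
    have := continuous_star_completion p
    Completion.induction_on a (isClosed_le (by fun_prop) (by fun_prop))
      fun a => by
        rw [← coe_star, ← coe_mul, norm_coe, norm_coe, norm_star_mul_self_pre, sq]

instance : IsScalarTower ℂ (Completion p.Pre) (Completion p.Pre) where
  smul_assoc c a b :=
    Completion.induction_on₂ a b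
      (isClosed_eq ((continuous_fst.const_smul c).mul continuous_snd)
        ((continuous_fst.mul continuous_snd).const_smul c))
      fun a b => by
        rw [smul_eq_mul, smul_eq_mul, ← coe_smul, ← coe_mul, ← coe_mul, ← coe_smul, smul_mul_assoc]

instance : SMulCommClass ℂ (Completion p.Pre) (Completion p.Pre) where
  smul_comm c a b :=
    Completion.induction_on₂ a b
      (isClosed_eq ((continuous_fst.mul continuous_snd).const_smul c)
        (continuous_fst.mul (continuous_snd.const_smul c)))
      fun a b => by
        rw [smul_eq_mul, smul_eq_mul, ← coe_smul, ← coe_mul, ← coe_mul, ← coe_smul, mul_smul_comm]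

instance : StarModule ℂ (Completion p.Pre) where
  star_smul c a :=
    have := continuous_star_completion p
    Completion.induction_on a
      (isClosed_eq (this.comp (continuous_id.const_smul c)) (this.const_smul (star c)))
      fun a => by rw [← coe_smul, ← coe_star, ← coe_star, ← coe_smul, star_smul]

instance : NonUnitalCStarAlgebra (Completion p.Pre) where

/-- The representation with C⋆-seminorm `p`. -/
def toCompletion : X →⋆ₙₐ[ℂ] Completion p.Pre where
  toFun x := ((p.toPre x : p.Pre) : Completion p.Pre)
  map_smul' c x := by rw [map_smul]; exact coe_smul c (p.toPre x)
  map_zero' := by rw [map_zero, coe_zero]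
  map_add' x y := by rw [map_add, coe_add]
  map_mul' x y := by rw [map_mul, coe_mul]
  map_star' x := by rw [map_star, coe_star]

theorem norm_toCompletion (x : X) : ‖toCompletion p x‖ = p x := norm_coe (p.toPre x)

theorem denseRange_toCompletion : DenseRange (toCompletion p) := denseRange_coe (α := p.Pre)

/-- Bounded linear extension to the completion. -/
def completionExtend {E : Type*} [NormedAddCommGroup E] [NormedSpace ℂ E] [CompleteSpace E]
    (f : X →ₗ[ℂ] E) (C : ℝ) (h : ∀ x, ‖f x‖ ≤ C * p x) : Completion p.Pre →L[ℂ] E :=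
  ContinuousLinearMap.extend
    (LinearMap.mkContinuous
      ({ toFun := fun x => f x, map_add' := map_add f, map_smul' := map_smul f } :
        p.Pre →ₗ[ℂ] E) C h) (toComplL : p.Pre →L[ℂ] Completion p.Pre)

theorem completionExtend_apply {E : Type*} [NormedAddCommGroup E] [NormedSpace ℂ E]
    [CompleteSpace E] (f : X →ₗ[ℂ] E) (C : ℝ) (h : ∀ x, ‖f x‖ ≤ C * p x) (x : X) :
    completionExtend p f C h (toCompletion p x) = f x :=
  ContinuousLinearMap.extend_eq _ denseRange_coe (isUniformInducing_coe _) (p.toPre x)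

/-- Extension of a representation that is dominated by `p`. -/
def completionLift {E : Type*} [NonUnitalCStarAlgebra E] (π : X →⋆ₙₐ[ℂ] E)
    (h : ∀ x, ‖π x‖ ≤ p x) : Completion p.Pre →⋆ₙₐ[ℂ] E :=
  let g := completionExtend p (π : X →ₗ[ℂ] E) 1 (by simpa using! h)
  have hg : ∀ x, g (toCompletion p x) = π x := completionExtend_apply p _ _ _
  have hd := denseRange_toCompletion p
  { toFun := g
    map_smul' := map_smul g
    map_zero' := map_zero g
    map_add' := map_add g
    map_mul' := fun x y => by
      refine hd.induction_on₂ (p := fun x y => g (x * y) = g x * g y)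
        (isClosed_eq (by fun_prop) (by fun_prop)) (fun x y => ?_) x y
      rw [← map_mul, hg, hg, hg, map_mul]
    map_star' := fun x => by
      refine hd.induction_on (p := fun x => g (star x) = star (g x)) x
        (isClosed_eq (by fun_prop) (by fun_prop)) (fun x => ?_)
      rw [← map_star, hg, hg, map_star] }

theorem completionLift_toCompletion {E : Type*} [NonUnitalCStarAlgebra E] (π : X →⋆ₙₐ[ℂ] E)
    (h : ∀ x, ‖π x‖ ≤ p x) (x : X) : completionLift p π h (toCompletion p x) = π x :=
  completionExtend_apply p _ _ _ x

end Completion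

section Env

variable (X : Type*) [NonUnitalRing X] [StarRing X] [Module ℂ X]

/-- The condition that `|x| = sup {‖π x‖}`, the supremum over all representations `π` of `X`, is
finite for all `x`, that is, that `X` has an enveloping C⋆-algebra. -/
class HasEnvelope : Prop where
  bddAbove : ∀ x : X, BddAbove (Set.range fun p : CStarSeminorm X => p x)

instance : Inhabited (CStarSeminorm X) where
  default := { (0 : Seminorm ℂ X) with
    mul_le' := fun x y => by
      change (0 : Seminorm ℂ X) (x * y) ≤ (0 : Seminorm ℂ X) x * (0 : Seminorm ℂ X) y
      simp
    star_mul_self' := fun x => by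
      change (0 : Seminorm ℂ X) (star x * x) = (0 : Seminorm ℂ X) x ^ 2
      simp }

variable [HasEnvelope X]

variable {X} in
theorem le_iSup_seminorm (p : CStarSeminorm X) (x : X) : p x ≤ ⨆ q : CStarSeminorm X, q x :=
  le_ciSup (f := fun q : CStarSeminorm X => q x) (HasEnvelope.bddAbove x) p

variable {X} in
theorem iSup_seminorm_nonneg (x : X) : 0 ≤ ⨆ q : CStarSeminorm X, q x :=
  Real.iSup_nonneg fun q => q.nonneg x

/-- The largest C⋆-seminorm `x ↦ |x|`. -/
def maxSeminorm : CStarSeminorm X where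
  toFun x := ⨆ p : CStarSeminorm X, p x
  map_zero' := by simp
  add_le' x y := ciSup_le fun p => (map_add_le_add p.toSeminorm x y).trans
    (add_le_add (le_iSup_seminorm p x) (le_iSup_seminorm p y))
  neg' x := by simp
  smul' c x := by
    simp_rw [map_smul_eq_mul, Real.mul_iSup_of_nonneg (norm_nonneg c)]
  mul_le' x y := ciSup_le fun p => (p.mul_le x y).trans
    (mul_le_mul (le_iSup_seminorm p x) (le_iSup_seminorm p y) (p.nonneg y)
      (iSup_seminorm_nonneg x))
  star_mul_self' x := by
    refine le_antisymm (ciSup_le fun p => ?_) ?_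
    · rw [p.star_mul_self]
      exact pow_le_pow_left₀ (p.nonneg x) (le_iSup_seminorm p x) 2
    · rw [← Real.le_sqrt (iSup_seminorm_nonneg x) (iSup_seminorm_nonneg _)]
      refine ciSup_le fun p => Real.le_sqrt_of_sq_le ?_
      rw [← p.star_mul_self]
      exact le_iSup_seminorm p _

variable {X} in
theorem le_maxSeminorm (p : CStarSeminorm X) (x : X) : p x ≤ maxSeminorm X x :=
  le_iSup_seminorm p x

variable [IsScalarTower ℂ X X] [SMulCommClass ℂ X X] [StarModule ℂ X]

/-- The enveloping C⋆-algebra of `X`: the separated completion with respect to the largest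
C⋆-seminorm. -/
def CStarEnv : Type _ := UniformSpace.Completion (maxSeminorm X).Pre

instance : NonUnitalCStarAlgebra (CStarEnv X) :=
  (inferInstance : NonUnitalCStarAlgebra (UniformSpace.Completion (maxSeminorm X).Pre))

/-- The universal representation of `X`. -/
def toEnv : X →⋆ₙₐ[ℂ] CStarEnv X := toCompletion (maxSeminorm X)

variable {X}

theorem norm_toEnv (x : X) : ‖toEnv X x‖ = maxSeminorm X x := norm_toCompletion _ x

theorem denseRange_toEnv : DenseRange (toEnv X) := denseRange_toCompletion (maxSeminorm X)

/-- The extension of a representation of `X` to the enveloping C⋆-algebra. -/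
def envLift {E : Type*} [NonUnitalCStarAlgebra E] (π : X →⋆ₙₐ[ℂ] E) : CStarEnv X →⋆ₙₐ[ℂ] E :=
  completionLift (maxSeminorm X) π fun x => le_maxSeminorm (.ofHom π) x

theorem envLift_toEnv {E : Type*} [NonUnitalCStarAlgebra E] (π : X →⋆ₙₐ[ℂ] E) (x : X) :
    envLift π (toEnv X x) = π x := completionLift_toCompletion _ π _ x

/-- The extension of a linear map that is bounded with respect to the largest C⋆-seminorm. -/
def envExtend {E : Type*} [NormedAddCommGroup E] [NormedSpace ℂ E] [CompleteSpace E]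
    (f : X →ₗ[ℂ] E) (C : ℝ) (h : ∀ x, ‖f x‖ ≤ C * maxSeminorm X x) : CStarEnv X →L[ℂ] E :=
  completionExtend (maxSeminorm X) f C h

theorem envExtend_toEnv {E : Type*} [NormedAddCommGroup E] [NormedSpace ℂ E] [CompleteSpace E]
    (f : X →ₗ[ℂ] E) (C : ℝ) (h : ∀ x, ‖f x‖ ≤ C * maxSeminorm X x) (x : X) :
    envExtend f C h (toEnv X x) = f x := completionExtend_apply _ f C h x

theorem norm_envExtend_le {E : Type*} [NormedAddCommGroup E] [NormedSpace ℂ E] [CompleteSpace E]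
    (f : X →ₗ[ℂ] E) (C : ℝ) (h : ∀ x, ‖f x‖ ≤ C * maxSeminorm X x) (x : CStarEnv X) :
    ‖envExtend f C h x‖ ≤ C * ‖x‖ := by
  refine denseRange_toEnv.induction_on (p := fun x => ‖envExtend f C h x‖ ≤ C * ‖x‖) x
    (isClosed_le (by fun_prop) (by fun_prop)) (fun x => ?_)
  rw [envExtend_toEnv, norm_toEnv]
  exact h x

theorem continuous_hom {E F : Type*} [NonUnitalCStarAlgebra E] [NonUnitalCStarAlgebra F]
    (π : E →⋆ₙₐ[ℂ] F) : Continuous π :=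
  AddMonoidHomClass.continuous_of_bound π 1 fun x => by
    simpa using NonUnitalStarAlgHom.norm_apply_le π x

/-- Representations of the enveloping C⋆-algebra are determined on `X`. -/
theorem env_hom_ext {E : Type*} [NonUnitalCStarAlgebra E] {π ρ : CStarEnv X →⋆ₙₐ[ℂ] E}
    (h : ∀ x, π (toEnv X x) = ρ (toEnv X x)) : π = ρ :=
  DFunLike.coe_injective
    (denseRange_toEnv.equalizer (continuous_hom π) (continuous_hom ρ) (funext h))

end Env

/-! ### The full group C⋆-algebra -/

section Group

variable (Γ : Type*) [Group Γ]

/-- The involution of the group algebra, `(∑ z_γ γ)⋆ = ∑ conj(z_γ) γ⁻¹`. -/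
instance : Star (MonoidAlgebra ℂ Γ) where
  star f := .ofCoeff ((f.coeff.mapRange star (star_zero ℂ)).equivMapDomain (Equiv.inv Γ))

variable {Γ} in
theorem coeff_star (f : MonoidAlgebra ℂ Γ) (γ : Γ) : (star f).coeff γ = star (f.coeff γ⁻¹) := rfl

variable {Γ} in
theorem star_single (γ : Γ) (z : ℂ) :
    star (MonoidAlgebra.single γ z) = MonoidAlgebra.single γ⁻¹ (star z) := by
  classical
  ext δ
  rw [coeff_star, MonoidAlgebra.coeff_single, MonoidAlgebra.coeff_single, Finsupp.single_apply,
    Finsupp.single_apply]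
  by_cases h : γ = δ⁻¹
  · rw [if_pos h, if_pos (by rw [h, inv_inv])]
  · rw [if_neg h, if_neg (fun h' => h (by rw [← h', inv_inv])), star_zero]

variable {Γ} in
theorem star_add_groupAlgebra (f g : MonoidAlgebra ℂ Γ) : star (f + g) = star f + star g := by
  ext δ
  simp only [coeff_star, MonoidAlgebra.coeff_add, Finsupp.add_apply, star_add]

instance : StarRing (MonoidAlgebra ℂ Γ) where
  star_involutive f := by
    induction f using MonoidAlgebra.induction_linear with
    | zero => ext δ; simp [coeff_star]
    | add f g hf hg => rw [star_add_groupAlgebra, star_add_groupAlgebra, hf, hg]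
    | single γ z => simp [star_single]
  star_mul f g := by
    have h0 : star (0 : MonoidAlgebra ℂ Γ) = 0 := by ext δ; simp [coeff_star]
    induction f using MonoidAlgebra.induction_linear with
    | zero => simp [h0]
    | add f f' hf hf' => rw [add_mul, star_add_groupAlgebra, star_add_groupAlgebra, hf, hf', mul_add]
    | single γ z =>
      induction g using MonoidAlgebra.induction_linear with
      | zero => simp [h0]
      | add g g' hg hg' =>
        rw [mul_add, star_add_groupAlgebra, star_add_groupAlgebra, hg, hg', add_mul]
      | single γ' z' => simp [star_single, MonoidAlgebra.single_mul_single, mul_comm]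
  star_add := star_add_groupAlgebra

instance : StarModule ℂ (MonoidAlgebra ℂ Γ) where
  star_smul c f := by
    ext δ
    simp only [coeff_star, MonoidAlgebra.coeff_smul, Finsupp.smul_apply, smul_eq_mul, star_mul']

theorem seminorm_single_le (p : CStarSeminorm (MonoidAlgebra ℂ Γ)) (γ : Γ) :
    p (MonoidAlgebra.single γ 1) ≤ 1 := by
  have h1 := p.star_mul_self (MonoidAlgebra.single γ 1)
  have h2 := p.star_mul_self (MonoidAlgebra.single 1 1)
  simp only [star_single, MonoidAlgebra.single_mul_single, star_one, mul_one, inv_one,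
    inv_mul_cancel] at h1 h2
  have h3 : p (MonoidAlgebra.single (1 : Γ) 1) ≤ 1 := by
    by_contra! hc
    nlinarith
  by_contra! hc
  nlinarith

instance : HasEnvelope (MonoidAlgebra ℂ Γ) where
  bddAbove f := by
    induction f using MonoidAlgebra.induction_linear with
    | zero => exact ⟨0, by rintro _ ⟨p, rfl⟩; simp⟩
    | add f g hf hg =>
      obtain ⟨C, hC⟩ := hf
      obtain ⟨C', hC'⟩ := hg
      refine ⟨C + C', ?_⟩
      rintro _ ⟨p, rfl⟩
      exact (map_add_le_add p.toSeminorm f g).trans (add_le_add (hC ⟨p, rfl⟩) (hC' ⟨p, rfl⟩))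
    | single γ z =>
      refine ⟨‖z‖, ?_⟩
      rintro _ ⟨p, rfl⟩
      have h : MonoidAlgebra.single γ z = z • MonoidAlgebra.single γ (1 : ℂ) := by simp
      simp only [h, map_smul_eq_mul]
      nlinarith [norm_nonneg z, seminorm_single_le Γ p γ]

/-- The full group C⋆-algebra `C⋆(Γ)`. -/
def GroupCStar : Type _ := CStarEnv (MonoidAlgebra ℂ Γ)

instance : NonUnitalCStarAlgebra (GroupCStar Γ) :=
  (inferInstance : NonUnitalCStarAlgebra (CStarEnv (MonoidAlgebra ℂ Γ)))

/-- The universal representation of the group algebra. -/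
def ofGroupAlgebra : MonoidAlgebra ℂ Γ →⋆ₙₐ[ℂ] GroupCStar Γ := toEnv (MonoidAlgebra ℂ Γ)

variable {Γ}

/-- The canonical unitary in `C⋆(Γ)` given by `γ`. -/
def GroupCStar.of (γ : Γ) : GroupCStar Γ :=
  ofGroupAlgebra Γ (MonoidAlgebra.single γ 1)

variable (Γ) in
theorem denseRange_ofGroupAlgebra : DenseRange (ofGroupAlgebra Γ) :=
  denseRange_toEnv (X := MonoidAlgebra ℂ Γ)

/-- The ⋆-homomorphism on `ℂΓ` that is given by a family of elements behaving like the group. -/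
def groupAlgebraLift {E : Type*} [NonUnitalCStarAlgebra E] (u : Γ → E)
    (hmul : ∀ γ γ', u (γ * γ') = u γ * u γ') (hstar : ∀ γ, u γ⁻¹ = star (u γ)) :
    MonoidAlgebra ℂ Γ →⋆ₙₐ[ℂ] E :=
  let f : MonoidAlgebra ℂ Γ →ₗ[ℂ] E :=
    (Finsupp.linearCombination ℂ u).comp
      ({ toFun := MonoidAlgebra.coeff, map_add' := fun _ _ => rfl, map_smul' := fun _ _ => rfl } :
        MonoidAlgebra ℂ Γ →ₗ[ℂ] (Γ →₀ ℂ))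
  have hf : ∀ γ z, f (MonoidAlgebra.single γ z) = z • u γ := fun γ z =>
    Finsupp.linearCombination_single ℂ z γ
  { toFun := f
    map_smul' := map_smul f
    map_zero' := map_zero f
    map_add' := map_add f
    map_mul' := fun x y => by
      induction x using MonoidAlgebra.induction_linear with
      | zero => simp
      | add x x' hx hx' => rw [add_mul, map_add, hx, hx', map_add, add_mul]
      | single γ z =>
        induction y using MonoidAlgebra.induction_linear with
        | zero => simp
        | add y y' hy hy' => rw [mul_add, map_add, hy, hy', map_add, mul_add]
        | single γ' z' =>
          rw [MonoidAlgebra.single_mul_single, hf, hf, hf, hmul, smul_mul_smul_comm]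
    map_star' := fun x => by
      induction x using MonoidAlgebra.induction_linear with
      | zero => simp
      | add x x' hx hx' => rw [star_add, map_add, hx, hx', map_add, star_add]
      | single γ z => rw [star_single, hf, hf, hstar, star_smul] }

theorem groupAlgebraLift_single {E : Type*} [NonUnitalCStarAlgebra E] (u : Γ → E)
    (hmul : ∀ γ γ', u (γ * γ') = u γ * u γ') (hstar : ∀ γ, u γ⁻¹ = star (u γ)) (γ : Γ) :
    groupAlgebraLift u hmul hstar (MonoidAlgebra.single γ 1) = u γ :=
  (Finsupp.linearCombination_single ℂ 1 γ).trans (one_smul ℂ (u γ))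

theorem GroupCStar.of_mul (γ γ' : Γ) :
    GroupCStar.of (γ * γ') = GroupCStar.of γ * GroupCStar.of γ' := by
  simp [GroupCStar.of, ← map_mul, MonoidAlgebra.single_mul_single]

theorem GroupCStar.of_inv (γ : Γ) : GroupCStar.of γ⁻¹ = star (GroupCStar.of γ) := by
  simp [GroupCStar.of, ← map_star, star_single]

end Group

/-! ### The maximal tensor product -/

section Tensor

variable (A B C : Type*) [NonUnitalCStarAlgebra A] [NonUnitalCStarAlgebra B]
  [NonUnitalCStarAlgebra C]

section Bound

attribute [local instance] CStarAlgebra.spectralOrder CStarAlgebra.spectralOrderedRing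

variable {A B}

theorem sq_le_self_of_norm_le_one (a : A) (ha : ‖a‖ ≤ 1) :
    (star a * a) * (star a * a) ≤ star a * a := by
  have h1 := CStarAlgebra.star_left_conjugate_le_norm_smul (a := a) (b := a * star a)
    (IsSelfAdjoint.mul_star_self a)
  have h2 : ‖a * star a‖ ≤ 1 := by
    rw [CStarRing.norm_self_mul_star]
    nlinarith [norm_nonneg a]
  have h3 : ‖a * star a‖ • (star a * a) ≤ (1 : ℝ) • (star a * a) :=
    smul_le_smul_of_nonneg_right h2 (star_mul_self_nonneg a)
  rw [one_smul] at h3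
  simpa only [mul_assoc] using h1.trans h3

theorem norm_tmul_le_one {E : Type*} [NonUnitalCStarAlgebra E] (φ : A ⊗[ℂ] B →⋆ₙₐ[ℂ] E) (a : A)
    (b : B) (ha : ‖a‖ ≤ 1) (hb : ‖b‖ ≤ 1) : ‖φ (a ⊗ₜ b)‖ ≤ 1 := by
  obtain ⟨s, hs⟩ := CStarAlgebra.nonneg_iff_eq_star_mul_self.mp
    (sub_nonneg.mpr (sq_le_self_of_norm_le_one a ha))
  obtain ⟨t, ht⟩ := CStarAlgebra.nonneg_iff_eq_star_mul_self.mp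
    (sub_nonneg.mpr (sq_le_self_of_norm_le_one b hb))
  set h := star a * a with hh
  set k := star b * b with hk
  have hhs : star h = h := by simp [hh]
  set x := φ (h ⊗ₜ k) with hx
  have hx1 : x = star (φ (a ⊗ₜ b)) * φ (a ⊗ₜ b) := by
    rw [hx, ← map_star, ← map_mul, TensorProduct.star_tmul, Algebra.TensorProduct.tmul_mul_tmul]
  have key : x - x * x = star (φ (s ⊗ₜ b)) * φ (s ⊗ₜ b) + star (φ (h ⊗ₜ t)) * φ (h ⊗ₜ t) := by
    simp only [hx, ← map_star, ← map_mul, TensorProduct.star_tmul, ← map_sub, ← map_add,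
      Algebra.TensorProduct.tmul_mul_tmul, ← hs, ← ht, hhs]
    rw [TensorProduct.sub_tmul, TensorProduct.tmul_sub, ← hk]
    congr 1
    abel
  have hle : x * x ≤ x := by
    rw [← sub_nonneg, key]
    exact add_nonneg (star_mul_self_nonneg _) (star_mul_self_nonneg _)
  have hsa : star x = x := by rw [hx1]; simp
  have hn : ‖x * x‖ = ‖x‖ * ‖x‖ := by
    conv_lhs => rw [← hsa]
    rw [hsa, ← CStarRing.norm_star_mul_self, hsa]
  have h0 : 0 ≤ x * x := by
    have := star_mul_self_nonneg x
    rwa [hsa] at this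
  have h1 := CStarAlgebra.norm_le_norm_of_nonneg_of_le h0 hle
  have h2 : ‖x‖ = ‖φ (a ⊗ₜ b)‖ * ‖φ (a ⊗ₜ b)‖ := by
    rw [hx1, CStarRing.norm_star_mul_self]
  have h3 := norm_nonneg (φ (a ⊗ₜ b))
  have h4 : ‖x‖ ≤ 1 := by
    by_contra! hc
    nlinarith
  nlinarith

end Bound

variable {A B} in
theorem seminorm_tmul_le (p : CStarSeminorm (A ⊗[ℂ] B)) (a : A) (b : B) :
    p (a ⊗ₜ b) ≤ ‖a‖ * ‖b‖ := by
  rcases eq_or_ne a 0 with rfl | ha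
  · simp
  rcases eq_or_ne b 0 with rfl | hb
  · simp
  have ha' := norm_pos_iff.mpr ha
  have hb' := norm_pos_iff.mpr hb
  have h := norm_tmul_le_one (toCompletion p) (((‖a‖⁻¹ : ℝ) : ℂ) • a) (((‖b‖⁻¹ : ℝ) : ℂ) • b)
    (by rw [norm_smul]; simp [ha'.ne']) (by rw [norm_smul]; simp [hb'.ne'])
  rw [norm_toCompletion, TensorProduct.smul_tmul_smul, map_smul_eq_mul] at h
  simp only [norm_mul, Complex.norm_real, norm_inv, norm_norm] at h
  rw [← mul_inv, inv_mul_le_iff₀ (by positivity), mul_one] at h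
  exact h

instance : HasEnvelope (A ⊗[ℂ] B) where
  bddAbove x := by
    induction x using TensorProduct.induction_on with
    | zero => exact ⟨0, by rintro _ ⟨p, rfl⟩; simp⟩
    | add x y hx hy =>
      obtain ⟨C, hC⟩ := hx
      obtain ⟨C', hC'⟩ := hy
      refine ⟨C + C', ?_⟩
      rintro _ ⟨p, rfl⟩
      exact (map_add_le_add p.toSeminorm x y).trans (add_le_add (hC ⟨p, rfl⟩) (hC' ⟨p, rfl⟩))
    | tmul a b =>
      refine ⟨‖a‖ * ‖b‖, ?_⟩
      rintro _ ⟨p, rfl⟩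
      exact seminorm_tmul_le p a b

/-- The maximal tensor product of two C⋆-algebras: the enveloping C⋆-algebra of the algebraic
tensor product. -/
def MaxTensor : Type _ := CStarEnv (A ⊗[ℂ] B)

instance : NonUnitalCStarAlgebra (MaxTensor A B) :=
  (inferInstance : NonUnitalCStarAlgebra (CStarEnv (A ⊗[ℂ] B)))

/-- The universal representation of the algebraic tensor product. -/
def ofAlg : A ⊗[ℂ] B →⋆ₙₐ[ℂ] MaxTensor A B := toEnv (A ⊗[ℂ] B)

variable {A B} in
theorem norm_ofAlg (x : A ⊗[ℂ] B) : ‖ofAlg A B x‖ = maxSeminorm (A ⊗[ℂ] B) x := norm_toEnv x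

theorem denseRange_ofAlg : DenseRange (ofAlg A B) := denseRange_toEnv (X := A ⊗[ℂ] B)

variable {A B C}

/-- The elementary tensor `a ⊗ b` in the maximal tensor product. -/
def tmul (a : A) (b : B) : MaxTensor A B := ofAlg A B (a ⊗ₜ[ℂ] b)

theorem norm_tmul_le (a : A) (b : B) : ‖tmul a b‖ ≤ ‖a‖ * ‖b‖ := by
  rw [tmul, norm_ofAlg]
  exact seminorm_tmul_le _ a b

theorem tmul_mul_tmul (a a' : A) (b b' : B) :
    tmul a b * tmul a' b' = tmul (a * a') (b * b') := by
  simp only [tmul, ← map_mul, Algebra.TensorProduct.tmul_mul_tmul]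

theorem star_tmul (a : A) (b : B) : star (tmul a b) = tmul (star a) (star b) := by
  simp only [tmul, ← map_star, TensorProduct.star_tmul]

variable (A B) in
/-- The bilinear map `(a, b) ↦ a ⊗ b`. -/
def tmulBilin : A →ₗ[ℂ] B →ₗ[ℂ] MaxTensor A B :=
  LinearMap.mk₂ ℂ tmul
    (fun a a' b => by simp only [tmul, TensorProduct.add_tmul, map_add])
    (fun c a b => by simp only [tmul, ← TensorProduct.smul_tmul', map_smul])
    (fun a b b' => by simp only [tmul, TensorProduct.tmul_add, map_add])
    (fun c a b => by simp only [tmul, TensorProduct.tmul_smul, map_smul])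

theorem tmulBilin_apply (a : A) (b : B) : tmulBilin A B a b = tmul a b := rfl

theorem maxTensor_hom_ext {E : Type*} [NonUnitalCStarAlgebra E] {π ρ : MaxTensor A B →⋆ₙₐ[ℂ] E}
    (h : ∀ x, π (ofAlg A B x) = ρ (ofAlg A B x)) : π = ρ :=
  DFunLike.coe_injective
    ((denseRange_ofAlg A B).equalizer (continuous_hom π) (continuous_hom ρ) (funext h))

theorem tensor_hom_ext {E : Type*} [NonUnitalCStarAlgebra E] {π ρ : MaxTensor A B →⋆ₙₐ[ℂ] E}
    (h : ∀ a b, π (tmul a b) = ρ (tmul a b)) : π = ρ :=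
  maxTensor_hom_ext fun x => by
    induction x using TensorProduct.induction_on with
    | zero => simp
    | add x y hx hy => rw [map_add, map_add, map_add, hx, hy]
    | tmul a b => exact h a b

section Lift

variable {E : Type*} [NonUnitalCStarAlgebra E] (f : A →ₗ[ℂ] B →ₗ[ℂ] E)
  (hmul : ∀ a a' b b', f (a * a') (b * b') = f a b * f a' b')
  (hstar : ∀ a b, f (star a) (star b) = star (f a b))

/-- The representation of the algebraic tensor product given by a bilinear map that is
multiplicative and involutive on elementary tensors. -/
def algTensorLift : A ⊗[ℂ] B →⋆ₙₐ[ℂ] E :=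
  { toFun := TensorProduct.lift f
    map_smul' := map_smul _
    map_zero' := map_zero _
    map_add' := map_add _
    map_mul' := fun x y => by
      induction x using TensorProduct.induction_on with
      | zero => simp
      | add x x' hx hx' => rw [add_mul, map_add, hx, hx', map_add, add_mul]
      | tmul a b =>
        induction y using TensorProduct.induction_on with
        | zero => simp
        | add y y' hy hy' => rw [mul_add, map_add, hy, hy', map_add, mul_add]
        | tmul a' b' =>
          rw [Algebra.TensorProduct.tmul_mul_tmul, TensorProduct.lift.tmul,
            TensorProduct.lift.tmul, TensorProduct.lift.tmul, hmul]
    map_star' := fun x => by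
      induction x using TensorProduct.induction_on with
      | zero => simp
      | add x x' hx hx' => rw [star_add, map_add, hx, hx', map_add, star_add]
      | tmul a b =>
        rw [TensorProduct.star_tmul, TensorProduct.lift.tmul, TensorProduct.lift.tmul, hstar] }

/-- The extension of such a bilinear map to the maximal tensor product. -/
def tensorLift : MaxTensor A B →⋆ₙₐ[ℂ] E := envLift (algTensorLift f hmul hstar)

theorem tensorLift_tmul (a : A) (b : B) : tensorLift f hmul hstar (tmul a b) = f a b :=
  (envLift_toEnv _ _).trans (TensorProduct.lift.tmul a b)

end Lift

section Map

variable {A' B' A'' B'' : Type*} [NonUnitalCStarAlgebra A'] [NonUnitalCStarAlgebra B']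
  [NonUnitalCStarAlgebra A''] [NonUnitalCStarAlgebra B'']

/-- The ⋆-homomorphism `φ ⊗ ψ` between maximal tensor products. -/
def tensorMap (φ : A →⋆ₙₐ[ℂ] A') (ψ : B →⋆ₙₐ[ℂ] B') : MaxTensor A B →⋆ₙₐ[ℂ] MaxTensor A' B' :=
  tensorLift ((tmulBilin A' B').compl₁₂ (φ : A →ₗ[ℂ] A') (ψ : B →ₗ[ℂ] B'))
    (fun a a' b b' => by
      simp only [LinearMap.compl₁₂_apply, LinearMap.coe_coe, tmulBilin_apply, map_mul,
        tmul_mul_tmul])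
    (fun a b => by
      simp only [LinearMap.compl₁₂_apply, LinearMap.coe_coe, tmulBilin_apply, map_star, star_tmul])

theorem tensorMap_tmul (φ : A →⋆ₙₐ[ℂ] A') (ψ : B →⋆ₙₐ[ℂ] B') (a : A) (b : B) :
    tensorMap φ ψ (tmul a b) = tmul (φ a) (ψ b) := tensorLift_tmul _ _ _ a b

theorem tensorMap_comp (φ' : A' →⋆ₙₐ[ℂ] A'') (ψ' : B' →⋆ₙₐ[ℂ] B'') (φ : A →⋆ₙₐ[ℂ] A')
    (ψ : B →⋆ₙₐ[ℂ] B') :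
    (tensorMap φ' ψ').comp (tensorMap φ ψ) = tensorMap (φ'.comp φ) (ψ'.comp ψ) :=
  tensor_hom_ext fun a b => by
    simp only [NonUnitalStarAlgHom.comp_apply, tensorMap_tmul]

end Map

section Assoc

attribute [local instance] CStarAlgebra.spectralOrder CStarAlgebra.spectralOrderedRing

/-- The linear map `(a ⊗ b, c) ↦ a ⊗ (b ⊗ c)` on the algebraic level. -/
def tri : A ⊗[ℂ] B →ₗ[ℂ] C →ₗ[ℂ] MaxTensor A (MaxTensor B C) :=
  TensorProduct.lift
    (LinearMap.mk₂ ℂ (fun a b => (tmulBilin A (MaxTensor B C) a).comp (tmulBilin B C b))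
      (fun a a' b => by ext c; simp)
      (fun z a b => by ext c; simp)
      (fun a b b' => by ext c; simp)
      (fun z a b => by ext c; simp))

theorem tri_tmul (a : A) (b : B) (c : C) : tri (a ⊗ₜ b) c = tmul a (tmul b c) := rfl

theorem tri_mul (x y : A ⊗[ℂ] B) (c c' : C) : tri (x * y) (c * c') = tri x c * tri y c' := by
  induction x using TensorProduct.induction_on with
  | zero => simp
  | add x x' hx hx' =>
    rw [add_mul, map_add, LinearMap.add_apply, hx, hx', map_add, LinearMap.add_apply, add_mul]
  | tmul a b =>
    induction y using TensorProduct.induction_on with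
    | zero => simp
    | add y y' hy hy' =>
      rw [mul_add, map_add, LinearMap.add_apply, hy, hy', map_add, LinearMap.add_apply, mul_add]
    | tmul a' b' =>
      rw [Algebra.TensorProduct.tmul_mul_tmul, tri_tmul, tri_tmul, tri_tmul, tmul_mul_tmul,
        tmul_mul_tmul]

theorem tri_star (x : A ⊗[ℂ] B) (c : C) : tri (star x) (star c) = star (tri x c) := by
  induction x using TensorProduct.induction_on with
  | zero => simp
  | add x x' hx hx' =>
    rw [star_add, map_add, LinearMap.add_apply, hx, hx', map_add, LinearMap.add_apply, star_add]
  | tmul a b =>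
    rw [TensorProduct.star_tmul, tri_tmul, tri_tmul, star_tmul, star_tmul]

theorem exists_tri_bound (x : A ⊗[ℂ] B) : ∃ K : ℝ, ∀ c : C, ‖tri x c‖ ≤ K * ‖c‖ := by
  induction x using TensorProduct.induction_on with
  | zero => exact ⟨0, by simp⟩
  | add x y hx hy =>
    obtain ⟨K, hK⟩ := hx
    obtain ⟨K', hK'⟩ := hy
    refine ⟨K + K', fun c => ?_⟩
    rw [map_add, LinearMap.add_apply, add_mul]
    exact (norm_add_le _ _).trans (add_le_add (hK c) (hK' c))
  | tmul a b =>
    refine ⟨‖a‖ * ‖b‖, fun c => ?_⟩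
    rw [tri_tmul, mul_assoc]
    exact (norm_tmul_le _ _).trans
      (mul_le_mul_of_nonneg_left (norm_tmul_le _ _) (norm_nonneg _))

theorem continuous_tri (x : A ⊗[ℂ] B) : Continuous fun c : C => tri x c := by
  obtain ⟨K, hK⟩ := exists_tri_bound (C := C) x
  exact AddMonoidHomClass.continuous_of_bound (tri x) K hK

theorem bddAbove_tri (x : A ⊗[ℂ] B) :
    BddAbove (Set.range fun c : {c : C // ‖c‖ ≤ 1} => ‖tri x c.1‖) := by
  obtain ⟨K, hK⟩ := exists_tri_bound (C := C) x
  refine ⟨|K|, ?_⟩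
  rintro _ ⟨c, rfl⟩
  have h1 := hK c.1
  have h2 := c.2
  have h3 := norm_nonneg c.1
  have h4 := le_abs_self K
  nlinarith [abs_nonneg K, mul_le_mul_of_nonneg_right h4 h3]

theorem tri_le_iSup (x : A ⊗[ℂ] B) (c : C) (hc : ‖c‖ ≤ 1) :
    ‖tri x c‖ ≤ ⨆ c : {c : C // ‖c‖ ≤ 1}, ‖tri x c.1‖ :=
  le_ciSup (f := fun c : {c : C // ‖c‖ ≤ 1} => ‖tri x c.1‖) (bddAbove_tri x) ⟨c, hc⟩

variable (C) in
instance : Nonempty {c : C // ‖c‖ ≤ 1} := ⟨⟨0, by simp⟩⟩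

theorem iSup_tri_nonneg (x : A ⊗[ℂ] B) : 0 ≤ ⨆ c : {c : C // ‖c‖ ≤ 1}, ‖tri x c.1‖ :=
  Real.iSup_nonneg fun _ => norm_nonneg _

theorem iSup_tri_mul_le (x y : A ⊗[ℂ] B) :
    ⨆ c : {c : C // ‖c‖ ≤ 1}, ‖tri (x * y) c.1‖ ≤
      (⨆ c : {c : C // ‖c‖ ≤ 1}, ‖tri x c.1‖) * ⨆ c : {c : C // ‖c‖ ≤ 1}, ‖tri y c.1‖ := by
  refine ciSup_le fun c => ?_
  have hu := CStarAlgebra.increasingApproximateUnit C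
  have := hu.neBot
  refine le_of_tendsto
    (((continuous_tri (x * y)).norm.tendsto c.1).comp (hu.tendsto_mul_left c.1)) ?_
  filter_upwards [hu.eventually_norm] with e he
  simp only [Function.comp_apply]
  rw [tri_mul]
  exact (norm_mul_le _ _).trans (mul_le_mul (tri_le_iSup x c.1 c.2) (tri_le_iSup y e he)
    (norm_nonneg _) (iSup_tri_nonneg x))

theorem iSup_tri_star (x : A ⊗[ℂ] B) :
    ⨆ c : {c : C // ‖c‖ ≤ 1}, ‖tri (star x) c.1‖ ≤ ⨆ c : {c : C // ‖c‖ ≤ 1}, ‖tri x c.1‖ := by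
  refine ciSup_le fun c => ?_
  rw [← norm_star, ← tri_star, star_star]
  exact tri_le_iSup x _ (by rw [norm_star]; exact c.2)

variable (A B C) in
/-- An auxiliary C⋆-seminorm on the algebraic tensor product. -/
def triSeminorm : CStarSeminorm (A ⊗[ℂ] B) where
  toFun x := ⨆ c : {c : C // ‖c‖ ≤ 1}, ‖tri x c.1‖
  map_zero' := by simp
  add_le' x y := ciSup_le fun c => by
    rw [map_add, LinearMap.add_apply]
    exact (norm_add_le _ _).trans (add_le_add (tri_le_iSup x c.1 c.2) (tri_le_iSup y c.1 c.2))
  neg' x := by simp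
  smul' z x := by
    simp_rw [map_smul, LinearMap.smul_apply, norm_smul, Real.mul_iSup_of_nonneg (norm_nonneg z)]
  mul_le' := iSup_tri_mul_le
  star_mul_self' x := by
    refine le_antisymm ?_ ?_
    · rw [sq]
      exact (iSup_tri_mul_le _ _).trans
        (mul_le_mul_of_nonneg_right (iSup_tri_star x) (iSup_tri_nonneg x))
    · rw [← Real.le_sqrt (iSup_tri_nonneg x) (iSup_tri_nonneg _)]
      refine ciSup_le fun c => Real.le_sqrt_of_sq_le ?_
      rw [sq, ← CStarRing.norm_star_mul_self, ← tri_star, ← tri_mul]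
      refine tri_le_iSup _ _ ?_
      rw [CStarRing.norm_star_mul_self]
      nlinarith [norm_nonneg c.1, c.2]

theorem norm_tri_le (x : A ⊗[ℂ] B) (c : C) :
    ‖tri x c‖ ≤ ‖c‖ * maxSeminorm (A ⊗[ℂ] B) x := by
  rcases eq_or_ne c 0 with rfl | hc
  · simp
  have hc' := norm_pos_iff.mpr hc
  have h1 := tri_le_iSup x (((‖c‖⁻¹ : ℝ) : ℂ) • c) (by rw [norm_smul]; simp [hc'.ne'])
  have h2 := le_maxSeminorm (triSeminorm A B C) x
  have h3 := h1.trans h2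
  rw [map_smul, norm_smul, Complex.norm_real, norm_inv, norm_norm, inv_mul_le_iff₀ hc'] at h3
  exact h3

/-- The extension of a bounded linear map to the maximal tensor product. -/
def tensorExtend {E : Type*} [NormedAddCommGroup E] [NormedSpace ℂ E] [CompleteSpace E]
    (f : A ⊗[ℂ] B →ₗ[ℂ] E) (K : ℝ) (h : ∀ x, ‖f x‖ ≤ K * maxSeminorm (A ⊗[ℂ] B) x) :
    MaxTensor A B →L[ℂ] E := envExtend f K h

theorem tensorExtend_ofAlg {E : Type*} [NormedAddCommGroup E] [NormedSpace ℂ E] [CompleteSpace E]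
    (f : A ⊗[ℂ] B →ₗ[ℂ] E) (K : ℝ) (h : ∀ x, ‖f x‖ ≤ K * maxSeminorm (A ⊗[ℂ] B) x)
    (x : A ⊗[ℂ] B) : tensorExtend f K h (ofAlg A B x) = f x := envExtend_toEnv f K h x

/-- The map `x ↦ x ⊗ c` on `A ⊗ B`, where `(a ⊗ b) ⊗ c = a ⊗ (b ⊗ c)`. -/
def triRight (c : C) : MaxTensor A B →L[ℂ] MaxTensor A (MaxTensor B C) :=
  tensorExtend (tri.flip c) ‖c‖ (fun x => norm_tri_le x c)

theorem triRight_ofAlg (c : C) (x : A ⊗[ℂ] B) : triRight c (ofAlg A B x) = tri x c :=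
  tensorExtend_ofAlg _ _ _ x

/-- The bilinear map `(x, c) ↦ x ⊗ c` on `A ⊗ B` and `C`. -/
def triExtend : MaxTensor A B →ₗ[ℂ] C →ₗ[ℂ] MaxTensor A (MaxTensor B C) :=
  LinearMap.mk₂ ℂ (fun x c => triRight c x)
    (fun x y c => map_add (triRight c) x y) (fun z x c => map_smul (triRight c) z x)
    (fun x c c' => by
      refine (denseRange_ofAlg A B).induction_on (p := fun x : MaxTensor A B =>
        triRight (c + c') x = triRight c x + triRight c' x) x
        (isClosed_eq (triRight _).continuous
          ((triRight c).continuous.add (triRight c').continuous)) (fun x => ?_)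
      rw [triRight_ofAlg, triRight_ofAlg, triRight_ofAlg, map_add])
    (fun z x c => by
      refine (denseRange_ofAlg A B).induction_on (p := fun x : MaxTensor A B =>
        triRight (z • c) x = z • triRight c x) x
        (isClosed_eq (triRight _).continuous ((triRight c).continuous.const_smul z))
        (fun x => ?_)
      rw [triRight_ofAlg, triRight_ofAlg, map_smul])

theorem triExtend_ofAlg (x : A ⊗[ℂ] B) (c : C) : triExtend (ofAlg A B x) c = tri x c :=
  triRight_ofAlg c x

theorem continuous_triExtend (c : C) :
    Continuous fun x : MaxTensor A B => triExtend x c :=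
  (triRight c).continuous

variable (A B C) in
/-- The canonical isomorphism `(A ⊗ B) ⊗ C → A ⊗ (B ⊗ C)`, `(a ⊗ b) ⊗ c ↦ a ⊗ (b ⊗ c)`. -/
def tensorAssoc : MaxTensor (MaxTensor A B) C →⋆ₙₐ[ℂ] MaxTensor A (MaxTensor B C) :=
  tensorLift triExtend
    (fun x y c c' => by
      have := continuous_triExtend (A := A) (B := B) (c * c')
      have := continuous_triExtend (A := A) (B := B) c
      have := continuous_triExtend (A := A) (B := B) c'
      refine (denseRange_ofAlg A B).induction_on₂ (p := fun x y : MaxTensor A B =>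
        triExtend (x * y) (c * c') = triExtend x c * triExtend y c')
        (isClosed_eq (by fun_prop) (by fun_prop)) (fun x y => ?_) x y
      rw [← map_mul, triExtend_ofAlg, triExtend_ofAlg, triExtend_ofAlg, tri_mul])
    (fun x c => by
      have := continuous_triExtend (A := A) (B := B) c
      have := continuous_triExtend (A := A) (B := B) (star c)
      refine (denseRange_ofAlg A B).induction_on (p := fun x : MaxTensor A B =>
        triExtend (star x) (star c) = star (triExtend x c)) x
        (isClosed_eq (by fun_prop) (by fun_prop)) (fun x => ?_)
      rw [← map_star, triExtend_ofAlg, triExtend_ofAlg, tri_star])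

theorem tensorAssoc_tmul (a : A) (b : B) (c : C) :
    tensorAssoc A B C (tmul (tmul a b) c) = tmul a (tmul b c) :=
  (tensorLift_tmul _ _ _ _ _).trans ((triExtend_ofAlg _ _).trans (tri_tmul a b c))

/-- Homomorphisms on a threefold tensor product are determined by elementary tensors. -/
theorem tensor_hom_ext₃ {E : Type*} [NonUnitalCStarAlgebra E]
    {π ρ : MaxTensor (MaxTensor A B) C →⋆ₙₐ[ℂ] E}
    (h : ∀ a b c, π (tmul (tmul a b) c) = ρ (tmul (tmul a b) c)) : π = ρ :=
  tensor_hom_ext fun x c => by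
    have hc : Continuous fun x : MaxTensor A B => tmul x c :=
      AddMonoidHomClass.continuous_of_bound ((tmulBilin (MaxTensor A B) C).flip c) ‖c‖
        fun x => (norm_tmul_le x c).trans_eq (mul_comm _ _)
    have hπ := continuous_hom π
    have hρ := continuous_hom ρ
    refine (denseRange_ofAlg A B).induction_on (p := fun x : MaxTensor A B =>
      π (tmul x c) = ρ (tmul x c)) x (isClosed_eq (by fun_prop) (by fun_prop)) (fun x => ?_)
    induction x using TensorProduct.induction_on with
    | zero =>
      have : tmul (ofAlg A B 0) c = 0 := by
        rw [map_zero, ← tmulBilin_apply, map_zero, LinearMap.zero_apply]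
      rw [this, map_zero, map_zero]
    | add x y hx hy =>
      have : tmul (ofAlg A B (x + y)) c = tmul (ofAlg A B x) c + tmul (ofAlg A B y) c := by
        rw [map_add, ← tmulBilin_apply, map_add, LinearMap.add_apply]
        rfl
      rw [this, map_add, map_add, hx, hy]
    | tmul a b => exact h a b c

theorem tensorAssoc_natural {A' B' C' : Type*} [NonUnitalCStarAlgebra A']
    [NonUnitalCStarAlgebra B'] [NonUnitalCStarAlgebra C'] (f : A →⋆ₙₐ[ℂ] A') (g : B →⋆ₙₐ[ℂ] B')
    (h : C →⋆ₙₐ[ℂ] C') :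
    (tensorAssoc A' B' C').comp (tensorMap (tensorMap f g) h) =
      (tensorMap f (tensorMap g h)).comp (tensorAssoc A B C) :=
  tensor_hom_ext₃ fun a b c => by
    simp only [NonUnitalStarAlgHom.comp_apply, tensorMap_tmul, tensorAssoc_tmul]

end Assoc

end Tensor

/-! ### The comultiplication of `C⋆(Γ)` -/

section Comul

variable (Γ : Type*) [Group Γ]

/-- The comultiplication `Δ : C⋆(Γ) → C⋆(Γ) ⊗ C⋆(Γ)`, `γ ↦ γ ⊗ γ`. -/
def comul : GroupCStar Γ →⋆ₙₐ[ℂ] MaxTensor (GroupCStar Γ) (GroupCStar Γ) :=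
  envLift (groupAlgebraLift (fun γ : Γ => tmul (GroupCStar.of γ) (GroupCStar.of γ))
    (fun γ γ' => by rw [tmul_mul_tmul, GroupCStar.of_mul])
    (fun γ => by rw [star_tmul, GroupCStar.of_inv]))

theorem comul_of (γ : Γ) :
    comul Γ (GroupCStar.of γ) = tmul (GroupCStar.of γ) (GroupCStar.of γ) :=
  (envLift_toEnv _ _).trans (groupAlgebraLift_single _ _ _ γ)

end Comul

/-! ### `(ℂ,Γ)`-C⋆-algebras and their cotensor product -/

section Cotensor

open NonUnitalStarAlgHom (id)

/-- The structure of a `(ℂ,Γ)`-C⋆-algebra on a C⋆-algebra `A` (not necessarily unital): two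
commuting coactions of `C⋆(Γ)` on `A`, from the left and from the right. -/
structure CGammaStructure (Γ : Type*) [Group Γ] (A : Type*) [NonUnitalCStarAlgebra A] where
  /-- The left coaction `δ`. -/
  left : A →⋆ₙₐ[ℂ] MaxTensor (GroupCStar Γ) A
  /-- The right coaction `δ'`. -/
  right : A →⋆ₙₐ[ℂ] MaxTensor A (GroupCStar Γ)
  left_injective : Function.Injective left
  right_injective : Function.Injective right
  /-- `(id ⊗ δ) ∘ δ = (Δ ⊗ id) ∘ δ`. -/
  left_coassoc : (tensorMap (id ℂ (GroupCStar Γ)) left).comp left =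
    (tensorAssoc (GroupCStar Γ) (GroupCStar Γ) A).comp ((tensorMap (comul Γ) (id ℂ A)).comp left)
  /-- `(δ' ⊗ id) ∘ δ' = (id ⊗ Δ) ∘ δ'`. -/
  right_coassoc :
    (tensorAssoc A (GroupCStar Γ) (GroupCStar Γ)).comp
      ((tensorMap right (id ℂ (GroupCStar Γ))).comp right) =
    (tensorMap (id ℂ A) (comul Γ)).comp right
  /-- `(δ ⊗ id) ∘ δ' = (id ⊗ δ') ∘ δ`. -/
  left_right :
    (tensorAssoc (GroupCStar Γ) A (GroupCStar Γ)).comp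
      ((tensorMap left (id ℂ (GroupCStar Γ))).comp right) =
    (tensorMap (id ℂ (GroupCStar Γ)) right).comp left

variable {Γ : Type*} [Group Γ]
  {A B A' B' : Type*} [NonUnitalCStarAlgebra A] [NonUnitalCStarAlgebra B]
  [NonUnitalCStarAlgebra A'] [NonUnitalCStarAlgebra B']

/-- Morphisms of `(ℂ,Γ)`-C⋆-algebras: ⋆-homomorphisms that intertwine the coactions. -/
structure IsMorphism (cA : CGammaStructure Γ A) (cB : CGammaStructure Γ B) (π : A →⋆ₙₐ[ℂ] B) :
    Prop where
  left : cB.left.comp π = (tensorMap (id ℂ (GroupCStar Γ)) π).comp cA.left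
  right : cB.right.comp π = (tensorMap π (id ℂ (GroupCStar Γ))).comp cA.right

theorem tensorMap_id (A B : Type*) [NonUnitalCStarAlgebra A] [NonUnitalCStarAlgebra B] :
    tensorMap (id ℂ A) (id ℂ B) = id ℂ (MaxTensor A B) :=
  tensor_hom_ext fun a b => by rw [tensorMap_tmul]; rfl

theorem IsMorphism.refl (cA : CGammaStructure Γ A) : IsMorphism cA cA (id ℂ A) where
  left := by rw [tensorMap_id]; rfl
  right := by rw [tensorMap_id]; rfl

/-- A short exact sequence `J → A → C` of `(ℂ,Γ)`-C⋆-algebras. -/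
structure IsShortExact {J A C : Type*} [NonUnitalCStarAlgebra J] [NonUnitalCStarAlgebra A]
    [NonUnitalCStarAlgebra C] (cJ : CGammaStructure Γ J) (cA : CGammaStructure Γ A)
    (cC : CGammaStructure Γ C) (ι : J →⋆ₙₐ[ℂ] A) (π : A →⋆ₙₐ[ℂ] C) : Prop where
  morphism_ι : IsMorphism cJ cA ι
  morphism_π : IsMorphism cA cC π
  ker_ι : ∀ x, ι x = 0 → x = 0
  range_ι : Set.range ι = {a | π a = 0}
  range_π : Set.range π = Set.univ

/-- The subalgebra `{x ∈ A ⊗ B : (δ'_A ⊗ id) x = (id ⊗ δ_B) x}` of the maximal tensor product. -/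
def cotensorSubalgebra (cA : CGammaStructure Γ A) (cB : CGammaStructure Γ B) :
    NonUnitalStarSubalgebra ℂ (MaxTensor A B) where
  carrier := {x | tensorAssoc A (GroupCStar Γ) B (tensorMap cA.right (id ℂ B) x) =
    tensorMap (id ℂ A) cB.left x}
  add_mem' {x y} hx hy := by
    simp only [Set.mem_ofPred_eq] at hx hy ⊢
    rw [map_add, map_add, map_add, hx, hy]
  zero_mem' := by simp
  mul_mem' {x y} hx hy := by
    simp only [Set.mem_ofPred_eq] at hx hy ⊢
    rw [map_mul, map_mul, map_mul, hx, hy]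
  smul_mem' c x hx := by
    simp only [Set.mem_ofPred_eq] at hx ⊢
    rw [map_smul, map_smul, map_smul, hx]
  star_mem' {x} hx := by
    simp only [Set.mem_ofPred_eq] at hx ⊢
    rw [map_star, map_star, map_star, hx]

theorem mem_cotensorSubalgebra (cA : CGammaStructure Γ A) (cB : CGammaStructure Γ B)
    (x : MaxTensor A B) : x ∈ cotensorSubalgebra cA cB ↔
      tensorAssoc A (GroupCStar Γ) B (tensorMap cA.right (id ℂ B) x) =
        tensorMap (id ℂ A) cB.left x := Iff.rfl

theorem isClosed_cotensorSubalgebra (cA : CGammaStructure Γ A) (cB : CGammaStructure Γ B) :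
    IsClosed (cotensorSubalgebra cA cB : Set (MaxTensor A B)) :=
  isClosed_eq ((continuous_hom _).comp (continuous_hom _)) (continuous_hom _)

/-- The maximal cotensor product of two `(ℂ,Γ)`-C⋆-algebras `A` and `B`. -/
def Cotensor (cA : CGammaStructure Γ A) (cB : CGammaStructure Γ B) : Type _ :=
  cotensorSubalgebra cA cB

instance (cA : CGammaStructure Γ A) (cB : CGammaStructure Γ B) :
    NonUnitalCStarAlgebra (Cotensor cA cB) :=
  NonUnitalStarSubalgebra.nonUnitalCStarAlgebra (cotensorSubalgebra cA cB)
    (h_closed := isClosed_cotensorSubalgebra cA cB)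

/-- The inclusion of the cotensor product into the maximal tensor product. -/
def cotensorIncl (cA : CGammaStructure Γ A) (cB : CGammaStructure Γ B) :
    Cotensor cA cB →⋆ₙₐ[ℂ] MaxTensor A B :=
  NonUnitalStarSubalgebraClass.subtype (cotensorSubalgebra cA cB)

theorem cotensorIncl_injective (cA : CGammaStructure Γ A) (cB : CGammaStructure Γ B) :
    Function.Injective (cotensorIncl cA cB) := Subtype.val_injective

theorem range_cotensorIncl (cA : CGammaStructure Γ A) (cB : CGammaStructure Γ B) :
    Set.range (cotensorIncl cA cB) = cotensorSubalgebra cA cB := Subtype.range_val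

theorem tensorMap_mem_cotensor {cA : CGammaStructure Γ A} {cB : CGammaStructure Γ B}
    {cA' : CGammaStructure Γ A'} {cB' : CGammaStructure Γ B'} {φ : A →⋆ₙₐ[ℂ] A'}
    {ψ : B →⋆ₙₐ[ℂ] B'} (hφ : IsMorphism cA cA' φ) (hψ : IsMorphism cB cB' ψ)
    (x : MaxTensor A B) (hx : x ∈ cotensorSubalgebra cA cB) :
    tensorMap φ ψ x ∈ cotensorSubalgebra cA' cB' := by
  rw [mem_cotensorSubalgebra] at hx ⊢
  have h1 : (tensorMap cA'.right (id ℂ B')).comp (tensorMap φ ψ) =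
      (tensorMap (tensorMap φ (id ℂ (GroupCStar Γ))) ψ).comp (tensorMap cA.right (id ℂ B)) := by
    rw [tensorMap_comp, tensorMap_comp, hφ.right]
    rfl
  have h2 : (tensorMap (id ℂ A') cB'.left).comp (tensorMap φ ψ) =
      (tensorMap φ (tensorMap (id ℂ (GroupCStar Γ)) ψ)).comp (tensorMap (id ℂ A) cB.left) := by
    rw [tensorMap_comp, tensorMap_comp, hψ.left]
    rfl
  have h3 := DFunLike.congr_fun (tensorAssoc_natural φ (id ℂ (GroupCStar Γ)) ψ)
    (tensorMap cA.right (id ℂ B) x)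
  rw [NonUnitalStarAlgHom.comp_apply, NonUnitalStarAlgHom.comp_apply] at h3
  rw [← NonUnitalStarAlgHom.comp_apply (tensorMap cA'.right (id ℂ B')), h1,
    ← NonUnitalStarAlgHom.comp_apply (tensorMap (id ℂ A') cB'.left), h2,
    NonUnitalStarAlgHom.comp_apply, NonUnitalStarAlgHom.comp_apply, h3, hx]

/-- The restriction of `φ ⊗ ψ` to the cotensor products, for morphisms `φ` and `ψ`. -/
def cotensorMap {cA : CGammaStructure Γ A} {cB : CGammaStructure Γ B}
    {cA' : CGammaStructure Γ A'} {cB' : CGammaStructure Γ B'} {φ : A →⋆ₙₐ[ℂ] A'}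
    {ψ : B →⋆ₙₐ[ℂ] B'} (hφ : IsMorphism cA cA' φ) (hψ : IsMorphism cB cB' ψ) :
    Cotensor cA cB →⋆ₙₐ[ℂ] Cotensor cA' cB' :=
  NonUnitalStarAlgHom.codRestrict ((tensorMap φ ψ).comp (cotensorIncl cA cB))
    (cotensorSubalgebra cA' cB') fun x => tensorMap_mem_cotensor hφ hψ _ x.2

theorem cotensorIncl_cotensorMap {cA : CGammaStructure Γ A} {cB : CGammaStructure Γ B}
    {cA' : CGammaStructure Γ A'} {cB' : CGammaStructure Γ B'} {φ : A →⋆ₙₐ[ℂ] A'}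
    {ψ : B →⋆ₙₐ[ℂ] B'} (hφ : IsMorphism cA cA' φ) (hψ : IsMorphism cB cB' ψ)
    (x : Cotensor cA cB) :
    cotensorIncl cA' cB' (cotensorMap hφ hψ x) = tensorMap φ ψ (cotensorIncl cA cB x) := rfl

/-- The condition that the coactions on the cotensor product are the restrictions of the coactions
`δ_A ⊗ id` and `id ⊗ δ'_B` on `A ⊗ B`. -/
structure IsRestriction (cA : CGammaStructure Γ A) (cB : CGammaStructure Γ B)
    (c : CGammaStructure Γ (Cotensor cA cB)) : Prop where
  left : (tensorMap (id ℂ (GroupCStar Γ)) (cotensorIncl cA cB)).comp c.left =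
    (tensorAssoc (GroupCStar Γ) A B).comp
      ((tensorMap cA.left (id ℂ B)).comp (cotensorIncl cA cB))
  right : (tensorAssoc A B (GroupCStar Γ)).comp
      ((tensorMap (cotensorIncl cA cB) (id ℂ (GroupCStar Γ))).comp c.right) =
    (tensorMap (id ℂ A) cB.right).comp (cotensorIncl cA cB)

end Cotensor

end CGamma

end

/-! Let `ω` be the vector functional on `C⋆(Γ) ⊗ C⋆(Γ)` given by left and right translation on
`ℓ²(Γ)` and the unit vector at `1`, so that `ω (γ ⊗ γ')` is `1` if `γ = γ'` and `0` otherwise.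
Slicing the map `δ̄_A ⊗ δ_D` by `ω` yields a completely positive projection `E` of `A ⊗ D` onto the
cotensor product `A ⊗^Γ D`, natural in `A` and `D`. Completely positive maps remain bounded after
taking maximal tensor products with an identity map, so `C⋆(Γ) ⊗ (A ⊗^Γ D)` embeds into
`C⋆(Γ) ⊗ (A ⊗ D)`, where the restricted coactions can be compared with the given ones. Naturality
of `E` makes the sequence of cotensor products a retract of the sequence of maximal tensor products,
from which it inherits exactness. -/

noncomputable section

namespace CGamma

open Filter Topology

/-! ### Positive maps on ⋆-algebras -/

section Positive

attribute [local instance] CStarAlgebra.spectralOrder CStarAlgebra.spectralOrderedRing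

theorem norm_le_norm_of_neg_le_of_le {E : Type*} [NonUnitalCStarAlgebra E] {a b : E}
    (hneg : -b ≤ a) (hle : a ≤ b) : ‖a‖ ≤ ‖b‖ := by
  have hb₀ : 0 ≤ b := by
    have h : 0 ≤ (2 : ℝ) • b := by simpa [two_smul] using sub_nonneg.mpr (hneg.trans hle)
    simpa [smul_smul] using smul_nonneg (by norm_num : (0 : ℝ) ≤ 2⁻¹) h
  have hb : IsSelfAdjoint b := .of_nonneg hb₀
  have ha : IsSelfAdjoint a := by simpa using hb.sub (.of_nonneg (sub_nonneg.mpr hle))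
  have ha' : IsSelfAdjoint (a : Unitization ℂ E) := ha.inr ℂ
  have le_norm {c : E} (hc : IsSelfAdjoint c) (hcb : c ≤ b) :
      (c : Unitization ℂ E) ≤ algebraMap ℝ _ ‖b‖ := by
    rw [← Unitization.norm_inr (𝕜 := ℂ) b]
    exact ((Unitization.inr_le_iff c b hc).mpr hcb).trans (hb.inr ℂ).le_algebraMap_norm_self
  rw [← Unitization.norm_inr (𝕜 := ℂ) a]
  rcases CStarAlgebra.norm_or_neg_norm_mem_spectrum ha' with h | h
  · exact (le_algebraMap_iff_spectrum_le ha').mp (le_norm ha hle) _ h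
  · have h' : ‖(a : Unitization ℂ E)‖ ∈ spectrum ℝ (-(a : Unitization ℂ E)) := by
      rw [← spectrum.neg_eq]
      simpa using h
    exact (le_algebraMap_iff_spectrum_le ha'.neg).mp
      (by simpa using le_norm ha.neg (neg_le.mp hneg)) _ h'

variable {X : Type*} [NonUnitalRing X] [StarRing X] [Module ℂ X]
  {E : Type*} [NonUnitalCStarAlgebra E]

/-- The `L²`-seminorm `x ↦ ‖Q(x⋆x)‖^(1/2)` of a positive map `Q`. -/
def formNorm (Q : X →ₗ[ℂ] E) (x : X) : ℝ := √‖Q (star x * x)‖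

/-- The operator norm of the left multiplication by `x` with respect to the `L²`-seminorm of `Q`.
It is meaningful only if the left multiplication is bounded; otherwise the supremum is `0`. -/
def formOpNorm (Q : X →ₗ[ℂ] E) (x : X) : ℝ :=
  ⨆ w : {w : X // formNorm Q w ≤ 1}, formNorm Q (x * w.1)

section Basic

variable (Q : X →ₗ[ℂ] E)

@[simp]
theorem formNorm_zero : formNorm Q 0 = 0 := by simp [formNorm]

theorem formNorm_nonneg (x : X) : 0 ≤ formNorm Q x := Real.sqrt_nonneg _

theorem formOpNorm_nonneg (x : X) : 0 ≤ formOpNorm Q x :=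
  Real.iSup_nonneg fun _ => formNorm_nonneg _ _

theorem sq_formNorm (x : X) : formNorm Q x ^ 2 = ‖Q (star x * x)‖ :=
  Real.sq_sqrt (norm_nonneg _)

theorem formNorm_smul [IsScalarTower ℂ X X] [SMulCommClass ℂ X X] [StarModule ℂ X] (c : ℂ)
    (x : X) :
    formNorm Q (c • x) = ‖c‖ * formNorm Q x := by
  rw [formNorm, star_smul, smul_mul_smul_comm, map_smul, norm_smul, norm_mul, norm_star, ← sq,
    Real.sqrt_mul (by positivity), Real.sqrt_sq (norm_nonneg _), formNorm]

variable {Q}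

theorem formOpNorm_le {x : X} {M : ℝ} (h : ∀ w, formNorm Q w ≤ 1 → formNorm Q (x * w) ≤ M) :
    formOpNorm Q x ≤ M :=
  have : Nonempty {w : X // formNorm Q w ≤ 1} := ⟨⟨0, by simp⟩⟩
  ciSup_le fun w => h w.1 w.2

end Basic

section CauchySchwarz

variable [IsScalarTower ℂ X X] [SMulCommClass ℂ X X] [StarModule ℂ X] {Q : X →ₗ[ℂ] E}
  (hQ : ∀ x, 0 ≤ Q (star x * x))

include hQ

/- The positivity of `Q ((s x ± y)⋆ (s x ± y))` bounds `s (Q (x⋆y) + Q (y⋆x))` for all real `s`, and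
the claim is that the discriminant of the resulting quadratic polynomial is nonpositive. -/
theorem norm_map_star_mul_add_le (x y : X) :
    ‖Q (star x * y) + Q (star y * x)‖ ≤ 2 * (formNorm Q x * formNorm Q y) := by
  set N := Q (star x * y) + Q (star y * x) with hN
  have expand (s : ℝ) : Q (star ((s : ℂ) • x + y) * ((s : ℂ) • x + y)) =
      (s ^ 2) • Q (star x * x) + Q (star y * y) + s • N := by
    rw [← Complex.coe_smul, ← Complex.coe_smul s, Complex.ofReal_pow, sq]
    simp only [star_add, star_smul, Complex.star_def, Complex.conj_ofReal, add_mul, mul_add,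
      smul_mul_assoc, mul_smul_comm, map_add, map_smul, hN, smul_add, smul_smul]
    abel
  have bound (s : ℝ) : |s| * ‖N‖ ≤ s ^ 2 * formNorm Q x ^ 2 + formNorm Q y ^ 2 := by
    have hpos := expand s ▸ hQ ((s : ℂ) • x + y)
    have hneg := expand (-s) ▸ hQ (((-s : ℝ) : ℂ) • x + y)
    rw [neg_sq, neg_smul] at hneg
    have h := norm_le_norm_of_neg_le_of_le (neg_le_iff_add_nonneg'.mpr hpos)
      (sub_nonneg.mp (by rwa [sub_eq_add_neg]))
    rw [norm_smul, Real.norm_eq_abs] at h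
    refine h.trans ((norm_add_le _ _).trans_eq ?_)
    rw [norm_smul, Real.norm_of_nonneg (sq_nonneg s), sq_formNorm, sq_formNorm]
  have hdiscrim : discrim (formNorm Q x ^ 2) (-‖N‖) (formNorm Q y ^ 2) ≤ 0 :=
    discrim_le_zero fun s => by
      have := bound s
      nlinarith [mul_le_mul_of_nonneg_right (le_abs_self s) (norm_nonneg N)]
  refine (abs_le_of_sq_le_sq' ?_ ?_).2
  · rw [discrim] at hdiscrim
    linarith
  · have := formNorm_nonneg Q x
    have := formNorm_nonneg Q y
    positivity

theorem norm_map_star_mul_le (x y : X) :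
    ‖Q (star x * y)‖ ≤ 2 * (formNorm Q x * formNorm Q y) := by
  have hsum := norm_map_star_mul_add_le hQ x y
  have hdiff : ‖Q (star x * y) - Q (star y * x)‖ ≤ 2 * (formNorm Q x * formNorm Q y) := by
    have h := norm_map_star_mul_add_le hQ x (Complex.I • y)
    rw [formNorm_smul, Complex.norm_I, one_mul, star_smul, mul_smul_comm, smul_mul_assoc, map_smul,
      map_smul, Complex.star_def, Complex.conj_I, neg_smul, ← sub_eq_add_neg, ← smul_sub,
      norm_smul, Complex.norm_I, one_mul] at h
    exact h
  have hdouble : (2 : ℝ) • Q (star x * y) =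
      (Q (star x * y) + Q (star y * x)) + (Q (star x * y) - Q (star y * x)) := by
    rw [two_smul]
    abel
  have h := norm_add_le (Q (star x * y) + Q (star y * x)) (Q (star x * y) - Q (star y * x))
  rw [← hdouble, norm_smul, Real.norm_ofNat] at h
  linarith

theorem formNorm_add_le (x y : X) : formNorm Q (x + y) ≤ formNorm Q x + formNorm Q y := by
  refine (abs_le_of_sq_le_sq' ?_ (add_nonneg (formNorm_nonneg Q x) (formNorm_nonneg Q y))).2
  have expand : Q (star (x + y) * (x + y)) =
      Q (star x * x) + (Q (star x * y) + Q (star y * x)) + Q (star y * y) := by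
    simp only [star_add, add_mul, mul_add, map_add]
    abel
  calc formNorm Q (x + y) ^ 2
      ≤ ‖Q (star x * x)‖ + ‖Q (star x * y) + Q (star y * x)‖ + ‖Q (star y * y)‖ := by
        rw [sq_formNorm, expand]
        exact norm_add₃_le
    _ ≤ formNorm Q x ^ 2 + 2 * (formNorm Q x * formNorm Q y) + formNorm Q y ^ 2 := by
        rw [sq_formNorm, sq_formNorm]
        gcongr
        exact norm_map_star_mul_add_le hQ x y
    _ = (formNorm Q x + formNorm Q y) ^ 2 := by ring

theorem sq_formNorm_mul_le (x w : X) :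
    formNorm Q (x * w) ^ 2 ≤ formNorm Q w * formNorm Q (star x * x * w) := by
  have h := norm_map_star_mul_add_le hQ w (star x * x * w)
  have hleft : star w * (star x * x * w) = star (x * w) * (x * w) := by
    simp only [star_mul, mul_assoc]
  have hright : star (star x * x * w) * w = star (x * w) * (x * w) := by
    simp only [star_mul, star_star, mul_assoc]
  rw [hleft, hright, ← two_smul ℝ, norm_smul, Real.norm_ofNat, ← sq_formNorm] at h
  linarith

theorem formNorm_mul_le_of_sub_sq_eq {x s t : X}
    (h : star x * x - star x * x * (star x * x) = star s * s + star t * t) (w : X) :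
    formNorm Q (x * w) ≤ formNorm Q w := by
  have hdiff : star (x * w) * (x * w) - star (star x * x * w) * (star x * x * w) =
      star (s * w) * (s * w) + star (t * w) * (t * w) := by
    calc _ = star w * (star x * x - star x * x * (star x * x)) * w := by
          simp only [star_mul, star_star, mul_sub, sub_mul, mul_assoc]
      _ = _ := by
          rw [h]
          simp only [star_mul, mul_add, add_mul, mul_assoc]
  have hle : Q (star (star x * x * w) * (star x * x * w)) ≤ Q (star (x * w) * (x * w)) := by
    rw [← sub_nonneg, ← map_sub, hdiff, map_add]
    exact add_nonneg (hQ _) (hQ _)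
  have hsq : formNorm Q (star x * x * w) ≤ formNorm Q (x * w) :=
    Real.sqrt_le_sqrt (CStarAlgebra.norm_le_norm_of_nonneg_of_le (hQ _) hle)
  have := sq_formNorm_mul_le hQ x w
  have := formNorm_nonneg Q (x * w)
  have := formNorm_nonneg Q w
  by_contra! hlt
  nlinarith

end CauchySchwarz

section OperatorNorm

variable [IsScalarTower ℂ X X] [SMulCommClass ℂ X X] [StarModule ℂ X] {Q : X →ₗ[ℂ] E}
  (hmul : ∀ x, ∃ M, ∀ w, formNorm Q (x * w) ≤ M * formNorm Q w)

include hmul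

theorem formNorm_mul_le (x w : X) : formNorm Q (x * w) ≤ formOpNorm Q x * formNorm Q w := by
  obtain ⟨M, hM⟩ := hmul x
  rcases (formNorm_nonneg Q w).eq_or_lt with hw | hw
  · have := hM w
    rwa [← hw, mul_zero] at this ⊢
  have hbdd : BddAbove (Set.range fun w : {w : X // formNorm Q w ≤ 1} => formNorm Q (x * w.1)) := by
    refine ⟨|M|, ?_⟩
    rintro _ ⟨⟨v, hv⟩, rfl⟩
    calc formNorm Q (x * v) ≤ M * formNorm Q v := hM v
      _ ≤ |M| * 1 := mul_le_mul (le_abs_self M) hv (formNorm_nonneg Q v) (abs_nonneg M)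
      _ = |M| := mul_one _
  have hnorm : ‖(((formNorm Q w)⁻¹ : ℝ) : ℂ)‖ = (formNorm Q w)⁻¹ := by
    rw [Complex.norm_real, norm_inv, Real.norm_of_nonneg hw.le]
  have h := le_ciSup hbdd ⟨(((formNorm Q w)⁻¹ : ℝ) : ℂ) • w, by
    rw [formNorm_smul, hnorm, inv_mul_cancel₀ hw.ne']⟩
  rwa [mul_smul_comm, formNorm_smul, hnorm, inv_mul_le_iff₀ hw, mul_comm] at h

theorem formNorm_mul_le_formOpNorm (x : X) {w : X} (hw : formNorm Q w ≤ 1) :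
    formNorm Q (x * w) ≤ formOpNorm Q x :=
  (formNorm_mul_le hmul x w).trans (mul_le_of_le_one_right (formOpNorm_nonneg Q x) hw)

theorem formOpNorm_mul_le (x y : X) : formOpNorm Q (x * y) ≤ formOpNorm Q x * formOpNorm Q y :=
  formOpNorm_le fun w hw => by
    rw [mul_assoc]
    exact (formNorm_mul_le hmul x _).trans
      (mul_le_mul_of_nonneg_left (formNorm_mul_le_formOpNorm hmul y hw) (formOpNorm_nonneg Q x))

variable (hQ : ∀ x, 0 ≤ Q (star x * x))

include hQ

theorem sq_formOpNorm_le (x : X) : formOpNorm Q x ^ 2 ≤ formOpNorm Q (star x * x) := by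
  rw [← Real.le_sqrt (formOpNorm_nonneg Q x) (formOpNorm_nonneg Q _)]
  refine formOpNorm_le fun w hw => Real.le_sqrt_of_sq_le ?_
  calc formNorm Q (x * w) ^ 2 ≤ formNorm Q w * formNorm Q (star x * x * w) :=
        sq_formNorm_mul_le hQ x w
    _ ≤ 1 * formOpNorm Q (star x * x) := mul_le_mul hw (formNorm_mul_le_formOpNorm hmul _ hw)
        (formNorm_nonneg Q _) zero_le_one
    _ = formOpNorm Q (star x * x) := one_mul _

theorem formOpNorm_le_formOpNorm_star (x : X) : formOpNorm Q x ≤ formOpNorm Q (star x) := by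
  by_contra! hlt
  have := sq_formOpNorm_le hmul hQ x
  have := formOpNorm_mul_le hmul (star x) x
  nlinarith [formOpNorm_nonneg Q (star x), formOpNorm_nonneg Q x]

/-- The C⋆-seminorm of the representation that a positive map `Q` induces on the Hilbert module
obtained from the `L²`-seminorm of `Q`. -/
def formSeminorm : CStarSeminorm X where
  toFun := formOpNorm Q
  map_zero' := le_antisymm (formOpNorm_le fun w _ => by simp) (formOpNorm_nonneg Q _)
  add_le' x y := formOpNorm_le fun w hw => by
    rw [add_mul]
    exact (formNorm_add_le hQ _ _).trans (add_le_add (formNorm_mul_le_formOpNorm hmul x hw)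
      (formNorm_mul_le_formOpNorm hmul y hw))
  neg' x := by simp [formOpNorm, formNorm]
  smul' c x := by
    simp_rw [formOpNorm, smul_mul_assoc, formNorm_smul, Real.mul_iSup_of_nonneg (norm_nonneg c)]
  mul_le' := formOpNorm_mul_le hmul
  star_mul_self' x := by
    refine le_antisymm ((formOpNorm_mul_le hmul _ _).trans ?_) (sq_formOpNorm_le hmul hQ x)
    have h := formOpNorm_le_formOpNorm_star hmul hQ (star x)
    rw [star_star] at h
    rw [sq]
    exact mul_le_mul_of_nonneg_right h (formOpNorm_nonneg Q x)

theorem norm_map_le_of_approximateUnit {ι : Type*} {l : Filter ι} [l.NeBot] {e : ι → X} {c : ℝ}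
    (hc : ∀ᶠ i in l, formNorm Q (e i) ≤ c ∧ formNorm Q (star (e i)) ≤ c)
    (hleft : ∀ x, Tendsto (fun i => Q (e i * x)) l (𝓝 (Q x)))
    (hright : ∀ x, Tendsto (fun i => Q (x * e i)) l (𝓝 (Q x))) (x : X) :
    ‖Q x‖ ≤ 4 * c ^ 2 * formOpNorm Q x := by
  have hc₀ : 0 ≤ c := hc.exists.elim fun i hi => (formNorm_nonneg Q _).trans hi.1
  have hx := formOpNorm_nonneg Q x
  have hx' := formNorm_nonneg Q x
  have hform : formNorm Q x ≤ 2 * (formOpNorm Q x * c) := by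
    have hsq : formNorm Q x ^ 2 ≤ 2 * (formNorm Q x * (formOpNorm Q x * c)) := by
      rw [sq_formNorm]
      refine le_of_tendsto (hright (star x * x)).norm (hc.mono fun i hi => ?_)
      rw [mul_assoc]
      refine (norm_map_star_mul_le hQ x (x * e i)).trans ?_
      gcongr
      exact (formNorm_mul_le hmul x (e i)).trans (mul_le_mul_of_nonneg_left hi.1 hx)
    by_contra! hlt
    nlinarith [mul_nonneg hx hc₀]
  calc ‖Q x‖ ≤ 2 * (c * formNorm Q x) := by
        refine le_of_tendsto (hleft x).norm (hc.mono fun i hi => ?_)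
        have h := norm_map_star_mul_le hQ (star (e i)) x
        rw [star_star] at h
        exact h.trans (by gcongr; exact hi.2)
    _ ≤ 2 * (c * (2 * (formOpNorm Q x * c))) := by gcongr
    _ = 4 * c ^ 2 * formOpNorm Q x := by ring

end OperatorNorm

end Positive

/-! ### Positive maps on tensor products -/

section PositiveTensor

attribute [local instance] CStarAlgebra.spectralOrder CStarAlgebra.spectralOrderedRing

variable {A B E : Type*} [NonUnitalCStarAlgebra A] [NonUnitalCStarAlgebra B]
  [NonUnitalCStarAlgebra E] {Q : A ⊗[ℂ] B →ₗ[ℂ] E}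

theorem exists_star_tmul_mul_sub_sq_eq {a : A} {b : B} (ha : ‖a‖ ≤ 1) (hb : ‖b‖ ≤ 1) :
    ∃ s t : A ⊗[ℂ] B, star (a ⊗ₜ[ℂ] b) * (a ⊗ₜ[ℂ] b) -
      star (a ⊗ₜ[ℂ] b) * (a ⊗ₜ[ℂ] b) * (star (a ⊗ₜ[ℂ] b) * (a ⊗ₜ[ℂ] b)) =
        star s * s + star t * t := by
  obtain ⟨s, hs⟩ := CStarAlgebra.nonneg_iff_eq_star_mul_self.mp
    (sub_nonneg.mpr (sq_le_self_of_norm_le_one a ha))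
  obtain ⟨t, ht⟩ := CStarAlgebra.nonneg_iff_eq_star_mul_self.mp
    (sub_nonneg.mpr (sq_le_self_of_norm_le_one b hb))
  refine ⟨s ⊗ₜ b, (star a * a) ⊗ₜ t, ?_⟩
  simp only [TensorProduct.star_tmul, Algebra.TensorProduct.tmul_mul_tmul, ← hs, ← ht, star_mul,
    star_star, TensorProduct.sub_tmul, TensorProduct.tmul_sub]
  abel

section Bounds

variable (hQ : ∀ x, 0 ≤ Q (star x * x))

include hQ

theorem formNorm_tmul_mul_le (a : A) (b : B) (w : A ⊗[ℂ] B) :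
    formNorm Q (a ⊗ₜ b * w) ≤ ‖a‖ * ‖b‖ * formNorm Q w := by
  rcases eq_or_ne a 0 with rfl | ha
  · simp
  rcases eq_or_ne b 0 with rfl | hb
  · simp
  obtain ⟨s, t, hst⟩ := exists_star_tmul_mul_sub_sq_eq (a := ((‖a‖⁻¹ : ℝ) : ℂ) • a)
    (b := ((‖b‖⁻¹ : ℝ) : ℂ) • b) (by simp [norm_smul, ha]) (by simp [norm_smul, hb])
  have h := formNorm_mul_le_of_sub_sq_eq hQ hst w
  rw [TensorProduct.smul_tmul_smul, smul_mul_assoc, formNorm_smul, norm_mul, Complex.norm_real,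
    Complex.norm_real, norm_inv, norm_inv, norm_norm, norm_norm, ← mul_inv] at h
  exact (inv_mul_le_iff₀ (mul_pos (norm_pos_iff.mpr ha) (norm_pos_iff.mpr hb))).mp h

theorem exists_forall_formNorm_mul_le (x : A ⊗[ℂ] B) :
    ∃ M, ∀ w, formNorm Q (x * w) ≤ M * formNorm Q w := by
  induction x using TensorProduct.induction_on with
  | zero => exact ⟨0, by simp⟩
  | add x y hx hy =>
    obtain ⟨M, hM⟩ := hx
    obtain ⟨M', hM'⟩ := hy
    refine ⟨M + M', fun w => ?_⟩
    rw [add_mul, add_mul]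
    exact (formNorm_add_le hQ _ _).trans (add_le_add (hM w) (hM' w))
  | tmul a b => exact ⟨‖a‖ * ‖b‖, formNorm_tmul_mul_le hQ a b⟩

end Bounds

section ApproximateUnit

variable {K : ℝ} (hK : ∀ a b, ‖Q (a ⊗ₜ b)‖ ≤ K * ‖a‖ * ‖b‖)

include hK

theorem tendsto_map_tmul {ι : Type*} {l : Filter ι} {f : ι → A} {g : ι → B} {a : A} {b : B}
    (hf : Tendsto f l (𝓝 a)) (hg : Tendsto g l (𝓝 b)) :
    Tendsto (fun i => Q (f i ⊗ₜ g i)) l (𝓝 (Q (a ⊗ₜ b))) :=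
  ((LinearMap.mkContinuous₂ (TensorProduct.curry Q) K hK).continuous₂.tendsto (a, b)).comp
    (hf.prodMk_nhds hg)

theorem tendsto_map_approximateUnit_mul (x : A ⊗[ℂ] B) :
    Tendsto (fun e : A × B => Q (e.1 ⊗ₜ e.2 * x))
      (CStarAlgebra.approximateUnit A ×ˢ CStarAlgebra.approximateUnit B) (𝓝 (Q x)) := by
  induction x using TensorProduct.induction_on with
  | zero => simp
  | add x y hx hy => simpa only [mul_add, map_add] using hx.add hy
  | tmul a b =>
    simp only [Algebra.TensorProduct.tmul_mul_tmul]
    exact tendsto_map_tmul hK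
      (((CStarAlgebra.increasingApproximateUnit A).tendsto_mul_right a).comp tendsto_fst)
      (((CStarAlgebra.increasingApproximateUnit B).tendsto_mul_right b).comp tendsto_snd)

theorem tendsto_map_mul_approximateUnit (x : A ⊗[ℂ] B) :
    Tendsto (fun e : A × B => Q (x * e.1 ⊗ₜ e.2))
      (CStarAlgebra.approximateUnit A ×ˢ CStarAlgebra.approximateUnit B) (𝓝 (Q x)) := by
  induction x using TensorProduct.induction_on with
  | zero => simp
  | add x y hx hy => simpa only [add_mul, map_add] using hx.add hy
  | tmul a b =>
    simp only [Algebra.TensorProduct.tmul_mul_tmul]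
    exact tendsto_map_tmul hK
      (((CStarAlgebra.increasingApproximateUnit A).tendsto_mul_left a).comp tendsto_fst)
      (((CStarAlgebra.increasingApproximateUnit B).tendsto_mul_left b).comp tendsto_snd)

theorem formNorm_tmul_le (hK₀ : 0 ≤ K) {a : A} {b : B} (ha : ‖a‖ ≤ 1) (hb : ‖b‖ ≤ 1) :
    formNorm Q (a ⊗ₜ b) ≤ √K := by
  refine Real.sqrt_le_sqrt ?_
  rw [TensorProduct.star_tmul, Algebra.TensorProduct.tmul_mul_tmul]
  calc ‖Q ((star a * a) ⊗ₜ (star b * b))‖ ≤ K * ‖star a * a‖ * ‖star b * b‖ := hK _ _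
    _ = K * (‖a‖ * ‖a‖) * (‖b‖ * ‖b‖) := by
        rw [CStarRing.norm_star_mul_self, CStarRing.norm_star_mul_self]
    _ ≤ K * (1 * 1) * (1 * 1) := by gcongr
    _ = K := by ring

theorem norm_map_le_maxSeminorm (hQ : ∀ x, 0 ≤ Q (star x * x)) (hK₀ : 0 ≤ K) (x : A ⊗[ℂ] B) :
    ‖Q x‖ ≤ 4 * K * maxSeminorm (A ⊗[ℂ] B) x := by
  have unitA := CStarAlgebra.increasingApproximateUnit A
  have unitB := CStarAlgebra.increasingApproximateUnit B
  have := unitA.neBot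
  have := unitB.neBot
  have hmul := exists_forall_formNorm_mul_le hQ
  have hunit : ∀ᶠ e : A × B in CStarAlgebra.approximateUnit A ×ˢ CStarAlgebra.approximateUnit B,
      formNorm Q (e.1 ⊗ₜ e.2) ≤ √K ∧ formNorm Q (star (e.1 ⊗ₜ[ℂ] e.2)) ≤ √K := by
    filter_upwards [unitA.eventually_norm.prod_inl _, unitB.eventually_norm.prod_inr _]
      with e he₁ he₂
    rw [TensorProduct.star_tmul]
    exact ⟨formNorm_tmul_le hK hK₀ he₁ he₂,
      formNorm_tmul_le hK hK₀ ((norm_star _).trans_le he₁) ((norm_star _).trans_le he₂)⟩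
  calc ‖Q x‖ ≤ 4 * √K ^ 2 * formOpNorm Q x := norm_map_le_of_approximateUnit hmul hQ hunit
        (tendsto_map_approximateUnit_mul hK) (tendsto_map_mul_approximateUnit hK) x
    _ = 4 * K * formOpNorm Q x := by rw [Real.sq_sqrt hK₀]
    _ ≤ 4 * K * maxSeminorm (A ⊗[ℂ] B) x := by
        gcongr
        exact le_maxSeminorm (formSeminorm hmul hQ) x

end ApproximateUnit

end PositiveTensor

/-! ### Completely positive maps -/

section CompletelyPositive

attribute [local instance] CStarAlgebra.spectralOrder CStarAlgebra.spectralOrderedRing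

/-- Complete positivity of a bounded map between `C⋆`-algebras: each matrix `(P (yᵢ⋆ yⱼ))` is of
the form `w⋆ w`. This form avoids an order on matrices, and it is what is used to extend `id ⊗ P`
to maximal tensor products. -/
def IsCP {Y Z : Type*} [NonUnitalCStarAlgebra Y] [NonUnitalCStarAlgebra Z] (P : Y →L[ℂ] Z) : Prop :=
  ∀ (n : ℕ) (y : Fin n → Y), ∃ (m : ℕ) (w : Fin m → Fin n → Z),
    ∀ i j, P (star (y i) * y j) = ∑ k, star (w k i) * w k j

theorem exists_fin_sum_tmul {R M N : Type*} [CommSemiring R] [AddCommMonoid M] [AddCommMonoid N]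
    [Module R M] [Module R N] (x : M ⊗[R] N) :
    ∃ (n : ℕ) (a : Fin n → M) (b : Fin n → N), x = ∑ i, a i ⊗ₜ[R] b i := by
  obtain ⟨S, hS⟩ := TensorProduct.exists_finset x
  refine ⟨S.card, fun i => (S.equivFin.symm i).1.1, fun i => (S.equivFin.symm i).1.2, ?_⟩
  rw [hS, ← Finset.sum_coe_sort S]
  exact (S.equivFin.symm.sum_comp fun s : S => s.1.1 ⊗ₜ[R] s.1.2).symm

variable {B Y Z : Type*} [NonUnitalCStarAlgebra B] [NonUnitalCStarAlgebra Y]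
  [NonUnitalCStarAlgebra Z]

theorem tmul_sum {ι : Type*} (b : B) (s : Finset ι) (f : ι → Y) :
    tmul b (∑ i ∈ s, f i) = ∑ i ∈ s, tmul b (f i) := map_sum (tmulBilin B Y b) f s

variable (B) in
/-- The map `id ⊗ P` from the algebraic to the maximal tensor product. -/
def algIdTensor (P : Y →L[ℂ] Z) : B ⊗[ℂ] Y →ₗ[ℂ] MaxTensor B Z :=
  (ofAlg B Z : B ⊗[ℂ] Z →ₗ[ℂ] MaxTensor B Z).comp (TensorProduct.map LinearMap.id (P : Y →ₗ[ℂ] Z))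

theorem algIdTensor_tmul (P : Y →L[ℂ] Z) (b : B) (y : Y) :
    algIdTensor B P (b ⊗ₜ y) = tmul b (P y) := rfl

variable {P : Y →L[ℂ] Z} (hP : IsCP P)

include hP in
theorem algIdTensor_star_mul_self_nonneg (x : B ⊗[ℂ] Y) : 0 ≤ algIdTensor B P (star x * x) := by
  obtain ⟨n, b, y, rfl⟩ := exists_fin_sum_tmul x
  obtain ⟨m, w, hw⟩ := hP n y
  have sum_squares : algIdTensor B P (star (∑ i, b i ⊗ₜ[ℂ] y i) * ∑ i, b i ⊗ₜ[ℂ] y i) =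
      ∑ k, star (∑ i, tmul (b i) (w k i)) * ∑ i, tmul (b i) (w k i) := by
    simp only [star_sum, Finset.sum_mul_sum, map_sum, TensorProduct.star_tmul,
      Algebra.TensorProduct.tmul_mul_tmul, algIdTensor_tmul, hw, star_tmul, tmul_mul_tmul, tmul_sum]
    rw [eq_comm, Finset.sum_comm]
    exact Finset.sum_congr rfl fun i _ => Finset.sum_comm
  rw [sum_squares]
  exact Finset.sum_nonneg fun k _ => star_mul_self_nonneg _

variable (B) in
/-- The map `id ⊗ P` on the maximal tensor product, for a completely positive map `P`. -/
def idTensor : MaxTensor B Y →L[ℂ] MaxTensor B Z :=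
  tensorExtend (algIdTensor B P) (4 * ‖P‖) <|
    norm_map_le_maxSeminorm (fun b y => by
      rw [algIdTensor_tmul, mul_comm ‖P‖, mul_assoc]
      exact (norm_tmul_le _ _).trans (mul_le_mul_of_nonneg_left (P.le_opNorm y) (norm_nonneg b)))
      (algIdTensor_star_mul_self_nonneg hP) (norm_nonneg P)

theorem idTensor_tmul (b : B) (y : Y) : idTensor B hP (tmul b y) = tmul b (P y) :=
  tensorExtend_ofAlg _ _ _ _

theorem idTensor_star_mul_self_nonneg (x : MaxTensor B Y) : 0 ≤ idTensor B hP (star x * x) := by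
  refine (denseRange_ofAlg B Y).induction_on (p := fun x => 0 ≤ idTensor B hP (star x * x)) x
    (CStarAlgebra.isClosed_nonneg.preimage (f := fun x => idTensor B hP (star x * x))
      (by fun_prop)) fun x => ?_
  rw [← map_star, ← map_mul]
  exact (algIdTensor_star_mul_self_nonneg hP x).trans_eq (tensorExtend_ofAlg _ _ _ _).symm

end CompletelyPositive

/-! ### Density of elementary tensors, symmetry -/

section Symmetry

variable {A B C : Type*} [NonUnitalCStarAlgebra A] [NonUnitalCStarAlgebra B]
  [NonUnitalCStarAlgebra C]

theorem continuous_tmul : Continuous fun p : A × B => tmul p.1 p.2 :=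
  (LinearMap.mkContinuous₂ (tmulBilin A B) 1 fun a b => by
    rw [one_mul]; exact norm_tmul_le a b).continuous₂

theorem tmul_zero (a : A) : tmul a (0 : B) = 0 := map_zero (tmulBilin A B a)

theorem zero_tmul (b : B) : tmul (0 : A) b = 0 := LinearMap.map_zero₂ (tmulBilin A B) b

variable (B) in
/-- The bounded map `b ↦ a ⊗ b`. -/
def tmulLeft (a : A) : B →L[ℂ] MaxTensor A B :=
  LinearMap.mkContinuous (tmulBilin A B a) ‖a‖ (norm_tmul_le a)

theorem tmulLeft_apply (a : A) (b : B) : tmulLeft B a b = tmul a b := rfl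

/-- A ⋆-homomorphism as a continuous linear map. -/
def homCLM (π : A →⋆ₙₐ[ℂ] B) : A →L[ℂ] B := ⟨(π : A →ₗ[ℂ] B), continuous_hom π⟩

theorem homCLM_apply (π : A →⋆ₙₐ[ℂ] B) (a : A) : homCLM π a = π a := rfl

theorem dense_span_tmul {S : Set A} {T : Set B} (hS : Dense (Submodule.span ℂ S : Set A))
    (hT : Dense (Submodule.span ℂ T : Set B)) :
    Dense (Submodule.span ℂ (Set.image2 tmul S T) : Set (MaxTensor A B)) := by
  set V := (Submodule.span ℂ (Set.image2 tmul S T)).topologicalClosure with hV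
  have tmul_mem (a : A) (b : B) : tmul a b ∈ V :=
    map_mem_closure₂ continuous_tmul (hS a) (hT b) fun a ha b hb => by
      have h := Submodule.apply_mem_map₂ (tmulBilin A B) ha hb
      rwa [Submodule.map₂_span_span] at h
  rw [← dense_closure, ← Submodule.topologicalClosure_coe, ← hV]
  refine (denseRange_ofAlg A B).mono ?_
  rintro _ ⟨x, rfl⟩
  induction x using TensorProduct.induction_on with
  | zero => exact (map_zero (ofAlg A B)).symm ▸ V.zero_mem
  | add x y hx hy => exact (map_add (ofAlg A B) x y).symm ▸ V.add_mem hx hy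
  | tmul a b => exact tmul_mem a b

theorem tensor_clm_ext {E : Type*} [NonUnitalCStarAlgebra E] {S : Set A} {T : Set B}
    (hS : Dense (Submodule.span ℂ S : Set A)) (hT : Dense (Submodule.span ℂ T : Set B))
    {f g : MaxTensor A B →L[ℂ] E} (h : ∀ a ∈ S, ∀ b ∈ T, f (tmul a b) = g (tmul a b)) : f = g :=
  ContinuousLinearMap.ext_on (dense_span_tmul hS hT) <| by
    rintro _ ⟨a, ha, b, hb, rfl⟩
    exact h a ha b hb

variable (A) in
theorem dense_span_univ : Dense (Submodule.span ℂ (Set.univ : Set A) : Set A) := by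
  simp

theorem hom_ext_of_dense {S : Set A} (hS : Dense (Submodule.span ℂ S : Set A))
    {π ρ : A →⋆ₙₐ[ℂ] B} (h : Set.EqOn π ρ S) : π = ρ := by
  have hCLM : homCLM π = homCLM ρ := ContinuousLinearMap.ext_on hS h
  exact DFunLike.ext _ _ fun x => DFunLike.congr_fun hCLM x

theorem tensor_hom_ext_assoc {E : Type*} [NonUnitalCStarAlgebra E]
    {π ρ : MaxTensor A (MaxTensor B C) →⋆ₙₐ[ℂ] E}
    (h : ∀ a b c, π (tmul a (tmul b c)) = ρ (tmul a (tmul b c))) : π = ρ := by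
  refine hom_ext_of_dense (dense_span_tmul (dense_span_univ A)
    (dense_span_tmul (dense_span_univ B) (dense_span_univ C))) ?_
  rintro _ ⟨a, _, _, ⟨b, _, c, _, rfl⟩, rfl⟩
  exact h a b c

variable (A B C)

/-- The symmetry `a ⊗ b ↦ b ⊗ a`. -/
def tensorFlip : MaxTensor A B →⋆ₙₐ[ℂ] MaxTensor B A :=
  tensorLift (tmulBilin B A).flip
    (fun a a' b b' => by simp only [LinearMap.flip_apply, tmulBilin_apply, tmul_mul_tmul])
    (fun a b => by simp only [LinearMap.flip_apply, tmulBilin_apply, star_tmul])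

variable {A B C}

theorem tensorFlip_tmul (a : A) (b : B) : tensorFlip A B (tmul a b) = tmul b a :=
  tensorLift_tmul _ _ _ a b

theorem tensorFlip_comp_tensorFlip : (tensorFlip B A).comp (tensorFlip A B) =
    NonUnitalStarAlgHom.id ℂ (MaxTensor A B) :=
  tensor_hom_ext fun a b => by
    rw [NonUnitalStarAlgHom.comp_apply, tensorFlip_tmul, tensorFlip_tmul,
      NonUnitalStarAlgHom.coe_id, id]

theorem tensorFlip_tensorFlip (x : MaxTensor A B) : tensorFlip B A (tensorFlip A B x) = x :=
  DFunLike.congr_fun tensorFlip_comp_tensorFlip x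

variable (A B C)

/-- The inverse of the canonical isomorphism `(A ⊗ B) ⊗ C → A ⊗ (B ⊗ C)`. -/
def tensorAssocInv : MaxTensor A (MaxTensor B C) →⋆ₙₐ[ℂ] MaxTensor (MaxTensor A B) C :=
  (tensorFlip C (MaxTensor A B)).comp <|
    (tensorMap (NonUnitalStarAlgHom.id ℂ C) (tensorFlip B A)).comp <|
      (tensorAssoc C B A).comp <|
        (tensorMap (tensorFlip B C) (NonUnitalStarAlgHom.id ℂ A)).comp <|
          tensorFlip A (MaxTensor B C)

variable {A B C}

theorem tensorAssocInv_tmul (a : A) (b : B) (c : C) :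
    tensorAssocInv A B C (tmul a (tmul b c)) = tmul (tmul a b) c := by
  simp only [tensorAssocInv, NonUnitalStarAlgHom.comp_apply, tensorFlip_tmul, tensorMap_tmul,
    tensorAssoc_tmul, NonUnitalStarAlgHom.coe_id, id]

theorem tensorAssocInv_tensorAssoc (x : MaxTensor (MaxTensor A B) C) :
    tensorAssocInv A B C (tensorAssoc A B C x) = x := by
  have h : (tensorAssocInv A B C).comp (tensorAssoc A B C) = NonUnitalStarAlgHom.id ℂ _ :=
    tensor_hom_ext₃ fun a b c => by
      rw [NonUnitalStarAlgHom.comp_apply, tensorAssoc_tmul, tensorAssocInv_tmul,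
        NonUnitalStarAlgHom.coe_id, id]
  exact DFunLike.congr_fun h x

theorem tensorAssoc_injective : Function.Injective (tensorAssoc A B C) :=
  Function.LeftInverse.injective tensorAssocInv_tensorAssoc

end Symmetry

/-! ### The diagonal functional on `C⋆(Γ) ⊗ C⋆(Γ)` -/

section GroupAlgebra

variable {Γ : Type*} [Group Γ]

theorem dense_span_of :
    Dense (Submodule.span ℂ (Set.range (GroupCStar.of (Γ := Γ))) : Set (GroupCStar Γ)) := by
  refine (denseRange_ofGroupAlgebra Γ).mono ?_
  rintro _ ⟨f, rfl⟩
  induction f using MonoidAlgebra.induction_linear with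
  | zero => rw [map_zero]; exact zero_mem _
  | add f g hf hg => rw [map_add]; exact add_mem hf hg
  | single γ z =>
    have hsingle : MonoidAlgebra.single γ z = z • MonoidAlgebra.single γ (1 : ℂ) := by simp
    rw [hsingle, map_smul]
    exact Submodule.smul_mem _ _ (Submodule.subset_span ⟨γ, rfl⟩)

variable {E : Type*} [NonUnitalCStarAlgebra E] (u : Γ → E)
  (hmul : ∀ γ γ', u (γ * γ') = u γ * u γ') (hstar : ∀ γ, u γ⁻¹ = star (u γ))

/-- The ⋆-homomorphism on `C⋆(Γ)` that extends a family `u` of partial isometries with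
`u (γγ') = u γ u γ'` and `u γ⁻¹ = (u γ)⋆`; the target need not be unital. -/
def groupLift : GroupCStar Γ →⋆ₙₐ[ℂ] E := envLift (groupAlgebraLift u hmul hstar)

theorem groupLift_of (γ : Γ) : groupLift u hmul hstar (GroupCStar.of γ) = u γ :=
  (envLift_toEnv _ _).trans (groupAlgebraLift_single _ _ _ γ)

end GroupAlgebra

section RegularRepresentation

variable {Γ : Type*}

variable (Γ) in
/-- The Hilbert space `ℓ²(Γ)`. -/
abbrev L2 : Type _ := lp (fun _ : Γ => ℂ) 2

/-- The unitary operator `f ↦ f ∘ e⁻¹` on `ℓ²(Γ)`. -/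
def permOp (e : Equiv.Perm Γ) : L2 Γ →L[ℂ] L2 Γ :=
  LinearMap.mkContinuous
    { toFun := fun f => ⟨fun r => f (e⁻¹ r), memℓp_gen <|
        ((lp.memℓp f).summable (by norm_num)).comp_injective (e⁻¹).injective⟩
      map_add' := fun f g => rfl
      map_smul' := fun c f => rfl } 1 fun f => by
    refine le_of_eq ?_
    rw [one_mul, lp.norm_eq_tsum_rpow (by norm_num), lp.norm_eq_tsum_rpow (by norm_num)]
    congr 1
    exact (e⁻¹).tsum_eq fun r => ‖f r‖ ^ (2 : ENNReal).toReal

theorem permOp_apply (e : Equiv.Perm Γ) (f : L2 Γ) (r : Γ) : permOp e f r = f (e⁻¹ r) := rfl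

theorem permOp_mul (e e' : Equiv.Perm Γ) : permOp (e * e') = permOp e * permOp e' := by
  ext f r
  rw [permOp_apply, mul_inv_rev]
  rfl

theorem permOp_inv (e : Equiv.Perm Γ) : permOp e⁻¹ = star (permOp e) := by
  rw [ContinuousLinearMap.star_eq_adjoint, ContinuousLinearMap.eq_adjoint_iff]
  intro f g
  rw [lp.inner_eq_tsum, lp.inner_eq_tsum, ← (e⁻¹).tsum_eq]
  refine tsum_congr fun r => ?_
  rw [permOp_apply, permOp_apply, inv_inv, ← Equiv.Perm.mul_apply, mul_inv_cancel,
    Equiv.Perm.one_apply]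

variable [Group Γ]

variable (Γ)

/-- The vector `δ₁` of `ℓ²(Γ)`. -/
def deltaOne : L2 Γ :=
  open scoped Classical in lp.single 2 1 1

/-- The left regular representation. -/
def leftRegular : GroupCStar Γ →⋆ₙₐ[ℂ] (L2 Γ →L[ℂ] L2 Γ) :=
  groupLift (fun γ => permOp (Equiv.mulLeft γ))
    (fun γ γ' => by rw [← permOp_mul]; congr 1; ext r; simp)
    (fun γ => by rw [← permOp_inv]; congr 1; ext r; simp)

/-- The right regular representation. -/
def rightRegular : GroupCStar Γ →⋆ₙₐ[ℂ] (L2 Γ →L[ℂ] L2 Γ) :=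
  groupLift (fun γ => permOp (Equiv.mulRight γ⁻¹))
    (fun γ γ' => by rw [← permOp_mul]; congr 1; ext r; simp [mul_assoc])
    (fun γ => by rw [← permOp_inv]; congr 1; ext r; simp)

variable {Γ}

theorem leftRegular_of (γ : Γ) :
    leftRegular Γ (GroupCStar.of γ) = permOp (Equiv.mulLeft γ) := groupLift_of _ _ _ γ

theorem rightRegular_of (γ : Γ) :
    rightRegular Γ (GroupCStar.of γ) = permOp (Equiv.mulRight γ⁻¹) := groupLift_of _ _ _ γ

theorem commute_leftRegular_rightRegular (x y : GroupCStar Γ) :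
    Commute (leftRegular Γ x) (rightRegular Γ y) := by
  have h : (ContinuousLinearMap.mul ℂ (L2 Γ →L[ℂ] L2 Γ)).bilinearComp
      (homCLM (leftRegular Γ)) (homCLM (rightRegular Γ)) =
        (ContinuousLinearMap.mul ℂ (L2 Γ →L[ℂ] L2 Γ)).flip.bilinearComp
          (homCLM (leftRegular Γ)) (homCLM (rightRegular Γ)) := by
    refine ContinuousLinearMap.ext_on dense_span_of ?_
    rintro _ ⟨γ, rfl⟩
    refine ContinuousLinearMap.ext_on dense_span_of ?_
    rintro _ ⟨γ', rfl⟩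
    simp only [ContinuousLinearMap.bilinearComp_apply, ContinuousLinearMap.flip_apply,
      ContinuousLinearMap.mul_apply', homCLM_apply, leftRegular_of, rightRegular_of, ← permOp_mul]
    congr 1
    ext r
    simp [mul_assoc]
  exact DFunLike.congr_fun (DFunLike.congr_fun h x) y

variable (Γ)

/-- The representation of `C⋆(Γ) ⊗ C⋆(Γ)` on `ℓ²(Γ)` by left and right translations. -/
def biregular : MaxTensor (GroupCStar Γ) (GroupCStar Γ) →⋆ₙₐ[ℂ] (L2 Γ →L[ℂ] L2 Γ) :=
  tensorLift ((LinearMap.mul ℂ (L2 Γ →L[ℂ] L2 Γ)).compl₁₂ (leftRegular Γ : _ →ₗ[ℂ] _)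
      (rightRegular Γ : _ →ₗ[ℂ] _))
    (fun x x' y y' => by
      simp only [LinearMap.compl₁₂_apply, LinearMap.mul_apply', LinearMap.coe_coe, map_mul]
      exact (commute_leftRegular_rightRegular x' y).mul_mul_mul_comm _ _)
    (fun x y => by
      simp only [LinearMap.compl₁₂_apply, LinearMap.mul_apply', LinearMap.coe_coe, map_star,
        star_mul]
      rw [← map_star, ← map_star]
      exact commute_leftRegular_rightRegular _ _)

variable {Γ}

theorem biregular_of (γ γ' : Γ) : biregular Γ (tmul (GroupCStar.of γ) (GroupCStar.of γ')) =
    permOp (Equiv.mulLeft γ * Equiv.mulRight γ'⁻¹) := by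
  rw [biregular, tensorLift_tmul, LinearMap.compl₁₂_apply, LinearMap.mul_apply', LinearMap.coe_coe,
    LinearMap.coe_coe, leftRegular_of, rightRegular_of, permOp_mul]

end RegularRepresentation

section DiagonalFunctional

variable {Γ : Type*} [Group Γ]

variable (Γ) in
/-- The vector functional of `biregular` at `δ₁`, which maps `γ ⊗ γ'` to `1` if `γ = γ'` and to `0`
otherwise. -/
def diagFunctional : MaxTensor (GroupCStar Γ) (GroupCStar Γ) →L[ℂ] ℂ :=
  (innerSL ℂ (deltaOne Γ)).comp
    ((ContinuousLinearMap.apply ℂ (L2 Γ) (deltaOne Γ)).comp (homCLM (biregular Γ)))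

theorem diagFunctional_apply (x : MaxTensor (GroupCStar Γ) (GroupCStar Γ)) :
    diagFunctional Γ x = inner ℂ (deltaOne Γ) (biregular Γ x (deltaOne Γ)) := rfl

open scoped Classical in
theorem diagFunctional_of (γ γ' : Γ) :
    diagFunctional Γ (tmul (GroupCStar.of γ) (GroupCStar.of γ')) = if γ = γ' then 1 else 0 := by
  have horbit : ((Equiv.mulLeft γ * Equiv.mulRight γ'⁻¹)⁻¹ : Equiv.Perm Γ) 1 = γ⁻¹ * γ' := by
    rw [Equiv.Perm.inv_eq_iff_eq]
    simp
  rw [diagFunctional_apply, biregular_of, deltaOne, lp.inner_single_left, permOp_apply, horbit,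
    lp.single_apply, ← inv_mul_eq_one (a := γ)]
  by_cases h : γ⁻¹ * γ' = 1 <;> simp [h]

theorem isCP_diagFunctional : IsCP (diagFunctional Γ) := by
  intro n y
  obtain ⟨m, v, hv⟩ := Matrix.posSemidef_iff_eq_sum_vecMulVec.mp
    (Matrix.posSemidef_gram ℂ fun i => biregular Γ (y i) (deltaOne Γ))
  refine ⟨m, fun k i => star (v k i), fun i j => ?_⟩
  have hentry := congr_fun (congr_fun hv i) j
  rw [Matrix.gram_apply, Matrix.sum_apply] at hentry
  rw [diagFunctional_apply, map_mul, map_star, mul_apply_eq_comp,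
    ContinuousLinearMap.star_eq_adjoint, ContinuousLinearMap.adjoint_inner_right, hentry]
  simp [Matrix.vecMulVec_apply]

end DiagonalFunctional

section Slices

variable (Γ : Type*) [Group Γ] (A : Type*) [NonUnitalCStarAlgebra A]

/-- The canonical isomorphism `A ⊗ ℂ → A`. -/
def tensorScalar : MaxTensor A ℂ →⋆ₙₐ[ℂ] A :=
  tensorLift (LinearMap.lsmul ℂ A).flip (fun a a' z z' => by simp [smul_mul_smul_comm])
    (fun a z => by simp)

/-- The slice map `id ⊗ ω`, where `ω` is the diagonal functional. -/
def diagSlice : MaxTensor A (MaxTensor (GroupCStar Γ) (GroupCStar Γ)) →L[ℂ] A :=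
  (homCLM (tensorScalar A)).comp (idTensor A (isCP_diagFunctional (Γ := Γ)))

/-- The counit `γ ↦ 1` of `C⋆(Γ)`. -/
def counit : GroupCStar Γ →⋆ₙₐ[ℂ] ℂ := groupLift (fun _ => 1) (by simp) (by simp)

/-- The slice map `ε ⊗ id`, where `ε` is the counit. -/
def counitSlice : MaxTensor (GroupCStar Γ) A →⋆ₙₐ[ℂ] A :=
  (tensorScalar A).comp ((tensorMap (NonUnitalStarAlgHom.id ℂ A) (counit Γ)).comp
    (tensorFlip (GroupCStar Γ) A))

variable {Γ A}

theorem tensorScalar_tmul (a : A) (z : ℂ) : tensorScalar A (tmul a z) = z • a :=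
  tensorLift_tmul _ _ _ a z

open scoped Classical in
theorem diagSlice_tmul (a : A) (γ γ' : Γ) :
    diagSlice Γ A (tmul a (tmul (GroupCStar.of γ) (GroupCStar.of γ'))) =
      if γ = γ' then a else 0 := by
  rw [diagSlice, ContinuousLinearMap.comp_apply, idTensor_tmul, homCLM_apply, tensorScalar_tmul,
    diagFunctional_of, ite_smul, one_smul, zero_smul]

attribute [local instance] CStarAlgebra.spectralOrder CStarAlgebra.spectralOrderedRing in
theorem diagSlice_star_mul_self_nonneg
    (x : MaxTensor A (MaxTensor (GroupCStar Γ) (GroupCStar Γ))) :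
    0 ≤ diagSlice Γ A (star x * x) := by
  rw [diagSlice, ContinuousLinearMap.comp_apply, homCLM_apply]
  exact map_nonneg (tensorScalar A) (idTensor_star_mul_self_nonneg isCP_diagFunctional x)

theorem counit_of (γ : Γ) : counit Γ (GroupCStar.of γ) = 1 := groupLift_of _ _ _ γ

theorem counitSlice_tmul (γ : Γ) (a : A) : counitSlice Γ A (tmul (GroupCStar.of γ) a) = a := by
  rw [counitSlice, NonUnitalStarAlgHom.comp_apply, NonUnitalStarAlgHom.comp_apply, tensorFlip_tmul,
    tensorMap_tmul, tensorScalar_tmul, counit_of, one_smul, NonUnitalStarAlgHom.coe_id, id]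

end Slices

section Reverse

open NonUnitalStarAlgHom (id)

variable {A B C D : Type*} [NonUnitalCStarAlgebra A] [NonUnitalCStarAlgebra B]
  [NonUnitalCStarAlgebra C] [NonUnitalCStarAlgebra D]

theorem tensorFlip_tensorMap (f : A →⋆ₙₐ[ℂ] C) (g : B →⋆ₙₐ[ℂ] D) (x : MaxTensor A B) :
    tensorFlip C D (tensorMap f g x) = tensorMap g f (tensorFlip A B x) := by
  have h : (tensorFlip C D).comp (tensorMap f g) = (tensorMap g f).comp (tensorFlip A B) :=
    tensor_hom_ext fun a b => by
      simp only [NonUnitalStarAlgHom.comp_apply, tensorFlip_tmul, tensorMap_tmul]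
  exact DFunLike.congr_fun h x

variable (A B C) in
/-- The isomorphism `a ⊗ (b ⊗ c) ↦ c ⊗ (b ⊗ a)`. It exchanges the coassociativity conditions for
left and right coactions. -/
def tensorReverse : MaxTensor A (MaxTensor B C) →⋆ₙₐ[ℂ] MaxTensor C (MaxTensor B A) :=
  (tensorMap (id ℂ C) (tensorFlip A B)).comp
    ((tensorFlip (MaxTensor A B) C).comp (tensorAssocInv A B C))

theorem tensorReverse_tmul (a : A) (b : B) (c : C) :
    tensorReverse A B C (tmul a (tmul b c)) = tmul c (tmul b a) := by
  simp only [tensorReverse, NonUnitalStarAlgHom.comp_apply, tensorAssocInv_tmul, tensorFlip_tmul,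
    tensorMap_tmul, NonUnitalStarAlgHom.coe_id, id_eq]

theorem tensorReverse_tensorMap_id (f : D →⋆ₙₐ[ℂ] MaxTensor A B) (x : MaxTensor C D) :
    tensorReverse C A B (tensorMap (id ℂ C) f x) =
      tensorAssoc B A C (tensorMap ((tensorFlip A B).comp f) (id ℂ C) (tensorFlip C D x)) := by
  have hassoc : tensorReverse C A B = (tensorAssoc B A C).comp
      ((tensorMap (tensorFlip A B) (id ℂ C)).comp (tensorFlip C (MaxTensor A B))) :=
    tensor_hom_ext_assoc fun c a b => by
      simp only [NonUnitalStarAlgHom.comp_apply, tensorReverse_tmul, tensorFlip_tmul,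
        tensorMap_tmul, tensorAssoc_tmul, NonUnitalStarAlgHom.coe_id, id_eq]
  rw [hassoc, NonUnitalStarAlgHom.comp_apply, NonUnitalStarAlgHom.comp_apply, tensorFlip_tensorMap,
    ← NonUnitalStarAlgHom.comp_apply (tensorMap _ _), tensorMap_comp]
  rfl

theorem tensorReverse_tensorAssoc_tensorMap (f : D →⋆ₙₐ[ℂ] MaxTensor A B) (x : MaxTensor D C) :
    tensorReverse A B C (tensorAssoc A B C (tensorMap f (id ℂ C) x)) =
      tensorMap (id ℂ C) ((tensorFlip A B).comp f) (tensorFlip D C x) := by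
  rw [tensorReverse, NonUnitalStarAlgHom.comp_apply, NonUnitalStarAlgHom.comp_apply,
    tensorAssocInv_tensorAssoc, tensorFlip_tensorMap,
    ← NonUnitalStarAlgHom.comp_apply (tensorMap _ _), tensorMap_comp]
  rfl

end Reverse

section GroupTensor

open NonUnitalStarAlgHom (id)

variable {Γ : Type*} [Group Γ] {A E : Type*} [NonUnitalCStarAlgebra A] [NonUnitalCStarAlgebra E]

theorem group_tensor_clm_ext {f g : MaxTensor (GroupCStar Γ) A →L[ℂ] E}
    (h : ∀ γ a, f (tmul (GroupCStar.of γ) a) = g (tmul (GroupCStar.of γ) a)) : f = g := by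
  refine tensor_clm_ext dense_span_of (dense_span_univ A) ?_
  rintro _ ⟨γ, rfl⟩ a _
  exact h γ a

theorem group_tensor_hom_ext {f g : MaxTensor (GroupCStar Γ) A →⋆ₙₐ[ℂ] E}
    (h : ∀ γ a, f (tmul (GroupCStar.of γ) a) = g (tmul (GroupCStar.of γ) a)) : f = g := by
  have hCLM : homCLM f = homCLM g := group_tensor_clm_ext h
  exact DFunLike.ext _ _ fun x => DFunLike.congr_fun hCLM x

theorem tensor_group_clm_ext {f g : MaxTensor A (GroupCStar Γ) →L[ℂ] E}
    (h : ∀ a γ, f (tmul a (GroupCStar.of γ)) = g (tmul a (GroupCStar.of γ))) : f = g := by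
  refine tensor_clm_ext (dense_span_univ A) dense_span_of ?_
  rintro a _ _ ⟨γ, rfl⟩
  exact h a γ

theorem tensor_group_hom_ext {f g : MaxTensor A (GroupCStar Γ) →⋆ₙₐ[ℂ] E}
    (h : ∀ a γ, f (tmul a (GroupCStar.of γ)) = g (tmul a (GroupCStar.of γ))) : f = g := by
  have hCLM : homCLM f = homCLM g := tensor_group_clm_ext h
  exact DFunLike.ext _ _ fun x => DFunLike.congr_fun hCLM x

theorem tensorReverse_comul_right (x : MaxTensor A (GroupCStar Γ)) :
    tensorReverse A (GroupCStar Γ) (GroupCStar Γ) (tensorMap (id ℂ A) (comul Γ) x) =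
      tensorAssoc (GroupCStar Γ) (GroupCStar Γ) A
        (tensorMap (comul Γ) (id ℂ A) (tensorFlip A (GroupCStar Γ) x)) := by
  have h : (tensorReverse A (GroupCStar Γ) (GroupCStar Γ)).comp (tensorMap (id ℂ A) (comul Γ)) =
      (tensorAssoc (GroupCStar Γ) (GroupCStar Γ) A).comp
        ((tensorMap (comul Γ) (id ℂ A)).comp (tensorFlip A (GroupCStar Γ))) :=
    tensor_group_hom_ext fun a γ => by
      simp only [NonUnitalStarAlgHom.comp_apply, tensorMap_tmul, comul_of, tensorReverse_tmul,
        tensorFlip_tmul, tensorAssoc_tmul, NonUnitalStarAlgHom.coe_id, id_eq]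
  exact DFunLike.congr_fun h x

theorem tensorReverse_comul_left (x : MaxTensor (GroupCStar Γ) A) :
    tensorReverse (GroupCStar Γ) (GroupCStar Γ) A
        (tensorAssoc (GroupCStar Γ) (GroupCStar Γ) A (tensorMap (comul Γ) (id ℂ A) x)) =
      tensorMap (id ℂ A) (comul Γ) (tensorFlip (GroupCStar Γ) A x) := by
  have h : (tensorReverse (GroupCStar Γ) (GroupCStar Γ) A).comp
        ((tensorAssoc (GroupCStar Γ) (GroupCStar Γ) A).comp (tensorMap (comul Γ) (id ℂ A))) =
      (tensorMap (id ℂ A) (comul Γ)).comp (tensorFlip (GroupCStar Γ) A) :=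
    group_tensor_hom_ext fun γ a => by
      simp only [NonUnitalStarAlgHom.comp_apply, tensorMap_tmul, comul_of, tensorReverse_tmul,
        tensorFlip_tmul, tensorAssoc_tmul, NonUnitalStarAlgHom.coe_id, id_eq]
  exact DFunLike.congr_fun h x

/-- The opposite structure: the coactions are interchanged by means of the symmetry of the tensor
product. Results about left coactions applied to it become results about right coactions. -/
def CGammaStructure.op (c : CGammaStructure Γ A) : CGammaStructure Γ A where
  left := (tensorFlip A (GroupCStar Γ)).comp c.right
  right := (tensorFlip (GroupCStar Γ) A).comp c.left
  left_injective := (Function.LeftInverse.injective tensorFlip_tensorFlip).comp c.right_injective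
  right_injective := (Function.LeftInverse.injective tensorFlip_tensorFlip).comp c.left_injective
  left_coassoc := DFunLike.ext _ _ fun a => by
    have hc := DFunLike.congr_fun c.right_coassoc a
    simp only [NonUnitalStarAlgHom.comp_apply] at hc ⊢
    rw [← tensorReverse_tensorAssoc_tensorMap, hc, tensorReverse_comul_right]
  right_coassoc := DFunLike.ext _ _ fun a => by
    have hc := DFunLike.congr_fun c.left_coassoc a
    simp only [NonUnitalStarAlgHom.comp_apply] at hc ⊢
    rw [← tensorReverse_tensorMap_id, hc, tensorReverse_comul_left]
  left_right := DFunLike.ext _ _ fun a => by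
    have hc := DFunLike.congr_fun c.left_right a
    simp only [NonUnitalStarAlgHom.comp_apply] at hc ⊢
    rw [← tensorReverse_tensorMap_id, ← hc, tensorReverse_tensorAssoc_tensorMap]

theorem op_left_apply (c : CGammaStructure Γ A) (a : A) :
    c.op.left a = tensorFlip A (GroupCStar Γ) (c.right a) := rfl

end GroupTensor

/-! ### Homogeneous elements -/

section Homogeneous

open NonUnitalStarAlgHom (id)

variable {Γ : Type*} [Group Γ] {A B : Type*} [NonUnitalCStarAlgebra A] [NonUnitalCStarAlgebra B]

variable (Γ A) in
/-- The slice map `γ ⊗ (γ' ⊗ a) ↦ δ_{γ,γ'} a`. -/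
def pairSlice : MaxTensor (GroupCStar Γ) (MaxTensor (GroupCStar Γ) A) →L[ℂ] A :=
  (diagSlice Γ A).comp (homCLM ((tensorFlip (MaxTensor (GroupCStar Γ) (GroupCStar Γ)) A).comp
    (tensorAssocInv (GroupCStar Γ) (GroupCStar Γ) A)))

variable (A) in
/-- The slice map `γ' ⊗ a ↦ δ_{γ,γ'} a`, which picks the coefficient of `γ`. -/
def degreeSlice (γ : Γ) : MaxTensor (GroupCStar Γ) A →L[ℂ] A :=
  (pairSlice Γ A).comp (tmulLeft _ (GroupCStar.of γ))

open scoped Classical in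
theorem pairSlice_tmul (γ γ' : Γ) (a : A) :
    pairSlice Γ A (tmul (GroupCStar.of γ) (tmul (GroupCStar.of γ') a)) =
      if γ = γ' then a else 0 := by
  rw [pairSlice, ContinuousLinearMap.comp_apply, homCLM_apply, NonUnitalStarAlgHom.comp_apply,
    tensorAssocInv_tmul, tensorFlip_tmul, diagSlice_tmul]

open scoped Classical in
theorem degreeSlice_tmul (γ γ' : Γ) (a : A) :
    degreeSlice A γ (tmul (GroupCStar.of γ') a) = if γ = γ' then a else 0 :=
  pairSlice_tmul γ γ' a

theorem degreeSlice_tensorMap (γ : Γ) (f : A →⋆ₙₐ[ℂ] B) (x : MaxTensor (GroupCStar Γ) A) :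
    degreeSlice B γ (tensorMap (id ℂ (GroupCStar Γ)) f x) = f (degreeSlice A γ x) := by
  classical
  have h : (degreeSlice B γ).comp (homCLM (tensorMap (id ℂ (GroupCStar Γ)) f)) =
      (homCLM f).comp (degreeSlice A γ) :=
    group_tensor_clm_ext fun γ' a => by
      simp only [ContinuousLinearMap.comp_apply, homCLM_apply, tensorMap_tmul, degreeSlice_tmul,
        NonUnitalStarAlgHom.coe_id, id_eq, apply_ite f, map_zero]
  exact DFunLike.congr_fun h x

theorem degreeSlice_comul (γ : Γ) (x : MaxTensor (GroupCStar Γ) A) :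
    degreeSlice (MaxTensor (GroupCStar Γ) A) γ
        (tensorAssoc (GroupCStar Γ) (GroupCStar Γ) A (tensorMap (comul Γ) (id ℂ A) x)) =
      tmul (GroupCStar.of γ) (degreeSlice A γ x) := by
  classical
  have h : (degreeSlice (MaxTensor (GroupCStar Γ) A) γ).comp
        (homCLM ((tensorAssoc (GroupCStar Γ) (GroupCStar Γ) A).comp
          (tensorMap (comul Γ) (id ℂ A)))) =
      (tmulLeft A (GroupCStar.of γ)).comp (degreeSlice A γ) :=
    group_tensor_clm_ext fun γ' a => by
      simp only [ContinuousLinearMap.comp_apply, homCLM_apply, NonUnitalStarAlgHom.comp_apply,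
        tensorMap_tmul, comul_of, tensorAssoc_tmul, degreeSlice_tmul (A := A),
        degreeSlice_tmul (A := MaxTensor (GroupCStar Γ) A), tmulLeft_apply,
        NonUnitalStarAlgHom.coe_id, id_eq]
      split_ifs with hγ
      · rw [hγ]
      · rw [tmul_zero]
  simpa only [ContinuousLinearMap.comp_apply, homCLM_apply, NonUnitalStarAlgHom.comp_apply,
    tmulLeft_apply] using DFunLike.congr_fun h x

theorem pairSlice_comul (x : MaxTensor (GroupCStar Γ) A) :
    pairSlice Γ A (tensorAssoc (GroupCStar Γ) (GroupCStar Γ) A (tensorMap (comul Γ) (id ℂ A) x)) =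
      counitSlice Γ A x := by
  classical
  have h : (pairSlice Γ A).comp (homCLM ((tensorAssoc (GroupCStar Γ) (GroupCStar Γ) A).comp
        (tensorMap (comul Γ) (id ℂ A)))) = homCLM (counitSlice Γ A) :=
    group_tensor_clm_ext fun γ a => by
      simp only [ContinuousLinearMap.comp_apply, homCLM_apply, NonUnitalStarAlgHom.comp_apply,
        tensorMap_tmul, comul_of, tensorAssoc_tmul, pairSlice_tmul, counitSlice_tmul, if_true,
        NonUnitalStarAlgHom.coe_id, id_eq]
  exact DFunLike.congr_fun h x

theorem counitSlice_comul (x : MaxTensor (GroupCStar Γ) A) :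
    counitSlice Γ (MaxTensor (GroupCStar Γ) A)
      (tensorAssoc (GroupCStar Γ) (GroupCStar Γ) A (tensorMap (comul Γ) (id ℂ A) x)) = x := by
  have h : (counitSlice Γ _).comp ((tensorAssoc (GroupCStar Γ) (GroupCStar Γ) A).comp
      (tensorMap (comul Γ) (id ℂ A))) = id ℂ _ :=
    group_tensor_hom_ext fun γ a => by
      simp only [NonUnitalStarAlgHom.comp_apply, tensorMap_tmul, comul_of, tensorAssoc_tmul,
        counitSlice_tmul, NonUnitalStarAlgHom.coe_id, id_eq]
  exact DFunLike.congr_fun h x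

theorem counitSlice_tensorMap (f : A →⋆ₙₐ[ℂ] B) (x : MaxTensor (GroupCStar Γ) A) :
    counitSlice Γ B (tensorMap (id ℂ (GroupCStar Γ)) f x) = f (counitSlice Γ A x) := by
  have h : (counitSlice Γ B).comp (tensorMap (id ℂ (GroupCStar Γ)) f) =
      f.comp (counitSlice Γ A) :=
    group_tensor_hom_ext fun γ a => by
      simp only [NonUnitalStarAlgHom.comp_apply, tensorMap_tmul, counitSlice_tmul,
        NonUnitalStarAlgHom.coe_id, id_eq]
  exact DFunLike.congr_fun h x

variable (c : CGammaStructure Γ A)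

/-- The projection onto the component of degree `γ` with respect to the left coaction. -/
def leftComponent (γ : Γ) : A →L[ℂ] A := (degreeSlice A γ).comp (homCLM c.left)

variable {c}

theorem leftComponent_apply (γ : Γ) (a : A) :
    leftComponent c γ a = degreeSlice A γ (c.left a) := rfl

theorem counitSlice_left (a : A) : counitSlice Γ A (c.left a) = a := by
  have hc := DFunLike.congr_fun c.left_coassoc a
  simp only [NonUnitalStarAlgHom.comp_apply] at hc
  apply c.left_injective
  rw [← counitSlice_tensorMap, hc, counitSlice_comul]

theorem left_leftComponent (γ : Γ) (a : A) :
    c.left (leftComponent c γ a) = tmul (GroupCStar.of γ) (leftComponent c γ a) := by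
  have hc := DFunLike.congr_fun c.left_coassoc a
  simp only [NonUnitalStarAlgHom.comp_apply] at hc
  rw [leftComponent_apply,
    ← degreeSlice_tensorMap (A := A) (B := MaxTensor (GroupCStar Γ) A) γ c.left, hc,
    degreeSlice_comul]

theorem map_mem_of_dense_span {S : Set A} (hS : Dense (Submodule.span ℂ S : Set A))
    {V : Submodule ℂ B} (hV : IsClosed (V : Set B)) (f : A →L[ℂ] B) (h : ∀ a ∈ S, f a ∈ V)
    (a : A) : f a ∈ V :=
  Submodule.topologicalClosure_minimal (t := V.comap (f : A →ₗ[ℂ] B)) _ (Submodule.span_le.mpr h)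
    (hV.preimage f.continuous) (hS a)

variable (c) in
theorem dense_span_leftComponent :
    Dense (Submodule.span ℂ {a | ∃ γ b, a = leftComponent c γ b} : Set A) := by
  set V := (Submodule.span ℂ {a | ∃ γ b, a = leftComponent c γ b}).topologicalClosure
  have slice_mem (y : MaxTensor (GroupCStar Γ) A) :
      pairSlice Γ A (tensorMap (id ℂ (GroupCStar Γ)) c.left y) ∈ V := by
    refine map_mem_of_dense_span (dense_span_tmul dense_span_of (dense_span_univ A))
      (Submodule.isClosed_topologicalClosure _)
      ((pairSlice Γ A).comp (homCLM (tensorMap (id ℂ (GroupCStar Γ)) c.left))) ?_ y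
    rintro _ ⟨_, ⟨γ, rfl⟩, a, _, rfl⟩
    refine Submodule.le_topologicalClosure _ (Submodule.subset_span ⟨γ, a, ?_⟩)
    rw [ContinuousLinearMap.comp_apply, homCLM_apply, tensorMap_tmul]
    rfl
  intro a
  -- Slicing `(id ⊗ δ) δ a = (Δ ⊗ id) δ a` along the diagonal recovers `a`.
  have ha := slice_mem (c.left a)
  have hc := DFunLike.congr_fun c.left_coassoc a
  simp only [NonUnitalStarAlgHom.comp_apply] at hc
  rwa [hc, pairSlice_comul, counitSlice_left] at ha

variable (c) in
/-- The elements that are homogeneous of degree `γ` with respect to the left coaction and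
homogeneous of degree `η` with respect to the right coaction. -/
structure IsBihomogeneous (γ η : Γ) (a : A) : Prop where
  left : c.left a = tmul (GroupCStar.of γ) a
  right : c.right a = tmul a (GroupCStar.of η)

variable (c) in
/-- The set of all bihomogeneous elements. -/
def bihomogeneous : Set A := {a | ∃ γ η, IsBihomogeneous c γ η a}

theorem right_eq_of_op_left_eq {γ : Γ} {a : A} (h : c.op.left a = tmul (GroupCStar.of γ) a) :
    c.right a = tmul a (GroupCStar.of γ) := by
  have h' := congrArg (tensorFlip (GroupCStar Γ) A) h
  rwa [tensorFlip_tmul, op_left_apply, tensorFlip_tensorFlip] at h'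

theorem degreeSlice_tensorFlip_tmul (γ η : Γ) (x : MaxTensor A (GroupCStar Γ)) :
    degreeSlice (MaxTensor (GroupCStar Γ) A) η
      (tensorFlip (MaxTensor (GroupCStar Γ) A) (GroupCStar Γ)
        (tensorAssocInv (GroupCStar Γ) A (GroupCStar Γ) (tmul (GroupCStar.of γ) x))) =
      tmul (GroupCStar.of γ) (degreeSlice A η (tensorFlip A (GroupCStar Γ) x)) := by
  classical
  have h : ((degreeSlice (MaxTensor (GroupCStar Γ) A) η).comp
        (homCLM ((tensorFlip (MaxTensor (GroupCStar Γ) A) (GroupCStar Γ)).comp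
          (tensorAssocInv (GroupCStar Γ) A (GroupCStar Γ))))).comp
        (tmulLeft _ (GroupCStar.of γ)) =
      (tmulLeft A (GroupCStar.of γ)).comp
        ((degreeSlice A η).comp (homCLM (tensorFlip A (GroupCStar Γ)))) :=
    tensor_group_clm_ext fun a γ' => by
      simp only [ContinuousLinearMap.comp_apply, homCLM_apply, NonUnitalStarAlgHom.comp_apply,
        tmulLeft_apply, tensorAssocInv_tmul, tensorFlip_tmul, degreeSlice_tmul (A := A),
        degreeSlice_tmul (A := MaxTensor (GroupCStar Γ) A), apply_ite (tmul (GroupCStar.of γ)),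
        tmul_zero]
  simpa only [ContinuousLinearMap.comp_apply, homCLM_apply, NonUnitalStarAlgHom.comp_apply,
    tmulLeft_apply] using DFunLike.congr_fun h x

theorem left_rightComponent {γ : Γ} {a : A} (h : c.left a = tmul (GroupCStar.of γ) a) (η : Γ) :
    c.left (leftComponent c.op η a) = tmul (GroupCStar.of γ) (leftComponent c.op η a) := by
  have hc := congrArg (tensorAssocInv (GroupCStar Γ) A (GroupCStar Γ))
    (DFunLike.congr_fun c.left_right a)
  simp only [NonUnitalStarAlgHom.comp_apply] at hc
  rw [h, tensorMap_tmul, tensorAssocInv_tensorAssoc, NonUnitalStarAlgHom.coe_id, id_eq] at hc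
  rw [leftComponent_apply,
    ← degreeSlice_tensorMap (A := A) (B := MaxTensor (GroupCStar Γ) A) η c.left, op_left_apply,
    ← tensorFlip_tensorMap, hc, degreeSlice_tensorFlip_tmul]

variable (c) in
theorem dense_span_bihomogeneous : Dense (Submodule.span ℂ (bihomogeneous c) : Set A) := by
  set V := (Submodule.span ℂ (bihomogeneous c)).topologicalClosure
  have hVc : IsClosed (V : Set A) := Submodule.isClosed_topologicalClosure _
  have component_mem (η : Γ) : ∀ a, leftComponent c.op η a ∈ V := by
    refine map_mem_of_dense_span (dense_span_leftComponent c) hVc (leftComponent c.op η) ?_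
    rintro _ ⟨γ, b, rfl⟩
    exact Submodule.le_topologicalClosure _ (Submodule.subset_span
      ⟨γ, η, left_rightComponent (left_leftComponent γ b) η,
        right_eq_of_op_left_eq (left_leftComponent η _)⟩)
  refine map_mem_of_dense_span (dense_span_leftComponent c.op) hVc (.id ℂ A) ?_
  rintro _ ⟨η, a, rfl⟩
  exact component_mem η a

end Homogeneous

/-! ### Completely positive conditional expectations -/

section Expectation

attribute [local instance] CStarAlgebra.spectralOrder CStarAlgebra.spectralOrderedRing

variable {Y Z : Type*} [NonUnitalCStarAlgebra Y] [NonUnitalCStarAlgebra Z]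

theorem nonneg_of_injective_of_map_nonneg {k : Z →⋆ₙₐ[ℂ] Y} (hk : Function.Injective k) {z : Z}
    (h : 0 ≤ k z) : 0 ≤ z := by
  have hz : IsSelfAdjoint z := hk (by rw [map_star]; exact h.isSelfAdjoint)
  have map_negPart : k z⁻ = (k z)⁻ := by
    have hc := continuous_hom k
    rw [CFC.negPart_def, CFC.negPart_def]
    exact NonUnitalStarAlgHom.map_cfcₙ k _ z (hφa := h.isSelfAdjoint)
  refine (CFC.negPart_eq_zero_iff z hz).mp (hk ?_)
  rw [map_negPart, map_zero, CFC.negPart_eq_zero_iff _ h.isSelfAdjoint]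
  exact h

theorem mul_negPart_eq_neg_mul_self {M : Z} (hM : IsSelfAdjoint M) : M * M⁻ = -(M⁻ * M⁻) := by
  nth_rw 1 [← CFC.posPart_sub_negPart M hM]
  rw [sub_mul, CFC.posPart_mul_negPart, zero_sub]

theorem exists_negPart_factorization {M : Z} (hM : IsSelfAdjoint M) :
    ∃ N S : Z, star N * (M * N) = -(star (S * N) * (S * N)) ∧
      (S * N = 0 → ∃ T : Z, M = star T * T) := by
  have hN : 0 ≤ M⁻ := CFC.negPart_nonneg M
  obtain ⟨S, hS⟩ := CStarAlgebra.nonneg_iff_eq_star_mul_self.mp hN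
  refine ⟨M⁻, S, ?_, fun hSN => CStarAlgebra.nonneg_iff_eq_star_mul_self.mp ?_⟩
  · rw [mul_negPart_eq_neg_mul_self hM, star_mul, mul_neg, mul_assoc (star M⁻),
      ← mul_assoc (star S), ← hS]
  · rw [← CFC.negPart_eq_zero_iff M hM, ← CStarRing.star_mul_self_eq_zero_iff,
      hN.isSelfAdjoint.star_eq]
    nth_rw 1 [hS]
    rw [mul_assoc, hSN, mul_zero]

variable {ι : Type*} [Fintype ι]

theorem star_mul_mul_apply_self (N M : CStarMatrix ι ι Z) (k : ι) :
    (star N * (M * N)) k k = ∑ i, ∑ j, star (N i k) * (M i j * N j k) := by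
  simp only [CStarMatrix.mul_apply, CStarMatrix.star_apply, Finset.mul_sum]

theorem eq_zero_of_star_mul_self_apply_self_nonpos {T : CStarMatrix ι ι Z}
    (h : ∀ k, (star T * T) k k ≤ 0) : T = 0 := by
  ext i k
  have hnonneg (j : ι) : 0 ≤ star (T j k) * T j k := star_mul_self_nonneg _
  have hsum : ∑ j, star (T j k) * T j k = 0 :=
    le_antisymm (h k) (Finset.sum_nonneg fun j _ => hnonneg j)
  exact (CStarRing.star_mul_self_eq_zero_iff _).mp
    ((Finset.sum_eq_zero_iff_of_nonneg fun j _ => hnonneg j).mp hsum i (Finset.mem_univ i))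

theorem exists_eq_star_mul_self_of_quadratic_nonneg {M : CStarMatrix ι ι Z}
    (hM : IsSelfAdjoint M) (h : ∀ v : ι → Z, 0 ≤ ∑ i, ∑ j, star (v i) * (M i j * v j)) :
    ∃ S : CStarMatrix ι ι Z, M = star S * S := by
  obtain ⟨N, S, hNMN, hsqrt⟩ := exists_negPart_factorization hM
  -- Testing `M` on the columns of its negative part `N` shows that `N * M * N = -N ^ 3` vanishes.
  refine hsqrt (eq_zero_of_star_mul_self_apply_self_nonpos fun k => ?_)
  have hk : (star N * (M * N)) k k = -(star (S * N) * (S * N)) k k :=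
    congrArg (fun T : CStarMatrix ι ι Z => T k k) hNMN
  rw [← neg_nonneg, ← hk, star_mul_mul_apply_self]
  exact h fun i => N i k

theorem isCP_of_bimodule {k : Z →⋆ₙₐ[ℂ] Y} (hk : Function.Injective k) {P : Y →L[ℂ] Z}
    (hleft : ∀ z y, P (k z * y) = z * P y) (hright : ∀ y z, P (y * k z) = P y * z)
    (hstar : ∀ y, P (star y) = star (P y)) (hnonneg : ∀ y, 0 ≤ k (P (star y * y))) :
    IsCP P := by
  intro n y
  set M : CStarMatrix (Fin n) (Fin n) Z := CStarMatrix.ofMatrix fun i j => P (star (y i) * y j)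
  have M_apply (i j : Fin n) : M i j = P (star (y i) * y j) := rfl
  have hM : IsSelfAdjoint M := by
    ext i j
    rw [CStarMatrix.star_apply, M_apply, M_apply, ← hstar, star_mul, star_star]
  have quadratic_nonneg (v : Fin n → Z) : 0 ≤ ∑ i, ∑ j, star (v i) * (M i j * v j) := by
    have hsum : ∑ i, ∑ j, star (v i) * (M i j * v j) =
        P (star (∑ i, y i * k (v i)) * ∑ i, y i * k (v i)) := by
      simp only [star_sum, Finset.sum_mul_sum, map_sum, star_mul, ← map_star, M_apply, mul_assoc,
        hleft]
      simp only [← mul_assoc (star (y _)), hright]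
    rw [hsum]
    exact nonneg_of_injective_of_map_nonneg hk (hnonneg _)
  obtain ⟨S, hS⟩ := exists_eq_star_mul_self_of_quadratic_nonneg hM quadratic_nonneg
  refine ⟨n, fun l i => S l i, fun i j => ?_⟩
  rw [← M_apply, hS, CStarMatrix.mul_apply]
  rfl

end Expectation

/-! ### The projection onto the cotensor product -/

section DegreeMatch

open NonUnitalStarAlgHom (id)

variable {Γ : Type*} [Group Γ] {A B C D : Type*} [NonUnitalCStarAlgebra A]
  [NonUnitalCStarAlgebra B] [NonUnitalCStarAlgebra C] [NonUnitalCStarAlgebra D]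

variable (B C D) in
/-- The isomorphism `b ⊗ (c ⊗ d) ↦ d ⊗ (b ⊗ c)`. -/
def tensorRotate : MaxTensor B (MaxTensor C D) →⋆ₙₐ[ℂ] MaxTensor D (MaxTensor B C) :=
  (tensorFlip (MaxTensor B C) D).comp (tensorAssocInv B C D)

variable (A) in
/-- The ⋆-homomorphism `a ⊗ b ↦ (a ⊗ d) ⊗ c`, where `g b = d ⊗ c`. -/
def assocAlong (g : B →⋆ₙₐ[ℂ] MaxTensor D C) : MaxTensor A B →⋆ₙₐ[ℂ] MaxTensor (MaxTensor A D) C :=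
  (tensorAssocInv A D C).comp (tensorMap (id ℂ A) g)

/-- The ⋆-homomorphism `γ ⊗ b ↦ b ⊗ (γ ⊗ γ')`, for `b` of degree `γ'`. -/
def degreeHom (c : CGammaStructure Γ B) :
    MaxTensor (GroupCStar Γ) B →⋆ₙₐ[ℂ] MaxTensor B (MaxTensor (GroupCStar Γ) (GroupCStar Γ)) :=
  (tensorRotate (GroupCStar Γ) (GroupCStar Γ) B).comp (tensorMap (id ℂ (GroupCStar Γ)) c.left)

variable (A) in
/-- The map `a ⊗ (γ ⊗ b) ↦ a ⊗ b_γ`, where `b_γ` is the component of `b` of degree `γ`. -/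
def degreeMatch (c : CGammaStructure Γ B) :
    MaxTensor A (MaxTensor (GroupCStar Γ) B) →L[ℂ] MaxTensor A B :=
  (diagSlice Γ (MaxTensor A B)).comp (homCLM (assocAlong A (degreeHom c)))

theorem tensorRotate_tmul (b : B) (c : C) (d : D) :
    tensorRotate B C D (tmul b (tmul c d)) = tmul d (tmul b c) := by
  rw [tensorRotate, NonUnitalStarAlgHom.comp_apply, tensorAssocInv_tmul,
    tensorFlip_tmul (A := MaxTensor B C)]

theorem assocAlong_tmul {g : B →⋆ₙₐ[ℂ] MaxTensor D C} (a : A) {b : B} {c : C} {d : D}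
    (h : g b = tmul d c) : assocAlong A g (tmul a b) = tmul (tmul a d) c := by
  rw [assocAlong, NonUnitalStarAlgHom.comp_apply, tensorMap_tmul, h, tensorAssocInv_tmul,
    NonUnitalStarAlgHom.coe_id, id_eq]

variable {cB : CGammaStructure Γ B}

theorem degreeHom_tmul (γ : Γ) {γ' : Γ} {b : B} (hb : cB.left b = tmul (GroupCStar.of γ') b) :
    degreeHom cB (tmul (GroupCStar.of γ) b) =
      tmul b (tmul (GroupCStar.of γ) (GroupCStar.of γ')) := by
  rw [degreeHom, NonUnitalStarAlgHom.comp_apply, tensorMap_tmul, hb, NonUnitalStarAlgHom.coe_id,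
    id_eq, tensorRotate_tmul]

open scoped Classical in
theorem degreeMatch_tmul (γ : Γ) {γ' : Γ} (a : A) {b : B}
    (hb : cB.left b = tmul (GroupCStar.of γ') b) :
    degreeMatch A cB (tmul a (tmul (GroupCStar.of γ) b)) = if γ = γ' then tmul a b else 0 := by
  rw [degreeMatch, ContinuousLinearMap.comp_apply, homCLM_apply,
    assocAlong_tmul a (degreeHom_tmul γ hb), diagSlice_tmul (A := MaxTensor A B)]

theorem degreeMatch_left (x : MaxTensor A B) :
    degreeMatch A cB (tensorMap (id ℂ A) cB.left x) = x := by
  classical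
  have h : (degreeMatch A cB).comp (homCLM (tensorMap (id ℂ A) cB.left)) =
      ContinuousLinearMap.id ℂ (MaxTensor A B) := by
    refine tensor_clm_ext (dense_span_univ A) (dense_span_bihomogeneous cB) ?_
    rintro a _ b ⟨γ, η, hb⟩
    rw [ContinuousLinearMap.comp_apply, homCLM_apply, tensorMap_tmul, NonUnitalStarAlgHom.coe_id,
      id_eq, hb.left, degreeMatch_tmul γ a hb.left, if_pos rfl, ContinuousLinearMap.id_apply]
  exact DFunLike.congr_fun h x

attribute [local instance] CStarAlgebra.spectralOrder CStarAlgebra.spectralOrderedRing in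
theorem degreeMatch_star_mul_self_nonneg (x : MaxTensor A (MaxTensor (GroupCStar Γ) B)) :
    0 ≤ degreeMatch A cB (star x * x) := by
  rw [degreeMatch, ContinuousLinearMap.comp_apply, homCLM_apply, map_mul, map_star]
  exact diagSlice_star_mul_self_nonneg (A := MaxTensor A B) _

end DegreeMatch

section Bihomogeneous

variable {Γ : Type*} [Group Γ] {A B : Type*} [NonUnitalCStarAlgebra A] [NonUnitalCStarAlgebra B]
  {c : CGammaStructure Γ A} {γ η γ' η' : Γ} {a a' : A}

theorem IsBihomogeneous.mul (h : IsBihomogeneous c γ η a) (h' : IsBihomogeneous c γ' η' a') :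
    IsBihomogeneous c (γ * γ') (η * η') (a * a') where
  left := by rw [map_mul, h.left, h'.left, tmul_mul_tmul, GroupCStar.of_mul]
  right := by rw [map_mul, h.right, h'.right, tmul_mul_tmul, GroupCStar.of_mul]

theorem IsBihomogeneous.star (h : IsBihomogeneous c γ η a) :
    IsBihomogeneous c γ⁻¹ η⁻¹ (star a) where
  left := by rw [map_star, h.left, star_tmul, GroupCStar.of_inv]
  right := by rw [map_star, h.right, star_tmul, GroupCStar.of_inv]

theorem IsBihomogeneous.map (h : IsBihomogeneous c γ η a) {cB : CGammaStructure Γ B}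
    {π : A →⋆ₙₐ[ℂ] B} (hπ : IsMorphism c cB π) : IsBihomogeneous cB γ η (π a) where
  left := (DFunLike.congr_fun hπ.left a).trans <| by
    rw [NonUnitalStarAlgHom.comp_apply, h.left, tensorMap_tmul, NonUnitalStarAlgHom.coe_id, id]
  right := (DFunLike.congr_fun hπ.right a).trans <| by
    rw [NonUnitalStarAlgHom.comp_apply, h.right, tensorMap_tmul, NonUnitalStarAlgHom.coe_id, id]

end Bihomogeneous

section Projection

open NonUnitalStarAlgHom (id)

variable {Γ : Type*} [Group Γ] {A B C D : Type*} [NonUnitalCStarAlgebra A]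
  [NonUnitalCStarAlgebra B] [NonUnitalCStarAlgebra C] [NonUnitalCStarAlgebra D]
  {cA : CGammaStructure Γ A} {cB : CGammaStructure Γ B}

variable (cA cB) in
/-- The projection of `A ⊗ B` onto the cotensor product. It maps `a ⊗ b` to itself if the right
degree of `a` is the left degree of `b`, and to zero if these degrees differ. -/
def cotensorProj : MaxTensor A B →L[ℂ] MaxTensor A B :=
  (degreeMatch A cB).comp (homCLM ((tensorAssoc A (GroupCStar Γ) B).comp
    (tensorMap cA.right (id ℂ B))))

open scoped Classical in
theorem cotensorProj_tmul {γ γ' : Γ} {a : A} {b : B}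
    (ha : cA.right a = tmul a (GroupCStar.of γ)) (hb : cB.left b = tmul (GroupCStar.of γ') b) :
    cotensorProj cA cB (tmul a b) = if γ = γ' then tmul a b else 0 := by
  rw [cotensorProj, ContinuousLinearMap.comp_apply, homCLM_apply, NonUnitalStarAlgHom.comp_apply,
    tensorMap_tmul, ha, NonUnitalStarAlgHom.coe_id, id_eq, tensorAssoc_tmul,
    degreeMatch_tmul γ a hb]

attribute [local instance] CStarAlgebra.spectralOrder CStarAlgebra.spectralOrderedRing in
theorem cotensorProj_star_mul_self_nonneg (x : MaxTensor A B) :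
    0 ≤ cotensorProj cA cB (star x * x) := by
  rw [cotensorProj, ContinuousLinearMap.comp_apply, homCLM_apply, map_mul, map_star]
  exact degreeMatch_star_mul_self_nonneg _

theorem cotensorProj_of_mem {x : MaxTensor A B} (hx : x ∈ cotensorSubalgebra cA cB) :
    cotensorProj cA cB x = x := by
  rw [mem_cotensorSubalgebra] at hx
  rw [cotensorProj, ContinuousLinearMap.comp_apply, homCLM_apply, NonUnitalStarAlgHom.comp_apply,
    hx, degreeMatch_left]

theorem tmul_mem_cotensorSubalgebra {γ : Γ} {a : A} {b : B}
    (ha : cA.right a = tmul a (GroupCStar.of γ)) (hb : cB.left b = tmul (GroupCStar.of γ) b) :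
    tmul a b ∈ cotensorSubalgebra cA cB := by
  rw [mem_cotensorSubalgebra, tensorMap_tmul, tensorMap_tmul, ha, hb, NonUnitalStarAlgHom.coe_id,
    NonUnitalStarAlgHom.coe_id, id_eq, id_eq, tensorAssoc_tmul]

theorem cotensorProj_mem {V : Submodule ℂ (MaxTensor A B)} (hV : IsClosed (V : Set (MaxTensor A B)))
    (h : ∀ ζ γ η a b, IsBihomogeneous cA ζ γ a → IsBihomogeneous cB γ η b → tmul a b ∈ V)
    (x : MaxTensor A B) : cotensorProj cA cB x ∈ V := by
  classical
  refine map_mem_of_dense_span (dense_span_tmul (dense_span_bihomogeneous cA)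
    (dense_span_bihomogeneous cB)) hV _ ?_ x
  rintro _ ⟨a, ⟨ζ, γ, ha⟩, b, ⟨γ', η, hb⟩, rfl⟩
  rw [cotensorProj_tmul ha.right hb.left]
  split_ifs with hγ
  · subst hγ
    exact h ζ γ η a b ha hb
  · exact V.zero_mem

theorem mem_of_mem_cotensorSubalgebra {V : Submodule ℂ (MaxTensor A B)}
    (hV : IsClosed (V : Set (MaxTensor A B)))
    (h : ∀ ζ γ η a b, IsBihomogeneous cA ζ γ a → IsBihomogeneous cB γ η b → tmul a b ∈ V)
    {x : MaxTensor A B} (hx : x ∈ cotensorSubalgebra cA cB) : x ∈ V :=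
  cotensorProj_of_mem hx ▸ cotensorProj_mem hV h x

theorem cotensorProj_mem_cotensorSubalgebra (x : MaxTensor A B) :
    cotensorProj cA cB x ∈ cotensorSubalgebra cA cB :=
  cotensorProj_mem (V := (cotensorSubalgebra cA cB).toSubmodule) (isClosed_cotensorSubalgebra cA cB)
    (fun _ _ _ _ _ ha hb => tmul_mem_cotensorSubalgebra ha.right hb.left) x

theorem clm_eq_of_mem_cotensorSubalgebra {E : Type*} [NonUnitalCStarAlgebra E]
    {f g : MaxTensor A B →L[ℂ] E}
    (h : ∀ ζ γ η a b, IsBihomogeneous cA ζ γ a → IsBihomogeneous cB γ η b →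
      f (tmul a b) = g (tmul a b)) {x : MaxTensor A B} (hx : x ∈ cotensorSubalgebra cA cB) :
    f x = g x :=
  sub_eq_zero.1 <| mem_of_mem_cotensorSubalgebra
    (V := LinearMap.ker ((f - g : MaxTensor A B →L[ℂ] E) : MaxTensor A B →ₗ[ℂ] E))
    (f - g).isClosed_ker (fun ζ γ η a b ha hb => sub_eq_zero.2 (h ζ γ η a b ha hb)) hx

theorem cotensorProj_star (x : MaxTensor A B) :
    cotensorProj cA cB (star x) = star (cotensorProj cA cB x) := by
  classical
  refine (dense_span_tmul (dense_span_bihomogeneous cA) (dense_span_bihomogeneous cB)).induction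
    (P := fun x => cotensorProj cA cB (star x) = star (cotensorProj cA cB x)) (fun x hx => ?_)
    (isClosed_eq (by fun_prop) (by fun_prop)) x
  refine Submodule.span_induction ?_ (by simp)
    (fun x y _ _ hx hy => by rw [star_add, map_add, map_add, hx, hy, star_add])
    (fun z x _ hx => by rw [star_smul, map_smul, map_smul, hx, star_smul]) hx
  rintro _ ⟨a, ⟨ζ, γ, ha⟩, b, ⟨γ', η, hb⟩, rfl⟩
  rw [star_tmul, cotensorProj_tmul ha.right hb.left, cotensorProj_tmul ha.star.right hb.star.left]
  simp only [inv_inj, apply_ite star, star_tmul, star_zero]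

theorem cotensorProj_tmul_mul {γ : Γ} {ζ η : Γ} {a : A} {b : B} (ha : IsBihomogeneous cA ζ γ a)
    (hb : IsBihomogeneous cB γ η b) (y : MaxTensor A B) :
    cotensorProj cA cB (tmul a b * y) = tmul a b * cotensorProj cA cB y := by
  classical
  have h : (cotensorProj cA cB).comp (ContinuousLinearMap.mul ℂ (MaxTensor A B) (tmul a b)) =
      (ContinuousLinearMap.mul ℂ (MaxTensor A B) (tmul a b)).comp (cotensorProj cA cB) := by
    refine tensor_clm_ext (dense_span_bihomogeneous cA) (dense_span_bihomogeneous cB) ?_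
    rintro a' ⟨ζ', γ', ha'⟩ b' ⟨γ'', η', hb'⟩
    rw [ContinuousLinearMap.comp_apply, ContinuousLinearMap.comp_apply,
      ContinuousLinearMap.mul_apply', ContinuousLinearMap.mul_apply', tmul_mul_tmul,
      cotensorProj_tmul ha'.right hb'.left,
      cotensorProj_tmul (ha.mul ha').right (hb.mul hb').left]
    simp only [mul_right_inj, mul_ite, mul_zero, tmul_mul_tmul]
  exact DFunLike.congr_fun h y

theorem cotensorProj_mul_left {x : MaxTensor A B} (hx : x ∈ cotensorSubalgebra cA cB)
    (y : MaxTensor A B) : cotensorProj cA cB (x * y) = x * cotensorProj cA cB y := by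
  have h := clm_eq_of_mem_cotensorSubalgebra
    (f := (cotensorProj cA cB).comp ((ContinuousLinearMap.mul ℂ (MaxTensor A B)).flip y))
    (g := (ContinuousLinearMap.mul ℂ (MaxTensor A B)).flip (cotensorProj cA cB y))
    (fun ζ γ η a b ha hb => by
      simpa only [ContinuousLinearMap.comp_apply, ContinuousLinearMap.flip_apply,
        ContinuousLinearMap.mul_apply'] using cotensorProj_tmul_mul ha hb y) hx
  simpa only [ContinuousLinearMap.comp_apply, ContinuousLinearMap.flip_apply,
    ContinuousLinearMap.mul_apply'] using h

theorem cotensorProj_mul_right {x : MaxTensor A B} (hx : x ∈ cotensorSubalgebra cA cB)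
    (y : MaxTensor A B) : cotensorProj cA cB (y * x) = cotensorProj cA cB y * x := by
  rw [← star_star (y * x), cotensorProj_star, star_mul, cotensorProj_mul_left (star_mem hx),
    star_mul, star_star, cotensorProj_star, star_star]

theorem cotensorProj_tensorMap {cC : CGammaStructure Γ C} {cD : CGammaStructure Γ D}
    {φ : A →⋆ₙₐ[ℂ] C} {ψ : B →⋆ₙₐ[ℂ] D} (hφ : IsMorphism cA cC φ) (hψ : IsMorphism cB cD ψ)
    (x : MaxTensor A B) :
    cotensorProj cC cD (tensorMap φ ψ x) = tensorMap φ ψ (cotensorProj cA cB x) := by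
  classical
  have h : (cotensorProj cC cD).comp (homCLM (tensorMap φ ψ)) =
      (homCLM (tensorMap φ ψ)).comp (cotensorProj cA cB) := by
    refine tensor_clm_ext (dense_span_bihomogeneous cA) (dense_span_bihomogeneous cB) ?_
    rintro a ⟨ζ, γ, ha⟩ b ⟨γ', η, hb⟩
    rw [ContinuousLinearMap.comp_apply, ContinuousLinearMap.comp_apply, homCLM_apply, homCLM_apply,
      tensorMap_tmul, cotensorProj_tmul ha.right hb.left,
      cotensorProj_tmul (ha.map hφ).right (hb.map hψ).left]
    simp only [apply_ite (tensorMap φ ψ), tensorMap_tmul, map_zero]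
  exact DFunLike.congr_fun h x

end Projection

/-! ### The coactions on the cotensor product -/

section Restriction

open NonUnitalStarAlgHom (id)

variable {A B C D Y Z : Type*} [NonUnitalCStarAlgebra A] [NonUnitalCStarAlgebra B]
  [NonUnitalCStarAlgebra C] [NonUnitalCStarAlgebra D] [NonUnitalCStarAlgebra Y]
  [NonUnitalCStarAlgebra Z]

theorem idTensor_tensorMap (B : Type*) [NonUnitalCStarAlgebra B] {P : Y →L[ℂ] Z} (hP : IsCP P)
    {k : Z →⋆ₙₐ[ℂ] Y} (hk : ∀ z, P (k z) = z) (x : MaxTensor B Z) :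
    idTensor B hP (tensorMap (id ℂ B) k x) = x := by
  have h : (idTensor B hP).comp (homCLM (tensorMap (id ℂ B) k)) =
      ContinuousLinearMap.id ℂ (MaxTensor B Z) := by
    refine tensor_clm_ext (dense_span_univ B) (dense_span_univ Z) ?_
    rintro b _ z _
    rw [ContinuousLinearMap.comp_apply, homCLM_apply, tensorMap_tmul, NonUnitalStarAlgHom.coe_id,
      id_eq, idTensor_tmul, hk, ContinuousLinearMap.id_apply]
  exact DFunLike.congr_fun h x

theorem tensorMap_injective_comm {f : A →⋆ₙₐ[ℂ] C} {g : B →⋆ₙₐ[ℂ] D}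
    (h : Function.Injective (tensorMap f g)) : Function.Injective (tensorMap g f) :=
  fun x y hxy => by
    have hflip := congrArg (tensorFlip D C) hxy
    rw [tensorFlip_tensorMap, tensorFlip_tensorMap] at hflip
    rw [← tensorFlip_tensorFlip x, h hflip, tensorFlip_tensorFlip]

theorem isClosed_range_hom {k : Z →⋆ₙₐ[ℂ] Y} (hk : Function.Injective k) :
    IsClosed (Set.range k) :=
  (NonUnitalStarAlgHom.isometry k hk).isClosedEmbedding.isClosed_range

theorem exists_lift {k : Z →⋆ₙₐ[ℂ] Y} (hk : Function.Injective k) (f : A →⋆ₙₐ[ℂ] Y)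
    (h : ∀ a, f a ∈ Set.range k) : ∃ g : A →⋆ₙₐ[ℂ] Z, k.comp g = f := by
  choose g hg using h
  refine ⟨{ toFun := g
            map_smul' := fun c a => hk ?_
            map_zero' := hk ?_
            map_add' := fun a b => hk ?_
            map_mul' := fun a b => hk ?_
            map_star' := fun a => hk ?_ }, DFunLike.ext _ _ hg⟩
  · simp only [hg, map_smul, MonoidHom.id_apply]
  · rw [hg, map_zero, map_zero]
  · simp only [hg, map_add]
  · simp only [hg, map_mul]
  · simp only [hg, map_star]

theorem exists_lift_of_dense {S : Set A} (hS : Dense (Submodule.span ℂ S : Set A))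
    {k : Z →⋆ₙₐ[ℂ] Y} (hk : Function.Injective k) (f : A →⋆ₙₐ[ℂ] Y)
    (h : ∀ a ∈ S, f a ∈ Set.range k) : ∃ g : A →⋆ₙₐ[ℂ] Z, k.comp g = f :=
  exists_lift hk f <| map_mem_of_dense_span (V := LinearMap.range (k : Z →ₗ[ℂ] Y)) hS
    (isClosed_range_hom hk) (homCLM f) h

variable {Γ : Type*} [Group Γ]

theorem CGammaStructure.eq_of_left_eq_of_right_eq {c c' : CGammaStructure Γ A}
    (hl : c.left = c'.left) (hr : c.right = c'.right) : c = c' := by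
  cases c
  cases c'
  cases hl
  cases hr
  rfl

theorem injective_of_left_homogeneous {l : A →⋆ₙₐ[ℂ] MaxTensor (GroupCStar Γ) A} {S : Set A}
    (hS : Dense (Submodule.span ℂ S : Set A))
    (h : ∀ a ∈ S, ∃ γ : Γ, l a = tmul (GroupCStar.of γ) a) : Function.Injective l := by
  have counit_left : (counitSlice Γ A).comp l = id ℂ A := hom_ext_of_dense hS fun a ha => by
    obtain ⟨γ, hγ⟩ := h a ha
    rw [NonUnitalStarAlgHom.comp_apply, hγ, counitSlice_tmul, NonUnitalStarAlgHom.coe_id, id_eq]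
  exact Function.LeftInverse.injective (g := counitSlice Γ A) (DFunLike.congr_fun counit_left)

theorem injective_of_right_homogeneous {r : A →⋆ₙₐ[ℂ] MaxTensor A (GroupCStar Γ)} {S : Set A}
    (hS : Dense (Submodule.span ℂ S : Set A))
    (h : ∀ a ∈ S, ∃ γ : Γ, r a = tmul a (GroupCStar.of γ)) : Function.Injective r := by
  refine Function.Injective.of_comp (f := tensorFlip A (GroupCStar Γ)) ?_
  refine injective_of_left_homogeneous (l := (tensorFlip A (GroupCStar Γ)).comp r) hS fun a ha => ?_
  obtain ⟨γ, hγ⟩ := h a ha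
  exact ⟨γ, by rw [NonUnitalStarAlgHom.comp_apply, hγ, tensorFlip_tmul]⟩

/-- The `(ℂ,Γ)`-structure given by two ⋆-homomorphisms that are diagonal on a total subset. All
axioms of a `(ℂ,Γ)`-structure are automatic in this case. -/
def CGammaStructure.ofTotal (l : A →⋆ₙₐ[ℂ] MaxTensor (GroupCStar Γ) A)
    (r : A →⋆ₙₐ[ℂ] MaxTensor A (GroupCStar Γ)) {S : Set A}
    (hS : Dense (Submodule.span ℂ S : Set A))
    (hl : ∀ a ∈ S, ∃ γ : Γ, l a = tmul (GroupCStar.of γ) a)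
    (hr : ∀ a ∈ S, ∃ γ : Γ, r a = tmul a (GroupCStar.of γ)) : CGammaStructure Γ A where
  left := l
  right := r
  left_injective := injective_of_left_homogeneous hS hl
  right_injective := injective_of_right_homogeneous hS hr
  left_coassoc := hom_ext_of_dense hS fun a ha => by
    obtain ⟨γ, hγ⟩ := hl a ha
    simp only [NonUnitalStarAlgHom.comp_apply, hγ, tensorMap_tmul, NonUnitalStarAlgHom.coe_id,
      id_eq, comul_of, tensorAssoc_tmul]
  right_coassoc := hom_ext_of_dense hS fun a ha => by
    obtain ⟨γ, hγ⟩ := hr a ha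
    simp only [NonUnitalStarAlgHom.comp_apply, hγ, tensorMap_tmul, NonUnitalStarAlgHom.coe_id,
      id_eq, comul_of, tensorAssoc_tmul]
  left_right := hom_ext_of_dense hS fun a ha => by
    obtain ⟨γ, hγ⟩ := hl a ha
    obtain ⟨η, hη⟩ := hr a ha
    simp only [NonUnitalStarAlgHom.comp_apply, hγ, hη, tensorMap_tmul, NonUnitalStarAlgHom.coe_id,
      id_eq, tensorAssoc_tmul]

section Retract

variable (cA : CGammaStructure Γ A) (cB : CGammaStructure Γ B)

/-- The projection of `A ⊗ B` onto the cotensor product, as a map into the cotensor product. -/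
def cotensorRetract : MaxTensor A B →L[ℂ] Cotensor cA cB :=
  (cotensorProj cA cB).codRestrict (cotensorSubalgebra cA cB).toSubmodule
    cotensorProj_mem_cotensorSubalgebra

theorem cotensorIncl_cotensorRetract (x : MaxTensor A B) :
    cotensorIncl cA cB (cotensorRetract cA cB x) = cotensorProj cA cB x := rfl

theorem cotensorIncl_mem (z : Cotensor cA cB) :
    cotensorIncl cA cB z ∈ cotensorSubalgebra cA cB := z.2

theorem cotensorRetract_cotensorIncl (z : Cotensor cA cB) :
    cotensorRetract cA cB (cotensorIncl cA cB z) = z :=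
  cotensorIncl_injective cA cB <| by
    rw [cotensorIncl_cotensorRetract, cotensorProj_of_mem (cotensorIncl_mem cA cB z)]

theorem isCP_cotensorRetract : IsCP (cotensorRetract cA cB) := by
  refine isCP_of_bimodule (cotensorIncl_injective cA cB)
    (fun z y => cotensorIncl_injective cA cB ?_) (fun y z => cotensorIncl_injective cA cB ?_)
    (fun y => cotensorIncl_injective cA cB ?_) fun y => ?_
  · rw [map_mul (cotensorIncl cA cB), cotensorIncl_cotensorRetract, cotensorIncl_cotensorRetract,
      cotensorProj_mul_left (cotensorIncl_mem cA cB z)]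
  · rw [map_mul (cotensorIncl cA cB), cotensorIncl_cotensorRetract, cotensorIncl_cotensorRetract,
      cotensorProj_mul_right (cotensorIncl_mem cA cB z)]
  · rw [map_star (cotensorIncl cA cB), cotensorIncl_cotensorRetract, cotensorIncl_cotensorRetract,
      cotensorProj_star]
  · rw [cotensorIncl_cotensorRetract]
    exact cotensorProj_star_mul_self_nonneg y

theorem tensorMap_id_cotensorIncl_injective (E : Type*) [NonUnitalCStarAlgebra E] :
    Function.Injective (tensorMap (id ℂ E) (cotensorIncl cA cB)) :=
  Function.LeftInverse.injective
    (idTensor_tensorMap E (isCP_cotensorRetract cA cB) (cotensorRetract_cotensorIncl cA cB))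

theorem tensorMap_cotensorIncl_id_injective (E : Type*) [NonUnitalCStarAlgebra E] :
    Function.Injective (tensorMap (cotensorIncl cA cB) (id ℂ E)) :=
  tensorMap_injective_comm (tensorMap_id_cotensorIncl_injective cA cB E)

/-- The elements `a ⊗ b` of the cotensor product with bihomogeneous `a` and `b`; they span a dense
subspace. -/
def cotensorTotal : Set (Cotensor cA cB) :=
  {z | ∃ ζ γ η a b, IsBihomogeneous cA ζ γ a ∧ IsBihomogeneous cB γ η b ∧
    cotensorIncl cA cB z = tmul a b}

theorem dense_span_cotensorTotal :
    Dense (Submodule.span ℂ (cotensorTotal cA cB) : Set (Cotensor cA cB)) := by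
  intro z
  let V := (Submodule.span ℂ (cotensorTotal cA cB)).topologicalClosure
  have retract_mem : cotensorIncl cA cB z ∈
      V.comap (cotensorRetract cA cB : MaxTensor A B →ₗ[ℂ] Cotensor cA cB) := by
    refine mem_of_mem_cotensorSubalgebra
      ((Submodule.isClosed_topologicalClosure _).preimage (cotensorRetract cA cB).continuous)
      (fun ζ γ η a b ha hb => ?_) (cotensorIncl_mem cA cB z)
    refine Submodule.le_topologicalClosure _ (Submodule.subset_span ⟨ζ, γ, η, a, b, ha, hb, ?_⟩)
    exact (cotensorIncl_cotensorRetract cA cB _).trans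
      (cotensorProj_of_mem (tmul_mem_cotensorSubalgebra ha.right hb.left))
  rw [Submodule.mem_comap] at retract_mem
  rw [← cotensorRetract_cotensorIncl cA cB z]
  exact retract_mem

theorem tensorAssoc_comp_tensorMap_cotensorIncl_injective :
    Function.Injective ((tensorAssoc A B (GroupCStar Γ)).comp
      (tensorMap (cotensorIncl cA cB) (id ℂ (GroupCStar Γ)))) :=
  tensorAssoc_injective.comp (tensorMap_cotensorIncl_id_injective cA cB _)

theorem exists_left_restriction :
    ∃ l : Cotensor cA cB →⋆ₙₐ[ℂ] MaxTensor (GroupCStar Γ) (Cotensor cA cB),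
      (tensorMap (id ℂ (GroupCStar Γ)) (cotensorIncl cA cB)).comp l =
        (tensorAssoc (GroupCStar Γ) A B).comp
          ((tensorMap cA.left (id ℂ B)).comp (cotensorIncl cA cB)) := by
  refine exists_lift_of_dense (dense_span_cotensorTotal cA cB)
    (tensorMap_id_cotensorIncl_injective cA cB _) _ ?_
  rintro z ⟨ζ, γ, η, a, b, ha, -, h⟩
  refine ⟨tmul (GroupCStar.of ζ) z, ?_⟩
  rw [tensorMap_tmul, NonUnitalStarAlgHom.coe_id, id_eq, NonUnitalStarAlgHom.comp_apply,
    NonUnitalStarAlgHom.comp_apply, h, tensorMap_tmul, NonUnitalStarAlgHom.coe_id, id_eq, ha.left,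
    tensorAssoc_tmul]

theorem exists_right_restriction :
    ∃ r : Cotensor cA cB →⋆ₙₐ[ℂ] MaxTensor (Cotensor cA cB) (GroupCStar Γ),
      (tensorAssoc A B (GroupCStar Γ)).comp
          ((tensorMap (cotensorIncl cA cB) (id ℂ (GroupCStar Γ))).comp r) =
        (tensorMap (id ℂ A) cB.right).comp (cotensorIncl cA cB) := by
  refine exists_lift_of_dense (dense_span_cotensorTotal cA cB)
    (tensorAssoc_comp_tensorMap_cotensorIncl_injective cA cB) _ ?_
  rintro z ⟨ζ, γ, η, a, b, -, hb, h⟩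
  refine ⟨tmul z (GroupCStar.of η), ?_⟩
  rw [NonUnitalStarAlgHom.comp_apply, NonUnitalStarAlgHom.comp_apply, tensorMap_tmul,
    NonUnitalStarAlgHom.coe_id, id_eq, h, tensorAssoc_tmul, tensorMap_tmul, hb.right,
    NonUnitalStarAlgHom.coe_id, id_eq]

end Retract

variable {cA : CGammaStructure Γ A} {cB : CGammaStructure Γ B} {z : Cotensor cA cB} {γ : Γ}
  {a : A} {b : B}

theorem left_restriction_apply
    {l : Cotensor cA cB →⋆ₙₐ[ℂ] MaxTensor (GroupCStar Γ) (Cotensor cA cB)}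
    (hl : (tensorMap (id ℂ (GroupCStar Γ)) (cotensorIncl cA cB)).comp l =
      (tensorAssoc (GroupCStar Γ) A B).comp
        ((tensorMap cA.left (id ℂ B)).comp (cotensorIncl cA cB)))
    (ha : cA.left a = tmul (GroupCStar.of γ) a) (hz : cotensorIncl cA cB z = tmul a b) :
    l z = tmul (GroupCStar.of γ) z := by
  refine tensorMap_id_cotensorIncl_injective cA cB _ ((DFunLike.congr_fun hl z).trans ?_)
  rw [NonUnitalStarAlgHom.comp_apply, NonUnitalStarAlgHom.comp_apply, hz, tensorMap_tmul,
    tensorMap_tmul, ha, NonUnitalStarAlgHom.coe_id, id_eq, NonUnitalStarAlgHom.coe_id, id_eq,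
    tensorAssoc_tmul, hz]

theorem right_restriction_apply
    {r : Cotensor cA cB →⋆ₙₐ[ℂ] MaxTensor (Cotensor cA cB) (GroupCStar Γ)}
    (hr : (tensorAssoc A B (GroupCStar Γ)).comp
        ((tensorMap (cotensorIncl cA cB) (id ℂ (GroupCStar Γ))).comp r) =
      (tensorMap (id ℂ A) cB.right).comp (cotensorIncl cA cB))
    (hb : cB.right b = tmul b (GroupCStar.of γ)) (hz : cotensorIncl cA cB z = tmul a b) :
    r z = tmul z (GroupCStar.of γ) := by
  refine tensorAssoc_comp_tensorMap_cotensorIncl_injective cA cB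
    ((DFunLike.congr_fun hr z).trans ?_)
  rw [NonUnitalStarAlgHom.comp_apply, NonUnitalStarAlgHom.comp_apply, hz, tensorMap_tmul,
    tensorMap_tmul, hb, NonUnitalStarAlgHom.coe_id, id_eq, NonUnitalStarAlgHom.coe_id, id_eq, hz,
    tensorAssoc_tmul]

theorem IsRestriction.unique {c c' : CGammaStructure Γ (Cotensor cA cB)}
    (hc : IsRestriction cA cB c) (hc' : IsRestriction cA cB c') : c = c' :=
  CGammaStructure.eq_of_left_eq_of_right_eq
    (DFunLike.ext _ _ fun z => tensorMap_id_cotensorIncl_injective cA cB _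
      (DFunLike.congr_fun (hc.left.trans hc'.left.symm) z))
    (DFunLike.ext _ _ fun z => tensorAssoc_comp_tensorMap_cotensorIncl_injective cA cB
      (DFunLike.congr_fun (hc.right.trans hc'.right.symm) z))

variable (cA cB) in
theorem existsUnique_isRestriction :
    ∃! c : CGammaStructure Γ (Cotensor cA cB), IsRestriction cA cB c := by
  obtain ⟨l, hl⟩ := exists_left_restriction cA cB
  obtain ⟨r, hr⟩ := exists_right_restriction cA cB
  let c := CGammaStructure.ofTotal l r (dense_span_cotensorTotal cA cB)
    (fun z ⟨ζ, _, _, _, _, ha, _, hz⟩ => ⟨ζ, left_restriction_apply hl ha.left hz⟩)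
    (fun z ⟨_, _, η, _, _, _, hb, hz⟩ => ⟨η, right_restriction_apply hr hb.right hz⟩)
  have hc : IsRestriction cA cB c := ⟨hl, hr⟩
  exact ⟨c, hc, fun c' hc' => hc'.unique hc⟩

end Restriction

/-! ### Tensor products with ideals -/

section Ideal

open NonUnitalStarAlgHom (id)

variable {A B J Y : Type*} [NonUnitalCStarAlgebra A] [NonUnitalCStarAlgebra B]
  [NonUnitalCStarAlgebra J] [NonUnitalCStarAlgebra Y]

theorem exists_clm_lift {k : J →⋆ₙₐ[ℂ] Y} (hk : Function.Injective k) (f : A →L[ℂ] Y)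
    (h : ∀ a, f a ∈ Set.range k) : ∃ g : A →L[ℂ] J, ∀ a, k (g a) = f a := by
  let k' : J →ₗᵢ[ℂ] Y := ⟨k, (AddMonoidHomClass.isometry_iff_norm k).mp
    (NonUnitalStarAlgHom.isometry k hk)⟩
  refine ⟨(k'.equivRange.symm : _ →L[ℂ] J).comp (f.codRestrict (LinearMap.range k'.toLinearMap) h),
    fun a => ?_⟩
  exact congrArg Subtype.val (k'.equivRange.apply_symm_apply ⟨f a, h a⟩)

variable {ι : J →⋆ₙₐ[ℂ] A} (hι : Function.Injective ι) (hI : ∀ a j, ∃ j', ι j' = a * ι j)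

include hι hI

theorem exists_isCP_conj (e : J) :
    ∃ P : A →L[ℂ] J, IsCP P ∧ ∀ a, ι (P a) = star (ι e) * a * ι e := by
  obtain ⟨P, hP⟩ := exists_clm_lift hι (ContinuousLinearMap.mulLeftRight ℂ A (star (ι e)) (ι e))
    fun a => by
      obtain ⟨j, hj⟩ := hI (star (ι e) * a) e
      exact ⟨j, hj⟩
  refine ⟨P, fun n y => ?_, hP⟩
  choose w hw using fun i => hI (y i) e
  refine ⟨1, fun _ => w, fun i j => hι ?_⟩
  rw [hP, ContinuousLinearMap.mulLeftRight_apply, Fin.sum_univ_one, map_mul, map_star, hw, hw,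
    star_mul]
  simp only [mul_assoc]

omit hι hI

theorem eq_zero_of_mul_tmul_eq_zero {z : MaxTensor A B} (h : ∀ a b, z * tmul a b = 0) :
    z = 0 := by
  have hmul : ContinuousLinearMap.mul ℂ (MaxTensor A B) z = 0 :=
    tensor_clm_ext (dense_span_univ A) (dense_span_univ B) fun a _ b _ => h a b
  exact CStarRing.mul_star_self_eq_zero_iff z |>.mp (DFunLike.congr_fun hmul (star z))

theorem idTensor_conj_tensorMap {e : J} {P : A →L[ℂ] J} (hP : IsCP P)
    (h : ∀ j, P (ι j) = star e * j * e) (z : MaxTensor B J) (b : B) (c : J) :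
    star (tmul b c) * idTensor B hP (tensorMap (id ℂ B) ι z) * tmul b c =
      star (tmul b (e * c)) * z * tmul b (e * c) := by
  have hCLM : (ContinuousLinearMap.mulLeftRight ℂ (MaxTensor B J) (star (tmul b c))
      (tmul b c)).comp ((idTensor B hP).comp (homCLM (tensorMap (id ℂ B) ι))) =
      ContinuousLinearMap.mulLeftRight ℂ (MaxTensor B J) (star (tmul b (e * c)))
        (tmul b (e * c)) := by
    refine tensor_clm_ext (dense_span_univ B) (dense_span_univ J) fun x _ j _ => ?_
    simp only [ContinuousLinearMap.comp_apply, ContinuousLinearMap.mulLeftRight_apply,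
      homCLM_apply, tensorMap_tmul, NonUnitalStarAlgHom.coe_id, id_eq, idTensor_tmul, h, star_tmul,
      tmul_mul_tmul, star_mul, mul_assoc]
  exact DFunLike.congr_fun hCLM z

include hι hI

-- For `e` in the ideal, `id ⊗ (a ↦ e⋆ a e)` is defined on all of `B ⊗ A`, so the image of `z` in
-- `B ⊗ A` determines the products `x⋆ z x`.
theorem tensorMap_id_ideal_injective : Function.Injective (tensorMap (id ℂ B) ι) := by
  have mul_tmul_mul_eq_zero {z : MaxTensor B J} (hz : tensorMap (id ℂ B) ι z = 0) (b : B)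
      (e c : J) : z * tmul b (e * c) = 0 := by
    obtain ⟨P, hP, hconj⟩ := exists_isCP_conj hι hI e
    have h := idTensor_conj_tensorMap hP (e := e) (fun j => hι (by
      rw [hconj, map_mul, map_mul, map_star])) (star z * z) b c
    rw [map_mul, hz, mul_zero, map_zero, mul_zero, zero_mul] at h
    rw [← CStarRing.star_mul_self_eq_zero_iff, star_mul, mul_assoc, ← mul_assoc (star z),
      ← mul_assoc, ← h]
  refine (injective_iff_map_eq_zero _).mpr fun z hz => ?_
  refine eq_zero_of_mul_tmul_eq_zero fun b e => eq_zero_of_mul_tmul_eq_zero fun b' c => ?_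
  rw [mul_assoc, tmul_mul_tmul]
  exact mul_tmul_mul_eq_zero hz (b * b') e c

theorem tensorMap_ideal_id_injective : Function.Injective (tensorMap ι (id ℂ B)) :=
  tensorMap_injective_comm (tensorMap_id_ideal_injective hι hI)

end Ideal

/-! ### Quotients by closed ideals -/

section Quotient

attribute [local instance] CStarAlgebra.spectralOrder CStarAlgebra.spectralOrderedRing

variable {Y I : Type*} [NonUnitalCStarAlgebra Y] [NonUnitalCStarAlgebra I]

theorem norm_one_sub_inr_le_one {e : Y} (he : 0 ≤ e) (hnorm : ‖e‖ ≤ 1) :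
    ‖(1 : Unitization ℂ Y) - e‖ ≤ 1 := by
  have inr_nonneg : 0 ≤ (e : Unitization ℂ Y) := Unitization.inr_nonneg_iff.mpr he
  have inr_le_one : (e : Unitization ℂ Y) ≤ 1 := by
    rwa [← CStarAlgebra.norm_le_one_iff_of_nonneg _ inr_nonneg, Unitization.norm_inr]
  rw [CStarAlgebra.norm_le_one_iff_of_nonneg _ (sub_nonneg.mpr inr_le_one)]
  exact sub_le_self _ inr_nonneg

theorem norm_sub_mul_le (u : Y) {e : Y} (he : 0 ≤ e) (hnorm : ‖e‖ ≤ 1) : ‖u - u * e‖ ≤ ‖u‖ :=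
  calc ‖u - u * e‖ = ‖(u : Unitization ℂ Y) * (1 - e)‖ := by
        rw [← Unitization.norm_inr (𝕜 := ℂ), Unitization.inr_sub, Unitization.inr_mul, mul_sub,
          mul_one]
    _ ≤ ‖(u : Unitization ℂ Y)‖ * ‖(1 : Unitization ℂ Y) - e‖ := norm_mul_le _ _
    _ ≤ ‖(u : Unitization ℂ Y)‖ :=
        mul_le_of_le_one_right (norm_nonneg _) (norm_one_sub_inr_le_one he hnorm)
    _ = ‖u‖ := Unitization.norm_inr u

theorem norm_sub_mul_left_le (u : Y) {e : Y} (he : 0 ≤ e) (hnorm : ‖e‖ ≤ 1) :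
    ‖u - e * u‖ ≤ ‖u‖ := by
  have h := norm_sub_mul_le (star u) he hnorm
  rwa [← norm_star, star_sub, star_mul, star_star, he.isSelfAdjoint.star_eq, norm_star] at h

theorem norm_sub_mul_sq_le {x m j e : Y} (h : star x * x = m + j) (he : 0 ≤ e) (hnorm : ‖e‖ ≤ 1) :
    ‖x - x * e‖ ^ 2 ≤ ‖m‖ + ‖j - e * j‖ := by
  have star_mul_self_eq : star (x - x * e) * (x - x * e) =
      ((m - e * m) - (m - e * m) * e) + ((j - e * j) - (j - e * j) * e) := by
    rw [star_sub, star_mul, he.isSelfAdjoint.star_eq]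
    calc (star x - e * star x) * (x - x * e)
        = (star x * x - e * (star x * x)) - (star x * x - e * (star x * x)) * e := by noncomm_ring
      _ = _ := by rw [h]; noncomm_ring
  calc ‖x - x * e‖ ^ 2 = ‖star (x - x * e) * (x - x * e)‖ := by
        rw [CStarRing.norm_star_mul_self, sq]
    _ ≤ ‖(m - e * m) - (m - e * m) * e‖ + ‖(j - e * j) - (j - e * j) * e‖ := by
        rw [star_mul_self_eq]
        exact norm_add_le _ _
    _ ≤ ‖m - e * m‖ + ‖j - e * j‖ :=
        add_le_add (norm_sub_mul_le _ he hnorm) (norm_sub_mul_le _ he hnorm)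
    _ ≤ ‖m‖ + ‖j - e * j‖ := add_le_add_left (norm_sub_mul_left_le m he hnorm) _

/-- The range of a ⋆-homomorphism as a subspace. -/
def rangeSubmodule (k : I →⋆ₙₐ[ℂ] Y) : Submodule ℂ Y := LinearMap.range (k : I →ₗ[ℂ] Y)

/-- The norm of the class of `y` in the quotient of `Y` by the range of `k`. -/
def quotientNorm (k : I →⋆ₙₐ[ℂ] Y) (y : Y) : ℝ :=
  ‖(Submodule.Quotient.mk y : Y ⧸ rangeSubmodule k)‖

variable {k : I →⋆ₙₐ[ℂ] Y}

theorem mem_rangeSubmodule {y : Y} : y ∈ rangeSubmodule k ↔ ∃ i, k i = y := Iff.rfl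

theorem star_mem_rangeSubmodule {y : Y} (h : y ∈ rangeSubmodule k) : star y ∈ rangeSubmodule k := by
  obtain ⟨i, rfl⟩ := mem_rangeSubmodule.mp h
  exact mem_rangeSubmodule.mpr ⟨star i, map_star k i⟩

theorem quotientNorm_le_of_mem {x y : Y} (h : x - y ∈ rangeSubmodule k) :
    quotientNorm k x ≤ ‖y‖ := by
  rw [quotientNorm, (Submodule.Quotient.eq _).mpr h]
  exact Submodule.Quotient.norm_mk_le _ y

theorem exists_sub_mem_norm_lt {x : Y} {r : ℝ} (h : quotientNorm k x < r) :
    ∃ y, x - y ∈ rangeSubmodule k ∧ ‖y‖ < r := by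
  obtain ⟨y, hy, hr⟩ := Submodule.Quotient.norm_mk_lt
    (Submodule.Quotient.mk x : Y ⧸ rangeSubmodule k) (sub_pos.mpr h)
  refine ⟨y, (Submodule.Quotient.eq _).mp hy.symm, hr.trans_eq ?_⟩
  rw [quotientNorm, add_sub_cancel]

theorem quotientNorm_star_le (x : Y) : quotientNorm k (star x) ≤ quotientNorm k x := by
  refine le_of_forall_gt_imp_ge_of_dense fun r hr => ?_
  obtain ⟨y, hy, hyr⟩ := exists_sub_mem_norm_lt hr
  refine (quotientNorm_le_of_mem (y := star y) ?_).trans ((norm_star y).trans_le hyr.le)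
  rw [← star_sub]
  exact star_mem_rangeSubmodule hy

variable (hI : ∀ y i, ∃ i', k i' = y * k i)

include hI

theorem mul_mem_rangeSubmodule (x : Y) {y : Y} (h : y ∈ rangeSubmodule k) :
    x * y ∈ rangeSubmodule k := by
  obtain ⟨i, rfl⟩ := mem_rangeSubmodule.mp h
  exact mem_rangeSubmodule.mpr (hI x i)

theorem mul_mem_rangeSubmodule_of_left {x : Y} (h : x ∈ rangeSubmodule k) (y : Y) :
    x * y ∈ rangeSubmodule k := by
  have h_star := star_mem_rangeSubmodule
    (mul_mem_rangeSubmodule hI (star y) (star_mem_rangeSubmodule h))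
  rwa [star_mul, star_star, star_star] at h_star

theorem quotientNorm_mul_le (x y : Y) :
    quotientNorm k (x * y) ≤ quotientNorm k x * quotientNorm k y := by
  refine le_mul_of_forall_lt₀ fun r hr s hs => ?_
  obtain ⟨x', hx, hxr⟩ := exists_sub_mem_norm_lt hr
  obtain ⟨y', hy, hys⟩ := exists_sub_mem_norm_lt hs
  refine (quotientNorm_le_of_mem (y := x' * y') ?_).trans ((norm_mul_le _ _).trans
    (mul_le_mul hxr.le hys.le (norm_nonneg _) ((norm_nonneg _).trans hxr.le)))
  have sub_eq : x * y - x' * y' = x * (y - y') + (x - x') * y' := by noncomm_ring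
  rw [sub_eq]
  exact add_mem (mul_mem_rangeSubmodule hI _ hy) (mul_mem_rangeSubmodule_of_left hI hx _)

theorem quotientNorm_le_norm_sub_mul (x : Y) (e : I) : quotientNorm k x ≤ ‖x - x * k e‖ := by
  refine quotientNorm_le_of_mem ?_
  rw [sub_sub_cancel]
  exact mul_mem_rangeSubmodule hI _ (mem_rangeSubmodule.mpr ⟨e, rfl⟩)

theorem quotientNorm_sq_le (x : Y) : quotientNorm k x ^ 2 ≤ quotientNorm k (star x * x) := by
  refine le_of_forall_gt_imp_ge_of_dense fun r hr => ?_
  obtain ⟨m, hm, hmr⟩ := exists_sub_mem_norm_lt hr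
  obtain ⟨j, hj⟩ := mem_rangeSubmodule.mp hm
  have unitI := CStarAlgebra.increasingApproximateUnit I
  have := unitI.neBot
  have lim : Tendsto (fun e : I => ‖m‖ + ‖j - e * j‖) (CStarAlgebra.approximateUnit I)
      (𝓝 ‖m‖) := by
    simpa only [sub_self, norm_zero, add_zero] using
      ((tendsto_const_nhds (x := j)).sub (unitI.tendsto_mul_right j)).norm.const_add ‖m‖
  refine (ge_of_tendsto lim ?_).trans hmr.le
  filter_upwards [unitI.eventually_nonneg, unitI.eventually_norm] with e he hnorm
  calc quotientNorm k x ^ 2 ≤ ‖x - x * k e‖ ^ 2 :=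
        pow_le_pow_left₀ (norm_nonneg _) (quotientNorm_le_norm_sub_mul hI x e) 2
    _ ≤ ‖m‖ + ‖k j - k e * k j‖ := norm_sub_mul_sq_le (by rw [hj]; abel) (map_nonneg k he)
        ((NonUnitalStarAlgHom.norm_apply_le k e).trans hnorm)
    _ = ‖m‖ + ‖k (j - e * j)‖ := by rw [map_sub, map_mul]
    _ ≤ ‖m‖ + ‖j - e * j‖ := by
        gcongr
        exact NonUnitalStarAlgHom.norm_apply_le k _

/-- The quotient norm of a closed ideal as a C⋆-seminorm. -/
def quotientSeminorm : CStarSeminorm Y where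
  toFun := quotientNorm k
  map_zero' := by rw [quotientNorm, Submodule.Quotient.mk_zero, norm_zero]
  add_le' x y := by
    rw [quotientNorm, Submodule.Quotient.mk_add]
    exact norm_add_le _ _
  neg' x := by rw [quotientNorm, Submodule.Quotient.mk_neg, norm_neg, quotientNorm]
  smul' c x := by rw [quotientNorm, Submodule.Quotient.mk_smul, norm_smul, quotientNorm]
  mul_le' := quotientNorm_mul_le hI
  star_mul_self' x := by
    refine le_antisymm ((quotientNorm_mul_le hI _ _).trans ?_) (quotientNorm_sq_le hI x)
    rw [sq]
    exact mul_le_mul_of_nonneg_right (quotientNorm_star_le x) (norm_nonneg _)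

end Quotient

section Descend

variable {X X' : Type*} [NonUnitalRing X] [StarRing X] [Module ℂ X] [NonUnitalRing X'] [StarRing X']
  [Module ℂ X']

theorem CStarSeminorm.eq_of_sub_eq_zero (p : CStarSeminorm X) {x y : X} (h : p (x - y) = 0) :
    p x = p y := by
  refine le_antisymm ?_ ?_
  · calc p x = p (x - y + y) := by rw [sub_add_cancel]
      _ ≤ p (x - y) + p y := map_add_le_add p.toSeminorm _ _
      _ = p y := by rw [h, zero_add]
  · calc p y = p (x - (x - y)) := by rw [sub_sub_cancel]
      _ ≤ p x + p (x - y) := map_sub_le_add p.toSeminorm _ _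
      _ = p x := by rw [h, add_zero]

theorem CStarSeminorm.eq_of_map_eq (p : CStarSeminorm X) {ρ : X →⋆ₙₐ[ℂ] X'}
    (hker : ∀ x, ρ x = 0 → p x = 0) {x y : X} (h : ρ x = ρ y) : p x = p y :=
  p.eq_of_sub_eq_zero (hker _ (by rw [map_sub, h, sub_self]))

/-- The C⋆-seminorm induced by `p` along a surjection `ρ` on whose kernel `p` vanishes; its values
are computed on the preimages `Function.surjInv`. -/
def CStarSeminorm.descend (p : CStarSeminorm X) {ρ : X →⋆ₙₐ[ℂ] X'} (hρ : Function.Surjective ρ)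
    (hker : ∀ x, ρ x = 0 → p x = 0) : CStarSeminorm X' :=
  let σ := Function.surjInv hρ
  have map_section (x') : ρ (σ x') = x' := Function.surjInv_eq hρ x'
  have section_map {x x'} (h : ρ x = x') : p (σ x') = p x :=
    p.eq_of_map_eq hker ((map_section x').trans h.symm)
  { toFun := fun x => p (σ x)
    map_zero' := by
      rw [section_map (map_zero ρ)]
      exact map_zero p.toSeminorm
    add_le' := fun x y => by
      rw [section_map (x := σ x + σ y) (by rw [map_add, map_section, map_section])]
      exact map_add_le_add p.toSeminorm _ _
    neg' := fun x => by
      rw [section_map (x := -σ x) (by rw [map_neg, map_section])]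
      exact map_neg_eq_map p.toSeminorm _
    smul' := fun c x => by
      rw [section_map (x := c • σ x) (by rw [map_smul, map_section])]
      exact map_smul_eq_mul p.toSeminorm _ _
    mul_le' := fun x y => by
      rw [section_map (x := σ x * σ y) (by rw [map_mul, map_section, map_section])]
      exact p.mul_le _ _
    star_mul_self' := fun x => by
      rw [section_map (x := star (σ x) * σ x) (by rw [map_mul, map_star, map_section])]
      exact p.star_mul_self _ }

theorem CStarSeminorm.descend_apply (p : CStarSeminorm X) {ρ : X →⋆ₙₐ[ℂ] X'}
    (hρ : Function.Surjective ρ) (hker : ∀ x, ρ x = 0 → p x = 0) (x : X) :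
    p.descend hρ hker (ρ x) = p x :=
  p.eq_of_map_eq hker (Function.surjInv_eq hρ (ρ x))

/-- The C⋆-seminorm `x ↦ p (f x)`. -/
def CStarSeminorm.pullback (p : CStarSeminorm X') (f : X →⋆ₙₐ[ℂ] X') : CStarSeminorm X where
  toFun x := p (f x)
  map_zero' := by
    rw [map_zero]
    exact map_zero p.toSeminorm
  add_le' x y := by
    rw [map_add]
    exact map_add_le_add p.toSeminorm _ _
  neg' x := by
    rw [map_neg]
    exact map_neg_eq_map p.toSeminorm _
  smul' c x := by
    rw [map_smul]
    exact map_smul_eq_mul p.toSeminorm _ _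
  mul_le' x y := by
    rw [map_mul]
    exact p.mul_le _ _
  star_mul_self' x := by
    rw [map_mul, map_star]
    exact p.star_mul_self _

end Descend

/-! ### Exactness of the maximal tensor product -/

section Exact

open NonUnitalStarAlgHom (id)

section AlgTensorMap

variable {A A' B B' : Type*} [NonUnitalCStarAlgebra A] [NonUnitalCStarAlgebra A']
  [NonUnitalCStarAlgebra B'] [NonUnitalCStarAlgebra B]

/-- The map `f ⊗ g` between algebraic tensor products. -/
def algTensorMap (f : A →⋆ₙₐ[ℂ] A') (g : B →⋆ₙₐ[ℂ] B') : A ⊗[ℂ] B →⋆ₙₐ[ℂ] A' ⊗[ℂ] B' :=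
  { TensorProduct.map (f : A →ₗ[ℂ] A') (g : B →ₗ[ℂ] B') with
    map_zero' := map_zero _
    map_mul' := fun x y => by
      change TensorProduct.map _ _ (x * y) = TensorProduct.map _ _ x * TensorProduct.map _ _ y
      induction x using TensorProduct.induction_on with
      | zero => simp only [zero_mul, map_zero]
      | add x x' hx hx' => rw [add_mul, map_add, map_add, add_mul, hx, hx']
      | tmul a b =>
        induction y using TensorProduct.induction_on with
        | zero => simp only [mul_zero, map_zero]
        | add y y' hy hy' => rw [mul_add, map_add, map_add, mul_add, hy, hy']
        | tmul a' b' =>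
          simp only [Algebra.TensorProduct.tmul_mul_tmul, TensorProduct.map_tmul, LinearMap.coe_coe,
            map_mul]
    map_star' := fun x => by
      change TensorProduct.map _ _ (star x) = star (TensorProduct.map _ _ x)
      induction x using TensorProduct.induction_on with
      | zero => simp only [star_zero, map_zero]
      | add x x' hx hx' => rw [star_add, map_add, map_add, star_add, hx, hx']
      | tmul a b =>
        simp only [TensorProduct.star_tmul, TensorProduct.map_tmul, LinearMap.coe_coe, map_star] }

theorem tensorMap_ofAlg (f : A →⋆ₙₐ[ℂ] A') (g : B →⋆ₙₐ[ℂ] B') (x : A ⊗[ℂ] B) :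
    tensorMap f g (ofAlg A B x) = ofAlg A' B' (algTensorMap f g x) := by
  induction x using TensorProduct.induction_on with
  | zero => simp only [map_zero]
  | add x y hx hy => simp only [map_add, hx, hy]
  | tmul a b => exact tensorMap_tmul f g a b

theorem algTensorMap_surjective {f : A →⋆ₙₐ[ℂ] A'} {g : B →⋆ₙₐ[ℂ] B'}
    (hf : Function.Surjective f) (hg : Function.Surjective g) :
    Function.Surjective (algTensorMap f g) :=
  TensorProduct.map_surjective (g := (f : A →ₗ[ℂ] A')) (g' := (g : B →ₗ[ℂ] B')) hf hg

end AlgTensorMap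

variable {A C J : Type*} [NonUnitalCStarAlgebra A] [NonUnitalCStarAlgebra C]
  [NonUnitalCStarAlgebra J]

theorem isClosed_rangeSubmodule {k : J →⋆ₙₐ[ℂ] A} (hk : Function.Injective k) :
    IsClosed (rangeSubmodule k : Set A) := isClosed_range_hom hk

theorem quotientNorm_eq_zero_iff {k : J →⋆ₙₐ[ℂ] A} (hk : Function.Injective k) {a : A} :
    quotientNorm k a = 0 ↔ a ∈ rangeSubmodule k :=
  QuotientAddGroup.norm_mk_eq_zero (S := (rangeSubmodule k).toAddSubgroup)
    (hS := isClosed_rangeSubmodule hk)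

theorem continuous_quotientNorm (k : J →⋆ₙₐ[ℂ] A) : Continuous (quotientNorm k) :=
  continuous_norm.comp <| AddMonoidHomClass.continuous_of_bound (rangeSubmodule k).mkQ 1 fun a => by
    rw [one_mul]
    exact Submodule.Quotient.norm_mk_le _ a

theorem surjective_of_quotientNorm_le {k : J →⋆ₙₐ[ℂ] A} {f : A →⋆ₙₐ[ℂ] C} (hf : DenseRange f)
    (hker : ∀ j, f (k j) = 0) (hle : ∀ a, quotientNorm k a ≤ ‖f a‖) : Function.Surjective f := by
  let F : NormedAddGroupHom A C := (f : A →+ C).mkNormedAddGroupHom 1 fun a => by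
    rw [one_mul]
    exact NonUnitalStarAlgHom.norm_apply_le f a
  -- Every value `f a` has a preimage of norm at most `2 ‖f a‖`.
  have controlled_range : F.SurjectiveOnWith F.range 2 := by
    rintro _ ⟨a, rfl⟩
    change ∃ a', f a' = f a ∧ ‖a'‖ ≤ 2 * ‖f a‖
    rcases eq_or_ne (f a) 0 with h₀ | h₀
    · exact ⟨0, by rw [map_zero, h₀], by rw [norm_zero]; positivity⟩
    obtain ⟨a', hmem, hlt⟩ := exists_sub_mem_norm_lt
      ((hle a).trans_lt (lt_two_mul_self (norm_pos_iff.mpr h₀)))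
    obtain ⟨j, hj⟩ := mem_rangeSubmodule.mp hmem
    refine ⟨a', ?_, hlt.le⟩
    rw [← sub_eq_zero, ← map_sub, ← neg_sub, map_neg, ← hj, hker, neg_zero]
  intro c
  obtain ⟨a, ha, -⟩ := controlled_closure_of_complete two_pos one_pos controlled_range c (hf c)
  exact ⟨a, ha⟩

variable {ι : J →⋆ₙₐ[ℂ] A} {π : A →⋆ₙₐ[ℂ] C}

theorem exists_mul_of_range_eq (h : Set.range ι = {a | π a = 0}) (a : A) (j : J) :
    ∃ j', ι j' = a * ι j := by
  have hj : π (ι j) = 0 := h.subset ⟨j, rfl⟩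
  exact h.superset (show π (a * ι j) = 0 by rw [map_mul, hj, mul_zero])

variable (B : Type*) [NonUnitalCStarAlgebra B]

theorem tmul_mul_tensorMap_mem_range (hι : Function.Injective ι)
    (hI : ∀ a j, ∃ j', ι j' = a * ι j) (a : A) (b : B) (y : MaxTensor J B) :
    tmul a b * tensorMap ι (id ℂ B) y ∈ rangeSubmodule (tensorMap ι (id ℂ B)) := by
  refine map_mem_of_dense_span (dense_span_tmul (dense_span_univ J) (dense_span_univ B))
    (isClosed_rangeSubmodule (tensorMap_ideal_id_injective hι hI))
    ((ContinuousLinearMap.mul ℂ _ (tmul a b)).comp (homCLM (tensorMap ι (id ℂ B)))) ?_ y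
  rintro _ ⟨j, -, b', -, rfl⟩
  obtain ⟨j', hj'⟩ := hI a j
  refine mem_rangeSubmodule.mpr ⟨tmul j' (b * b'), ?_⟩
  rw [ContinuousLinearMap.comp_apply, homCLM_apply, ContinuousLinearMap.mul_apply',
    tensorMap_tmul, tensorMap_tmul, tmul_mul_tmul, hj', NonUnitalStarAlgHom.coe_id, id_eq, id_eq]

theorem exists_tensorMap_eq_mul (hι : Function.Injective ι) (hI : ∀ a j, ∃ j', ι j' = a * ι j)
    (x : MaxTensor A B) (y : MaxTensor J B) :
    ∃ y', tensorMap ι (id ℂ B) y' = x * tensorMap ι (id ℂ B) y := by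
  refine mem_rangeSubmodule.mp <|
    map_mem_of_dense_span (dense_span_tmul (dense_span_univ A) (dense_span_univ B))
      (isClosed_rangeSubmodule (tensorMap_ideal_id_injective hι hI))
      ((ContinuousLinearMap.mul ℂ _).flip (tensorMap ι (id ℂ B) y)) ?_ x
  rintro _ ⟨a, -, b, -, rfl⟩
  rw [ContinuousLinearMap.flip_apply, ContinuousLinearMap.mul_apply']
  exact tmul_mul_tensorMap_mem_range B hι hI a b y

variable (hι : Function.Injective ι) (h : Set.range ι = {a | π a = 0}) (hπ : Function.Surjective π)

include h in
theorem tensorMap_comp_eq_zero (y : MaxTensor J B) :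
    tensorMap π (id ℂ B) (tensorMap ι (id ℂ B) y) = 0 := by
  have comp_eq_zero : (tensorMap π (id ℂ B)).comp (tensorMap ι (id ℂ B)) = 0 :=
    tensor_hom_ext fun j b => by
      have hj : π (ι j) = 0 := h.subset ⟨j, rfl⟩
      rw [NonUnitalStarAlgHom.comp_apply, tensorMap_tmul, tensorMap_tmul, hj, zero_tmul,
        NonUnitalStarAlgHom.zero_apply]
  exact DFunLike.congr_fun comp_eq_zero y

include h hπ in
theorem exists_algTensorMap_eq {x : A ⊗[ℂ] B} (hx : algTensorMap π (id ℂ B) x = 0) :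
    ∃ t, algTensorMap ι (id ℂ B) t = x := by
  have exact_hom : Function.Exact (ι : J →ₗ[ℂ] A) (π : A →ₗ[ℂ] C) := fun a =>
    ⟨fun ha => h.superset ha, fun ha => h.subset ha⟩
  exact (rTensor_exact B exact_hom hπ x).mp hx

include hι h hπ

-- The algebraic tensor product is right exact, so the quotient norm on `A ⊗ B` descends to a
-- `C⋆`-seminorm on the algebraic tensor product of `C` and `B`, and is at most the maximal one.
theorem quotientNorm_ofAlg_le (x : A ⊗[ℂ] B) :
    quotientNorm (tensorMap ι (id ℂ B)) (ofAlg A B x) ≤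
      maxSeminorm (C ⊗[ℂ] B) (algTensorMap π (id ℂ B) x) := by
  have hideal := exists_tensorMap_eq_mul B hι (exists_mul_of_range_eq h)
  set p := (quotientSeminorm hideal).pullback (ofAlg A B)
  have p_apply (t : A ⊗[ℂ] B) : p t = quotientNorm (tensorMap ι (id ℂ B)) (ofAlg A B t) := rfl
  have hsurj : Function.Surjective (algTensorMap π (id ℂ B)) :=
    algTensorMap_surjective hπ Function.surjective_id
  have hker (t : A ⊗[ℂ] B) (ht : algTensorMap π (id ℂ B) t = 0) : p t = 0 := by
    obtain ⟨s, rfl⟩ := exists_algTensorMap_eq B h hπ ht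
    rw [p_apply, quotientNorm_eq_zero_iff
      (tensorMap_ideal_id_injective hι (exists_mul_of_range_eq h)), ← tensorMap_ofAlg]
    exact mem_rangeSubmodule.mpr ⟨_, rfl⟩
  calc p x = p.descend hsurj hker (algTensorMap π (id ℂ B) x) := (p.descend_apply hsurj hker x).symm
    _ ≤ maxSeminorm (C ⊗[ℂ] B) (algTensorMap π (id ℂ B) x) := le_maxSeminorm _ _

theorem quotientNorm_le_norm_tensorMap (x : MaxTensor A B) :
    quotientNorm (tensorMap ι (id ℂ B)) x ≤ ‖tensorMap π (id ℂ B) x‖ := by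
  refine (denseRange_ofAlg A B).induction_on (p := fun x =>
    quotientNorm (tensorMap ι (id ℂ B)) x ≤ ‖tensorMap π (id ℂ B) x‖) x
    (isClosed_le (continuous_quotientNorm _) (continuous_hom _).norm) fun t => ?_
  rw [tensorMap_ofAlg, norm_ofAlg]
  exact quotientNorm_ofAlg_le B hι h hπ t

theorem range_tensorMap_id_eq :
    Set.range (tensorMap ι (id ℂ B)) = {x | tensorMap π (id ℂ B) x = 0} := by
  refine Set.Subset.antisymm ?_ fun x (hx : tensorMap π (id ℂ B) x = 0) => ?_
  · rintro _ ⟨y, rfl⟩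
    exact tensorMap_comp_eq_zero B h y
  · have hle := quotientNorm_le_norm_tensorMap B hι h hπ x
    rw [hx, norm_zero] at hle
    exact (quotientNorm_eq_zero_iff
      (tensorMap_ideal_id_injective hι (exists_mul_of_range_eq h))).mp
      (hle.antisymm (norm_nonneg _))

theorem tensorMap_id_surjective : Function.Surjective (tensorMap π (id ℂ B)) := by
  refine surjective_of_quotientNorm_le ?_ (tensorMap_comp_eq_zero B h)
    (quotientNorm_le_norm_tensorMap B hι h hπ)
  refine (denseRange_ofAlg C B).mono ?_
  rintro _ ⟨t, rfl⟩
  obtain ⟨s, rfl⟩ := algTensorMap_surjective (g := id ℂ B) hπ Function.surjective_id t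
  exact ⟨ofAlg A B s, tensorMap_ofAlg π (id ℂ B) s⟩

theorem range_id_tensorMap_eq :
    Set.range (tensorMap (id ℂ B) ι) = {x | tensorMap (id ℂ B) π x = 0} := by
  ext x
  have flip_mem_range : x ∈ Set.range (tensorMap (id ℂ B) ι) ↔
      tensorFlip B A x ∈ Set.range (tensorMap ι (id ℂ B)) := by
    refine ⟨?_, fun ⟨y, hy⟩ => ⟨tensorFlip J B y, ?_⟩⟩
    · rintro ⟨y, rfl⟩
      exact ⟨tensorFlip B J y, (tensorFlip_tensorMap _ _ y).symm⟩
    · rw [← tensorFlip_tensorMap, hy, tensorFlip_tensorFlip]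
  rw [flip_mem_range, range_tensorMap_id_eq B hι h hπ, Set.mem_ofPred_eq, Set.mem_ofPred_eq,
    ← tensorFlip_tensorMap]
  exact map_eq_zero_iff _ (Function.LeftInverse.injective tensorFlip_tensorFlip)

theorem id_tensorMap_surjective : Function.Surjective (tensorMap (id ℂ B) π) := fun z => by
  obtain ⟨x, hx⟩ := tensorMap_id_surjective B hι h hπ (tensorFlip B C z)
  refine ⟨tensorFlip A B x, ?_⟩
  rw [← tensorFlip_tensorMap, hx, tensorFlip_tensorFlip]

end Exact

/-! ### Exactness of the cotensor product -/

section CotensorExact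

variable {Γ A B C A' B' C' : Type*} [Group Γ] [NonUnitalCStarAlgebra A] [NonUnitalCStarAlgebra B]
  [NonUnitalCStarAlgebra C] [NonUnitalCStarAlgebra A'] [NonUnitalCStarAlgebra B']
  [NonUnitalCStarAlgebra C']
  {cA : CGammaStructure Γ A} {cB : CGammaStructure Γ B} {cC : CGammaStructure Γ C}
  {cA' : CGammaStructure Γ A'} {cB' : CGammaStructure Γ B'} {cC' : CGammaStructure Γ C'}
  {sA : CGammaStructure Γ (Cotensor cA cA')} {sB : CGammaStructure Γ (Cotensor cB cB')}
  {sC : CGammaStructure Γ (Cotensor cC cC')} {φ : A →⋆ₙₐ[ℂ] B} {φ' : A' →⋆ₙₐ[ℂ] B'}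
  {ψ : B →⋆ₙₐ[ℂ] C} {ψ' : B' →⋆ₙₐ[ℂ] C'}

theorem isMorphism_cotensorMap (hsA : IsRestriction cA cA' sA) (hsB : IsRestriction cB cB' sB)
    (hφ : IsMorphism cA cB φ) (hφ' : IsMorphism cA' cB' φ') :
    IsMorphism sA sB (cotensorMap hφ hφ') where
  left := hom_ext_of_dense (dense_span_cotensorTotal cA cA') <| by
    rintro z ⟨ζ, γ, η, a, b, ha, -, hz⟩
    have incl_map : cotensorIncl cB cB' (cotensorMap hφ hφ' z) = tmul (φ a) (φ' b) := by
      rw [cotensorIncl_cotensorMap, hz, tensorMap_tmul]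
    rw [NonUnitalStarAlgHom.comp_apply, NonUnitalStarAlgHom.comp_apply,
      left_restriction_apply hsA.left ha.left hz, tensorMap_tmul, NonUnitalStarAlgHom.coe_id, id_eq,
      left_restriction_apply hsB.left (ha.map hφ).left incl_map]
  right := hom_ext_of_dense (dense_span_cotensorTotal cA cA') <| by
    rintro z ⟨ζ, γ, η, a, b, -, hb, hz⟩
    have incl_map : cotensorIncl cB cB' (cotensorMap hφ hφ' z) = tmul (φ a) (φ' b) := by
      rw [cotensorIncl_cotensorMap, hz, tensorMap_tmul]
    rw [NonUnitalStarAlgHom.comp_apply, NonUnitalStarAlgHom.comp_apply,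
      right_restriction_apply hsA.right hb.right hz, tensorMap_tmul, NonUnitalStarAlgHom.coe_id,
      id_eq, right_restriction_apply hsB.right (hb.map hφ').right incl_map]

theorem cotensorMap_cotensorRetract (hφ : IsMorphism cA cB φ) (hφ' : IsMorphism cA' cB' φ')
    (x : MaxTensor A A') : cotensorMap hφ hφ' (cotensorRetract cA cA' x) =
      cotensorRetract cB cB' (tensorMap φ φ' x) :=
  cotensorIncl_injective cB cB' <| by
    rw [cotensorIncl_cotensorMap, cotensorIncl_cotensorRetract, cotensorIncl_cotensorRetract,
      cotensorProj_tensorMap hφ hφ']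

theorem range_cotensorMap_eq (hφ : IsMorphism cA cB φ) (hφ' : IsMorphism cA' cB' φ')
    (hψ : IsMorphism cB cC ψ) (hψ' : IsMorphism cB' cC' ψ')
    (hexact : Set.range (tensorMap φ φ') = {x | tensorMap ψ ψ' x = 0}) :
    Set.range (cotensorMap hφ hφ') = {z | cotensorMap hψ hψ' z = 0} := by
  refine Set.Subset.antisymm ?_ fun z (hz : cotensorMap hψ hψ' z = 0) => ?_
  · rintro _ ⟨x, rfl⟩
    refine cotensorIncl_injective cC cC' ?_
    rw [cotensorIncl_cotensorMap, cotensorIncl_cotensorMap, map_zero]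
    exact hexact.subset ⟨_, rfl⟩
  · have map_incl_eq_zero : tensorMap ψ ψ' (cotensorIncl cB cB' z) = 0 := by
      rw [← cotensorIncl_cotensorMap hψ hψ', hz, map_zero]
    obtain ⟨y, hy⟩ := hexact.superset map_incl_eq_zero
    exact ⟨cotensorRetract cA cA' y, by
      rw [cotensorMap_cotensorRetract, hy, cotensorRetract_cotensorIncl]⟩

theorem cotensorMap_surjective (hψ : IsMorphism cB cC ψ) (hψ' : IsMorphism cB' cC' ψ')
    (hsurj : Function.Surjective (tensorMap ψ ψ')) :
    Function.Surjective (cotensorMap hψ hψ') := fun z => by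
  obtain ⟨x, hx⟩ := hsurj (cotensorIncl cC cC' z)
  exact ⟨cotensorRetract cB cB' x, by
    rw [cotensorMap_cotensorRetract, hx, cotensorRetract_cotensorIncl]⟩

theorem isShortExact_cotensorMap (hsA : IsRestriction cA cA' sA) (hsB : IsRestriction cB cB' sB)
    (hsC : IsRestriction cC cC' sC) (hφ : IsMorphism cA cB φ) (hφ' : IsMorphism cA' cB' φ')
    (hψ : IsMorphism cB cC ψ) (hψ' : IsMorphism cB' cC' ψ')
    (hinj : Function.Injective (tensorMap φ φ'))
    (hexact : Set.range (tensorMap φ φ') = {x | tensorMap ψ ψ' x = 0})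
    (hsurj : Function.Surjective (tensorMap ψ ψ')) :
    IsShortExact sA sB sC (cotensorMap hφ hφ') (cotensorMap hψ hψ') where
  morphism_ι := isMorphism_cotensorMap hsA hsB hφ hφ'
  morphism_π := isMorphism_cotensorMap hsB hsC hψ hψ'
  ker_ι z hz := cotensorIncl_injective cA cA' <| hinj <| by
    rw [← cotensorIncl_cotensorMap hφ hφ', hz, map_zero, map_zero, map_zero]
  range_ι := range_cotensorMap_eq hφ hφ' hψ hψ' hexact
  range_π := Set.range_eq_univ.mpr (cotensorMap_surjective hψ hψ' hsurj)

end CotensorExact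

end CGamma

end

theorem mainTheorem9 (Γ : Type u) [Group Γ] (D : Type w) [NonUnitalCStarAlgebra D]
    (cD : CGamma.CGammaStructure Γ D) :
    -- the cotensor products with `D` are `(ℂ,Γ)`-C⋆-algebras
    (∀ (X : Type v) [NonUnitalCStarAlgebra X] (cX : CGamma.CGammaStructure Γ X),
      (∃! c : CGamma.CGammaStructure Γ (CGamma.Cotensor cX cD), CGamma.IsRestriction cX cD c) ∧
      (∃! c : CGamma.CGammaStructure Γ (CGamma.Cotensor cD cX), CGamma.IsRestriction cD cX c)) ∧
    -- the functors `- ⊗ D` and `D ⊗ -` are exact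
    (∀ (J A C : Type v) [NonUnitalCStarAlgebra J] [NonUnitalCStarAlgebra A]
      [NonUnitalCStarAlgebra C] (cJ : CGamma.CGammaStructure Γ J) (cA : CGamma.CGammaStructure Γ A)
      (cC : CGamma.CGammaStructure Γ C) (ι : J →⋆ₙₐ[ℂ] A) (π : A →⋆ₙₐ[ℂ] C)
      (h : CGamma.IsShortExact cJ cA cC ι π),
      (∀ (sJ : CGamma.CGammaStructure Γ (CGamma.Cotensor cJ cD))
        (sA : CGamma.CGammaStructure Γ (CGamma.Cotensor cA cD))
        (sC : CGamma.CGammaStructure Γ (CGamma.Cotensor cC cD)),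
        CGamma.IsRestriction cJ cD sJ → CGamma.IsRestriction cA cD sA →
        CGamma.IsRestriction cC cD sC →
        CGamma.IsShortExact sJ sA sC
          (CGamma.cotensorMap h.morphism_ι (CGamma.IsMorphism.refl cD))
          (CGamma.cotensorMap h.morphism_π (CGamma.IsMorphism.refl cD))) ∧
      (∀ (sJ : CGamma.CGammaStructure Γ (CGamma.Cotensor cD cJ))
        (sA : CGamma.CGammaStructure Γ (CGamma.Cotensor cD cA))
        (sC : CGamma.CGammaStructure Γ (CGamma.Cotensor cD cC)),
        CGamma.IsRestriction cD cJ sJ → CGamma.IsRestriction cD cA sA →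
        CGamma.IsRestriction cD cC sC →
        CGamma.IsShortExact sJ sA sC
          (CGamma.cotensorMap (CGamma.IsMorphism.refl cD) h.morphism_ι)
          (CGamma.cotensorMap (CGamma.IsMorphism.refl cD) h.morphism_π))) := by
  refine ⟨fun X _ cX => ⟨CGamma.existsUnique_isRestriction cX cD,
    CGamma.existsUnique_isRestriction cD cX⟩, fun J A C _ _ _ cJ cA cC ι π h => ?_⟩
  have hι : Function.Injective ι := (injective_iff_map_eq_zero ι).mpr h.ker_ι
  have hπ : Function.Surjective π := Set.range_eq_univ.mp h.range_π
  have hideal := CGamma.exists_mul_of_range_eq h.range_ι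
  refine ⟨fun sJ sA sC hJ hA hC => ?_, fun sJ sA sC hJ hA hC => ?_⟩
  · exact CGamma.isShortExact_cotensorMap hJ hA hC _ _ _ _
      (CGamma.tensorMap_ideal_id_injective hι hideal)
      (CGamma.range_tensorMap_id_eq D hι h.range_ι hπ)
      (CGamma.tensorMap_id_surjective D hι h.range_ι hπ)
  · exact CGamma.isShortExact_cotensorMap hJ hA hC _ _ _ _
      (CGamma.tensorMap_id_ideal_injective hι hideal)
      (CGamma.range_id_tensorMap_eq D hι h.range_ι hπ)
      (CGamma.id_tensorMap_surjective D hι h.range_ι hπ)
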